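/- Let $k$ be an algebraically closed field of characteristic $0$. Let $Q\subset\mathbb R^n$ be a full-dimensional lattice polytope (the convex hull of a finite set of points of $\mathbb Z^n$, with affine span $\mathbb R^n$), let $P$ be the monoid of lattice points of the cone over $Q\times\{1\}\subset\mathbb R^n\times\mathbb R$, let $\deg:P\to\mathbb Z$ be the height (the last coordinate), and let $X=\operatorname{Proj} k[P]$ be the projective normal toric variety of $Q$, with torus $j:T=\operatorname{Spec} k[\mathbb Z^n]\hookrightarrow X$ given by $P\to\mathbb Z^n$, $(m,h)\mapsto m$. (Every projective normal toric variety over $k$ is of this form, for the polytope of a sufficiently positive projective embedding.) Log structures are taken on the small étale site. Let $\mathcal M_X=j_*^{\log}\mathcal O_T^*$ be the standard log structure of $X$: its sections over an étale $V\to X$ are the functions on $V$ whose restriction to $V\times_X T$ is invertible. Let $A_P=\operatorname{Spec} k[P]$ with its standard log structure $\mathcal M_{A_P}$ (the one associated with $P\to k[P]$), let $U\subset A_P$ be the complement of the closed subscheme defined by the irrelevant ideal $\bigoplus_{d>0}k[P]_d$, and let $\mathcal M_U=\mathcal M_{A_P}|_U$. The homomorphism $P\to P\oplus\mathbb Z$,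 $p\mapsto(p,\deg p)$, induces an action of $\mathbb G_m$ on the log scheme $(U,\mathcal M_U)$; let $\mathcal M_P$ be the log structure on $X=U/\mathbb G_m$ to which $\mathcal M_U$ descends. Call a log structure $\mathcal M_Y$ on a scheme $Y$ generalized Deligne–Faltings if there exist a fine, saturated and sharp monoid $P'$ and a morphism $P'\to\overline{\mathcal M}_Y=\mathcal M_Y/\mathcal O_Y^*$ which étale locally on $Y$ lifts to a chart $P'\to\mathcal M_Y$. Then there is a unique morphism of log structures $\psi:\mathcal M_P\to\mathcal M_X$ on $X$, and it is an isomorphism. Moreover $(X,\mathcal M_X)$ is generalized Deligne–Faltings. -/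

import Mathlib

open CategoryTheory AlgebraicGeometry Limits Opposite
universe u

noncomputable section

namespace LogToric

instance : HasFilteredColimits CommMonCat.{u} where
  HasColimitsOfShape _ _ _ :=
    ⟨fun F => ⟨⟨_, CommMonCat.FilteredColimits.colimitCoconeIsColimit.{u, u} F⟩⟩⟩

section Objects

variable {X : Scheme.{u}}

/-- The underlying scheme of an object of the small étale site. -/
abbrev src (V : X.Etale) : Scheme.{u} := V.left

/-- The structure morphism of an object of the small étale site. -/
def str (V : X.Etale) : src V ⟶ X := V.hom

instance (V : X.Etale) : Etale (str V) := V.prop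

/-- The morphism of schemes underlying a morphism of the small étale site. -/
def srcMap {V W : X.Etale} (g : V ⟶ W) : src V ⟶ src W := g.left

instance {V W : X.Etale} (g : V ⟶ W) : Etale (srcMap g) := inferInstanceAs (Etale g.left)

/-- The morphism of the small étale site given by a morphism of schemes over the base. -/
def mkHom {V W : X.Etale} (φ : src V ⟶ src W) (h : φ ≫ str W = str V) : V ⟶ W :=
  MorphismProperty.Over.homMk φ h trivial

@[simp]
lemma srcMap_str {V W : X.Etale} (g : V ⟶ W) : srcMap g ≫ str W = str V := Over.w g.hom

@[simp] lemma srcMap_id (V : X.Etale) : srcMap (𝟙 V) = 𝟙 (src V) := rfl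

@[simp]
lemma srcMap_comp {U V W : X.Etale} (g : U ⟶ V) (h : V ⟶ W) :
    srcMap (g ≫ h) = srcMap g ≫ srcMap h := rfl

@[simp] lemma srcMap_mkHom {V W : X.Etale} (φ : src V ⟶ src W) (h : φ ≫ str W = str V) :
    srcMap (mkHom φ h) = φ := rfl

lemma hom_ext_srcMap {V W : X.Etale} {g h : V ⟶ W} (e : srcMap g = srcMap h) : g = h :=
  MorphismProperty.Over.Hom.ext e

@[simp] lemma str_mk {Y : Scheme.{u}} (f : Y ⟶ X) [Etale f] : str (Scheme.Etale.mk f) = f := rfl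

/-- The morphism between two objects `Etale.mk f`, `Etale.mk g` given by a morphism over `X`. -/
def mkMap {Y Z : Scheme.{u}} {f : Y ⟶ X} {g : Z ⟶ X} [Etale f] [Etale g] (φ : Y ⟶ Z)
    (h : φ ≫ g = f) : Scheme.Etale.mk f ⟶ Scheme.Etale.mk g :=
  mkHom (V := Scheme.Etale.mk f) (W := Scheme.Etale.mk g) φ h

lemma mkMap_id {Y : Scheme.{u}} {f : Y ⟶ X} [Etale f] (h : 𝟙 Y ≫ f = f) :
    mkMap (f := f) (g := f) (𝟙 Y) h = 𝟙 _ := rfl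

lemma mkMap_comp {Y Z T : Scheme.{u}} {f : Y ⟶ X} {g : Z ⟶ X} {k : T ⟶ X} [Etale f] [Etale g]
    [Etale k] (φ : Y ⟶ Z) (h : φ ≫ g = f) (ψ : Z ⟶ T) (h' : ψ ≫ k = g)
    (h'' : (φ ≫ ψ) ≫ k = f) :
    mkMap (φ ≫ ψ) h'' = mkMap (f := f) φ h ≫ mkMap ψ h' := rfl

end Objects

section Site

variable (S : Scheme.{u})

instance : HasSheafify (Scheme.AffineEtale.topology S) CommMonCat.{u} :=
  hasSheafifyEssentiallySmallSite.{u} _ _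

instance : ((Scheme.AffineEtale.Spec S).sheafPushforwardContinuous CommMonCat.{u}
    (Scheme.AffineEtale.topology S) S.smallEtaleTopology).IsEquivalence :=
  Functor.isEquivalence_of_isOneHypercoverDense _ _ _ _

instance : HasSheafify S.smallEtaleTopology CommMonCat.{u} :=
  Functor.IsDenseSubsite.hasSheafify_of_isEquivalence
    (Scheme.AffineEtale.topology S) S.smallEtaleTopology (Scheme.AffineEtale.Spec S)

instance : (Scheme.AffineEtale.topology S).WEqualsLocallyBijective CommMonCat.{u} :=
  .ofEssentiallySmall (Scheme.AffineEtale.topology S)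

instance : S.smallEtaleTopology.WEqualsLocallyBijective CommMonCat.{u} :=
  .transport _ _ _
    (Functor.IsDenseSubsite.coverPreserving (Scheme.AffineEtale.topology S) _
      (Scheme.AffineEtale.Spec S))

variable {S}

lemma mem_smallEtale_iff (V : S.Etale) (R : Sieve V) :
    R ∈ S.smallEtaleTopology V ↔
      ∀ x : V.left, ∃ (W : S.Etale) (f : W ⟶ V) (y : W.left), R f ∧ f.left y = x := by
  obtain ⟨ι, W, f, rfl⟩ := R.exists_eq_ofArrows
  rw [Scheme.ofArrows_mem_smallEtaleTopology_iff, Set.eq_univ_iff_forall]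
  refine forall_congr' fun x => ?_
  constructor
  · intro h
    obtain ⟨i, y, hy⟩ := Set.mem_iUnion.1 h
    exact ⟨W i, f i, y, Sieve.ofArrows_mk _ _ i, hy⟩
  · rintro ⟨Z, g, y, ⟨T, a, b, ⟨i⟩, rfl⟩, hy⟩
    refine Set.mem_iUnion.2 ⟨i, a.left y, ?_⟩
    rw [← hy]
    rfl

end Site

/-- A presheaf of commutative monoids is a sheaf iff its underlying presheaf of sets is. -/
lemma isSheaf_iff_types {C : Type*} [Category C] (J : GrothendieckTopology C)
    (F : Cᵒᵖ ⥤ CommMonCat.{u}) :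
    Presheaf.IsSheaf J F ↔ Presieve.IsSheaf J (F ⋙ forget CommMonCat.{u}) := by
  constructor
  · intro h X S hS x hx
    let E : CommMonCat.{u} := .of (ULift.{u} (Multiplicative ℕ))
    let p : ∀ {Z : C}, F.obj (op Z) → (E ⟶ F.obj (op Z)) := fun {Z} s =>
      CommMonCat.ofHom ((powersHom _ s).comp MulEquiv.ulift.toMonoidHom)
    have hp : ∀ {Z : C} (s : F.obj (op Z)), (p s).hom ⟨Multiplicative.ofAdd 1⟩ = s := fun s =>
      pow_one s
    have hp' : ∀ {Z : C} (g : E ⟶ F.obj (op Z)), g = p (g.hom ⟨Multiplicative.ofAdd 1⟩) := by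
      intro Z g
      ext ⟨a⟩
      have h1 : (⟨a⟩ : E) = (⟨Multiplicative.ofAdd 1⟩ : E) ^ (Multiplicative.toAdd a) := by
        apply ULift.ext
        change a = Multiplicative.ofAdd 1 ^ (Multiplicative.toAdd a)
        rw [← ofAdd_nsmul]
        simp
      conv_lhs => rw [h1]
      exact map_pow g.hom _ _
    have hpm : ∀ {Z Z' : C} (g : Z' ⟶ Z) (s : F.obj (op Z)),
        p s ≫ F.map g.op = p ((F.map g.op).hom s) := by
      intro Z Z' g s
      rw [hp' (p s ≫ F.map g.op)]
      congr 1
      exact congrArg (F.map g.op).hom (hp s)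
    obtain ⟨t, ht, ht'⟩ := h E S hS (fun Y f hf => p (x f hf)) (by
      intro Y₁ Y₂ Z g₁ g₂ f₁ f₂ h₁ h₂ e
      refine (hpm _ _).trans (Eq.trans ?_ (hpm _ _).symm)
      exact congrArg p (hx g₁ g₂ h₁ h₂ e))
    refine ⟨t.hom ⟨Multiplicative.ofAdd 1⟩, ?_, ?_⟩
    · intro Y f hf
      have := ConcreteCategory.congr_hom (ht f hf) (⟨Multiplicative.ofAdd 1⟩ : E)
      exact this.trans (hp _)
    · intro s hs
      rw [← ht' (p s) fun Y f hf => (hpm _ _).trans (congrArg p (hs f hf))]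
      exact (hp s).symm
  · intro h E X S hS x hx
    have hc : ∀ e : E, Presieve.FamilyOfElements.Compatible (P := F ⋙ forget CommMonCat.{u})
        (fun Y f hf => (x f hf).hom e : Presieve.FamilyOfElements _ S.arrows) := by
      intro e Y₁ Y₂ Z g₁ g₂ f₁ f₂ h₁ h₂ e'
      exact ConcreteCategory.congr_hom (hx g₁ g₂ h₁ h₂ e') e
    choose t ht ht' using fun e => h S hS _ (hc e)
    have hsep := fun (a b : F.obj (op X)) (hab : ∀ Y (f : Y ⟶ X), S f →
        F.map f.op a = F.map f.op b) => (h S hS).isSeparatedFor.ext (t₁ := a) (t₂ := b) hab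
    let T : E ⟶ F.obj (op X) := CommMonCat.ofHom
      { toFun := t
        map_one' := hsep _ _ fun Y f hf => by
          have : F.map f.op (t 1) = (x f hf).hom 1 := ht 1 f hf
          rw [this, map_one, map_one]
        map_mul' := fun a b => hsep _ _ fun Y f hf => by
          have h0 : F.map f.op (t (a * b)) = (x f hf).hom (a * b) := ht (a * b) f hf
          have h1 : F.map f.op (t a) = (x f hf).hom a := ht a f hf
          have h2 : F.map f.op (t b) = (x f hf).hom b := ht b f hf
          rw [map_mul, h0, h1, h2, map_mul] }
    refine ⟨T, ?_, ?_⟩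
    · intro Y f hf
      exact CommMonCat.hom_ext (MonoidHom.ext fun e => ht e f hf)
    · intro s hs
      refine CommMonCat.hom_ext (MonoidHom.ext fun e => ht' e _ ?_)
      intro Y f hf
      exact ConcreteCategory.congr_hom (hs f hf) e

/-- The structure sheaf of the small étale site, as a presheaf of multiplicative monoids. -/
def mulSheaf (X : Scheme.{u}) : X.Etaleᵒᵖ ⥤ CommMonCat.{u} where
  obj V := .of Γ(src V.unop, ⊤)
  map f := CommMonCat.ofHom ((srcMap f.unop).appTop.hom : _ →* _)
  map_id V := by rw [unop_id, srcMap_id, Scheme.Hom.id_appTop]; rfl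
  map_comp f g := by rw [unop_comp, srcMap_comp, Scheme.Hom.comp_appTop]; rfl

lemma etaleTopology_le_fppf : Scheme.etaleTopology.{u} ≤ Scheme.fppfTopology.{u} := by
  apply Precoverage.toGrothendieck_mono
  exact Scheme.precoverage_mono fun _ _ _ _ ↦ ⟨inferInstance, inferInstance⟩

/-- Global functions form a representable functor (represented by the affine line). -/
def ΓRepr : (Scheme.Γ.{u} ⋙ forget CommRingCat.{u}).RepresentableBy
    (Spec (.of (MvPolynomial PUnit.{u + 1} (ULift.{u} ℤ)))) where
  homEquiv {X} := (AffineSpace.toSpecMvPolyIntEquiv PUnit.{u+1} (X := X)).trans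
    (Equiv.funUnique PUnit.{u+1} _)
  homEquiv_comp f g := by
    simp
    rfl

lemma isSheaf_Γ : Presieve.IsSheaf Scheme.etaleTopology.{u} (Scheme.Γ ⋙ forget CommRingCat.{u}) := by
  have : Scheme.etaleTopology.{u}.Subcanonical :=
    .of_le etaleTopology_le_fppf
  have : (Scheme.Γ.{u} ⋙ forget CommRingCat.{u}).IsRepresentable := ΓRepr.isRepresentable
  exact GrothendieckTopology.Subcanonical.isSheaf_of_isRepresentable _

instance (X : Scheme.{u}) : (Scheme.Etale.forget X).IsContinuous X.smallEtaleTopology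
    (Scheme.etaleTopology.over X) := by
  have : RepresentablyFlat (Scheme.Etale.forget X) := flat_of_preservesFiniteLimits _
  refine Functor.isContinuous_of_coverPreserving (compatiblePreservingOfFlat _ _) ⟨?_⟩
  intro V R hR
  rw [mem_smallEtale_iff] at hR
  choose W f y hf hy using hR
  rw [GrothendieckTopology.mem_over_iff]
  refine (Scheme.mem_grothendieckTopology_iff (P := @Etale)).2 ?_
  let 𝒰 : V.left.Cover (Scheme.precoverage @Etale) :=
    Scheme.Cover.mkOfCovers V.left (fun w ↦ (W w).left) (fun w ↦ (f w).left)
      (fun w ↦ ⟨w, y w, hy w⟩) (fun w ↦ inferInstanceAs (Etale (f w).left))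
  refine ⟨𝒰, ?_⟩
  rintro _ _ ⟨i⟩
  rw [Sieve.overEquiv_iff]
  refine ⟨W i, f i, Over.homMk (𝟙 _) ?_, hf i, ?_⟩
  · change 𝟙 _ ≫ (W i).hom = (f i).left ≫ V.hom
    rw [Category.id_comp]
    exact (Over.w (f i).hom).symm
  · ext
    change (f i).left = 𝟙 _ ≫ (f i).left
    rw [Category.id_comp]

lemma mulSheaf_isSheaf (X : Scheme.{u}) :
    Presheaf.IsSheaf X.smallEtaleTopology (mulSheaf X) := by
  rw [isSheaf_iff_types]
  have : (Scheme.Etale.forget X ⋙ Over.forget X).IsContinuous X.smallEtaleTopology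
    Scheme.etaleTopology := Functor.isContinuous_comp _ _ _ (Scheme.etaleTopology.over X) _
  exact Functor.op_comp_isSheaf_of_isSheaf_type (F := Scheme.Etale.forget X ⋙ Over.forget X)
    (J := X.smallEtaleTopology) isSheaf_Γ

section Functors

variable {X Y : Scheme.{u}}

/-- The map induced on base changes along `f : Y ⟶ X`. -/
def baseChangeMap (f : Y ⟶ X) {V W : X.Etale} (g : V ⟶ W) :
    pullback (str V) f ⟶ pullback (str W) f :=
  pullback.lift (pullback.fst (str V) f ≫ srcMap g) (pullback.snd (str V) f)
    (by rw [Category.assoc, srcMap_str, pullback.condition])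

@[simp]
lemma baseChangeMap_fst (f : Y ⟶ X) {V W : X.Etale} (g : V ⟶ W) :
    baseChangeMap f g ≫ pullback.fst (str W) f = pullback.fst (str V) f ≫ srcMap g :=
  pullback.lift_fst _ _ _

@[simp]
lemma baseChangeMap_snd (f : Y ⟶ X) {V W : X.Etale} (g : V ⟶ W) :
    baseChangeMap f g ≫ pullback.snd (str W) f = pullback.snd (str V) f :=
  pullback.lift_snd _ _ _

lemma baseChangeMap_id (f : Y ⟶ X) (V : X.Etale) : baseChangeMap f (𝟙 V) = 𝟙 _ := by
  apply pullback.hom_ext <;> simp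

lemma baseChangeMap_comp (f : Y ⟶ X) {U V W : X.Etale} (g : U ⟶ V) (h : V ⟶ W) :
    baseChangeMap f (g ≫ h) = baseChangeMap f g ≫ baseChangeMap f h := by
  apply pullback.hom_ext
  · rw [baseChangeMap_fst, Category.assoc, baseChangeMap_fst, ← Category.assoc, baseChangeMap_fst,
      Category.assoc, srcMap_comp]
  · rw [baseChangeMap_snd, Category.assoc, baseChangeMap_snd, baseChangeMap_snd]

/-- Base change of étale schemes along `f : Y ⟶ X`. -/
def etalePullback (f : Y ⟶ X) : X.Etale ⥤ Y.Etale where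
  obj V := Scheme.Etale.mk (pullback.snd (str V) f)
  map {V W} g := mkMap (baseChangeMap f g) (baseChangeMap_snd f g)
  map_id V := hom_ext_srcMap (baseChangeMap_id f V)
  map_comp {U V W} g h := hom_ext_srcMap (baseChangeMap_comp f g h)

lemma isPullback_baseChangeMap (f : Y ⟶ X) {V W : X.Etale} (g : V ⟶ W) :
    IsPullback (pullback.fst (str V) f) (baseChangeMap f g) (srcMap g)
      (pullback.fst (str W) f) := by
  refine IsPullback.of_bot (h₃₁ := f) (v₂₁ := pullback.snd (str W) f) (v₂₂ := str W) ?_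
    (baseChangeMap_fst f g).symm ?_
  · rw [baseChangeMap_snd, srcMap_str]
    exact (IsPullback.of_hasPullback (str V) f)
  · exact (IsPullback.of_hasPullback (str W) f)

instance (f : Y ⟶ X) : (etalePullback f).IsContinuous X.smallEtaleTopology
    Y.smallEtaleTopology := by
  have e : etalePullback f ⋙ Scheme.Etale.forget Y ≅ Scheme.Etale.forget X ⋙ Over.pullback f :=
    Iso.refl _
  have : PreservesFiniteLimits (etalePullback f ⋙ Scheme.Etale.forget Y) :=
    preservesFiniteLimits_of_natIso e.symm
  have : PreservesFiniteLimits (etalePullback f) :=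
    preservesFiniteLimits_of_reflects_of_preserves _ (Scheme.Etale.forget Y)
  have : RepresentablyFlat (etalePullback f) := flat_of_preservesFiniteLimits _
  refine Functor.isContinuous_of_coverPreserving (compatiblePreservingOfFlat _ _) ⟨?_⟩
  intro V R hR
  rw [mem_smallEtale_iff] at hR ⊢
  intro x
  obtain ⟨W, g, y, hg, hy⟩ := hR (pullback.fst (str V) f x)
  obtain ⟨z, hz1, hz2⟩ := Scheme.Pullback.exists_preimage_pullback
    (f := srcMap g) (g := pullback.fst (str V) f) y x hy
  refine ⟨_, (etalePullback f).map g, (isPullback_baseChangeMap f g).isoPullback.inv z,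
    Sieve.image_mem_functorPushforward _ _ hg, ?_⟩
  change baseChangeMap f g ((isPullback_baseChangeMap f g).isoPullback.inv z) = x
  rw [← Scheme.Hom.comp_apply, IsPullback.isoPullback_inv_snd, hz2]

/-- Composition with an étale morphism, as a functor on étale schemes. -/
def etaleMap (f : Y ⟶ X) [Etale f] : Y.Etale ⥤ X.Etale where
  obj V := Scheme.Etale.mk (str V ≫ f)
  map {V W} g := mkMap (srcMap g) (by rw [← Category.assoc, srcMap_str])

instance (f : Y ⟶ X) [Etale f] : (etaleMap f).IsContinuous Y.smallEtaleTopology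
    X.smallEtaleTopology := by
  refine Functor.isContinuous_of_coverPreserving ⟨?_⟩ ⟨?_⟩
  · intro ℱ V T x hx W₁ W₂ Z f₁ f₂ g₁ g₂ hg₁ hg₂ e
    let φ₁ : src Z ⟶ src W₁ := srcMap f₁
    let φ₂ : src Z ⟶ src W₂ := srcMap f₂
    have e' : φ₁ ≫ srcMap g₁ = φ₂ ≫ srcMap g₂ := congrArg srcMap e
    have h2 : φ₂ ≫ str W₂ = φ₁ ≫ str W₁ := by
      rw [← srcMap_str g₁, ← srcMap_str g₂, ← Category.assoc, ← Category.assoc, e']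
    have : Etale φ₁ := inferInstanceAs (Etale (srcMap f₁))
    have hZ : (φ₁ ≫ str W₁) ≫ f = str Z := (Category.assoc _ _ _).trans (srcMap_str f₁)
    let Z' : Y.Etale := Scheme.Etale.mk (Y := src Z) (φ₁ ≫ str W₁)
    let f₁' : Z' ⟶ W₁ := mkHom (V := Z') φ₁ rfl
    let f₂' : Z' ⟶ W₂ := mkHom (V := Z') φ₂ h2
    let i : Z ⟶ (etaleMap f).obj Z' := mkHom (W := (etaleMap f).obj Z') (𝟙 (src Z))
      ((Category.id_comp _).trans hZ)
    have hi₁ : f₁ = i ≫ (etaleMap f).map f₁' :=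
      hom_ext_srcMap (Category.id_comp φ₁).symm
    have hi₂ : f₂ = i ≫ (etaleMap f).map f₂' :=
      hom_ext_srcMap (Category.id_comp φ₂).symm
    have hc : ((etaleMap f).op ⋙ ℱ.obj).map f₁'.op (x g₁ hg₁) =
        ((etaleMap f).op ⋙ ℱ.obj).map f₂'.op (x g₂ hg₂) :=
      hx f₁' f₂' hg₁ hg₂ (hom_ext_srcMap e')
    rw [hi₁, hi₂, op_comp, op_comp, Functor.map_comp, Functor.map_comp]
    exact congrArg (ℱ.obj.map i.op) hc
  · intro V R hR
    rw [mem_smallEtale_iff] at hR ⊢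
    intro x
    obtain ⟨W, g, y, hg, hy⟩ := hR x
    exact ⟨(etaleMap f).obj W, (etaleMap f).map g, y,
      Sieve.image_mem_functorPushforward _ _ hg, hy⟩

end Functors

section LogStructures

/-- A log structure on a scheme `X`: a sheaf of commutative monoids `M` on the small étale site
together with a morphism `α` to the multiplicative structure sheaf, which restricts to an
isomorphism from `α⁻¹(𝒪ˣ)` onto `𝒪ˣ`. -/
structure LogStructure (X : Scheme.{u}) where
  /-- the sheaf of monoids -/
  M : X.Etaleᵒᵖ ⥤ CommMonCat.{u}
  isSheaf : Presheaf.IsSheaf X.smallEtaleTopology M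
  /-- the structure morphism -/
  α : M ⟶ mulSheaf X
  existsUnique_of_isUnit : ∀ (V : X.Etale) (f : Γ(src V, ⊤)), IsUnit f →
    ∃! m : M.obj (op V), (α.app (op V)).hom m = f

namespace LogStructure

variable {X Y : Scheme.{u}}

/-- Morphisms of log structures on a fixed scheme. -/
@[ext]
structure Hom (L N : LogStructure X) where
  /-- the morphism of sheaves of monoids -/
  hom : L.M ⟶ N.M
  w : hom ≫ N.α = L.α

instance : Category (LogStructure X) where
  Hom := Hom
  id L := ⟨𝟙 _, Category.id_comp _⟩
  comp f g := ⟨f.hom ≫ g.hom, by rw [Category.assoc, g.w, f.w]⟩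

/-- The restriction of a log structure along an étale morphism `g : Y ⟶ X`. -/
def restrict (L : LogStructure X) (g : Y ⟶ X) [Etale g] : LogStructure Y where
  M := (etaleMap g).op ⋙ L.M
  isSheaf := (etaleMap g).op_comp_isSheaf_of_isSheaf Y.smallEtaleTopology X.smallEtaleTopology
    L.M L.isSheaf
  α :=
    { app := fun V => L.α.app (op ((etaleMap g).obj V.unop))
      naturality := fun _ _ h => L.α.naturality ((etaleMap g).map h.unop).op }
  existsUnique_of_isUnit V f hf := L.existsUnique_of_isUnit ((etaleMap g).obj V) f hf

end LogStructure

section Pushout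

variable {P P' R R' : Type*} [CommMonoid P] [CommMonoid P'] [CommMonoid R] [CommMonoid R']

/-- The congruence on `P × Rˣ` whose quotient is the pushout `P ⊕_{γ⁻¹(Rˣ)} Rˣ` of monoids. -/
def logCon (γ : P →* R) : Con (P × Rˣ) where
  r x y := ∃ a b : P, IsUnit (γ a) ∧ IsUnit (γ b) ∧ x.1 * a = y.1 * b ∧
    (x.2 : R) * γ b = y.2 * γ a
  iseqv :=
    { refl := fun x => ⟨1, 1, by simp, by simp, rfl, rfl⟩
      symm := fun ⟨a, b, ha, hb, h, h'⟩ => ⟨b, a, hb, ha, h.symm, h'.symm⟩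
      trans := by
        rintro x y z ⟨a, b, ha, hb, h, h'⟩ ⟨c, d, hc, hd, k, k'⟩
        refine ⟨a * c, b * d, by simp [ha, hc], by simp [hb, hd], ?_, ?_⟩
        · rw [← mul_assoc, h, mul_right_comm, k, mul_right_comm, mul_assoc]
        · rw [map_mul, map_mul, ← mul_assoc, h', mul_right_comm, k', mul_right_comm, mul_assoc] }
  mul' := by
    rintro x y z w ⟨a, b, ha, hb, h, h'⟩ ⟨c, d, hc, hd, k, k'⟩
    refine ⟨a * c, b * d, by simp [ha, hc], by simp [hb, hd], ?_, ?_⟩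
    · simp only [Prod.fst_mul]
      rw [mul_mul_mul_comm, h, k, mul_mul_mul_comm]
    · simp only [Prod.snd_mul, Units.val_mul, map_mul]
      rw [mul_mul_mul_comm, h', k', mul_mul_mul_comm]

/-- The pushout `P ⊕_{γ⁻¹(Rˣ)} Rˣ` of commutative monoids. -/
abbrev LogPushout (γ : P →* R) := (logCon γ).Quotient

/-- The structure map `(p, u) ↦ γ(p) u` of the pushout. -/
def LogPushout.toBase (γ : P →* R) : LogPushout γ →* R :=
  (logCon γ).lift ((γ.comp (MonoidHom.fst P Rˣ)) * ((Units.coeHom R).comp (MonoidHom.snd P Rˣ))) (by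
    rintro x y ⟨a, b, ha, hb, h, h'⟩
    rw [Con.ker_rel]
    change γ x.1 * x.2 = γ y.1 * y.2
    apply (ha.mul hb).mul_right_cancel
    rw [mul_mul_mul_comm, ← map_mul, h, h', map_mul, mul_mul_mul_comm (γ y.1), mul_comm (γ b)])

/-- Functoriality of the pushout. -/
def LogPushout.map {γ : P →* R} {γ' : P' →* R'} (h : P →* P') (φ : R →* R')
    (e : γ'.comp h = φ.comp γ) : LogPushout γ →* LogPushout γ' :=
  (logCon γ).lift ((logCon γ').mk'.comp (h.prodMap (Units.map φ))) (by
    rintro x y ⟨a, b, ha, hb, hab, hab'⟩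
    have e' : ∀ p, γ' (h p) = φ (γ p) := fun p => DFunLike.congr_fun e p
    rw [Con.ker_rel]
    refine (Con.eq _).2 ⟨h a, h b, ?_, ?_, ?_, ?_⟩
    · rw [e']; exact ha.map φ
    · rw [e']; exact hb.map φ
    · change h x.1 * h a = h y.1 * h b
      rw [← map_mul, hab, map_mul]
    · change φ x.2 * _ = φ y.2 * _
      rw [e', e', ← map_mul, hab', map_mul])

end Pushout

section Charts

variable {X Y : Scheme.{u}} {P P' : Type} [CommMonoid P] [CommMonoid P']

/-- The pullback of functions from `X` to an étale `X`-scheme. -/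
def resTop {P : Type} [CommMonoid P] (γ : P →* Γ(X, ⊤)) {Y : Scheme.{u}} (f : Y ⟶ X) :
    P →* Γ(Y, ⊤) :=
  (f.appTop.hom : Γ(X, ⊤) →* Γ(Y, ⊤)).comp γ

lemma resTop_resTop (γ : P →* Γ(X, ⊤)) {Z : Scheme.{u}} (f : Y ⟶ X) (g : Z ⟶ Y) :
    resTop (resTop γ f) g = resTop γ (g ≫ f) := by
  unfold resTop
  rw [Scheme.Hom.comp_appTop]
  rfl

/-- The presheaf of pushouts `P ⊕_{γ⁻¹(𝒪ˣ)} 𝒪ˣ` on the small étale site, where `P` is a monoid with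
a homomorphism `γ` to the global functions. -/
def preChart (γ : P →* Γ(X, ⊤)) : X.Etaleᵒᵖ ⥤ CommMonCat.{u} where
  obj V := .of (LogPushout (resTop γ (str V.unop)))
  map {V W} f := CommMonCat.ofHom (LogPushout.map (MonoidHom.id P)
    ((srcMap f.unop).appTop.hom : Γ(src V.unop, ⊤) →* Γ(src W.unop, ⊤)) (by
      change _ = resTop (resTop γ (str V.unop)) (srcMap f.unop)
      rw [resTop_resTop, srcMap_str]; rfl))
  map_id V := by
    refine CommMonCat.hom_ext (MonoidHom.ext fun x => ?_)
    induction x using Con.induction_on with | _ x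
    refine congrArg (logCon (resTop γ (str V.unop))).mk' (Prod.ext rfl (Units.ext ?_))
    exact ConcreteCategory.congr_hom ((mulSheaf X).map_id V) _
  map_comp {V W U} f g := by
    refine CommMonCat.hom_ext (MonoidHom.ext fun x => ?_)
    induction x using Con.induction_on with | _ x
    refine congrArg (logCon (resTop γ (str U.unop))).mk' (Prod.ext rfl (Units.ext ?_))
    exact ConcreteCategory.congr_hom ((mulSheaf X).map_comp f g) _

/-- The map from the presheaf of pushouts to the structure sheaf. -/
def preChartα (γ : P →* Γ(X, ⊤)) : preChart γ ⟶ mulSheaf X where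
  app V := CommMonCat.ofHom (LogPushout.toBase (resTop γ (str V.unop)))
  naturality V W f := by
    refine CommMonCat.hom_ext (MonoidHom.ext fun x => ?_)
    induction x using Con.induction_on with | _ x
    have h : resTop γ (str W.unop) x.1 =
        (srcMap f.unop).appTop.hom (resTop γ (str V.unop) x.1) := by
      change _ = resTop (resTop γ (str V.unop)) (srcMap f.unop) x.1
      rw [resTop_resTop, srcMap_str]
    change resTop γ (str W.unop) x.1 * (srcMap f.unop).appTop.hom x.2 =
      (srcMap f.unop).appTop.hom (resTop γ (str V.unop) x.1 * x.2)
    rw [h, map_mul]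

/-- The element of the pushout given by a unit. -/
def unitSection (γ : P →* Γ(X, ⊤)) (V : X.Etale) (u : Γ(src V, ⊤)ˣ) : (preChart γ).obj (op V) :=
  (logCon (resTop γ (str V))).mk' (1, u)

lemma eq_unitSection (γ : P →* Γ(X, ⊤)) (V : X.Etale) (x : (preChart γ).obj (op V))
    (u : Γ(src V, ⊤)ˣ) (hx : ((preChartα γ).app (op V)).hom x = (u : Γ(src V, ⊤))) :
    x = unitSection γ V u := by
  obtain ⟨⟨p, v⟩, rfl⟩ := (logCon (resTop γ (str V))).mk'_surjective x
  have hx : resTop γ (str V) p * (v : Γ(src V, ⊤)) = u := hx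
  have hp : IsUnit (resTop γ (str V) p) := by
    have := u.isUnit
    rw [← hx] at this
    exact isUnit_of_mul_isUnit_left this
  refine (Con.eq _).2 ⟨1, p, by simp, hp, by simp, ?_⟩
  rw [map_one, mul_one, ← hx, mul_comm]

lemma map_unitSection (γ : P →* Γ(X, ⊤)) {V W : X.Etale} (f : W ⟶ V) (u : Γ(src V, ⊤)ˣ) :
    ((preChart γ).map f.op).hom (unitSection γ V u) =
      unitSection γ W (Units.map ((srcMap f).appTop.hom : Γ(src V, ⊤) →* Γ(src W, ⊤)) u) := rfl

/-- The log structure on `X` associated with a homomorphism `γ` from a monoid `P` to the global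
functions on `X`: the sheafification of the presheaf of pushouts `P ⊕_{γ⁻¹(𝒪ˣ)} 𝒪ˣ`. -/
def chartLog (γ : P →* Γ(X, ⊤)) : LogStructure X where
  M := sheafify X.smallEtaleTopology (preChart γ)
  isSheaf := ((presheafToSheaf _ _).obj (preChart γ)).property
  α := sheafifyLift _ (preChartα γ) (mulSheaf_isSheaf X)
  existsUnique_of_isUnit := by
    intro V f hf
    let J := X.smallEtaleTopology
    let ι := toSheafify J (preChart γ)
    let A := sheafifyLift J (preChartα γ) (mulSheaf_isSheaf X)
    have hA : ∀ (W : X.Etale) (x : (preChart γ).obj (op W)),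
        (A.app (op W)).hom ((ι.app (op W)).hom x) = ((preChartα γ).app (op W)).hom x := by
      intro W x
      have := NatTrans.congr_app (toSheafify_sheafifyLift J (preChartα γ) (mulSheaf_isSheaf X))
        (op W)
      exact ConcreteCategory.congr_hom this x
    refine ⟨(ι.app (op V)).hom (unitSection γ V hf.unit), ?_, ?_⟩
    · refine (hA V _).trans ?_
      change resTop γ (str V) 1 * f = f
      rw [map_one, one_mul]
    · intro m hm
      have hs := Presheaf.imageSieve_mem J ι (U := op V) m
      have hsep := ((isSheaf_iff_types J _).1 (((presheafToSheaf J _).obj (preChart γ)).property) _ hs).isSeparatedFor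
      refine hsep.ext fun W g hg => ?_
      obtain ⟨x, hx⟩ := hg
      have hx : (ι.app (op W)).hom x = ((sheafify J (preChart γ)).map g.op).hom m := hx
      have h1 : x = unitSection γ W (Units.map
          ((srcMap g).appTop.hom : Γ(src V, ⊤) →* Γ(src W, ⊤)) hf.unit) := by
        apply eq_unitSection
        rw [← hA W x, hx]
        have := ConcreteCategory.congr_hom (A.naturality g.op) m
        refine this.trans ?_
        exact congrArg _ hm
      have h2 := ConcreteCategory.congr_hom (ι.naturality g.op) (unitSection γ V hf.unit)
      change ((sheafify J (preChart γ)).map g.op).hom m =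
        ((sheafify J (preChart γ)).map g.op).hom _
      rw [← hx, h1, ← map_unitSection]
      exact h2

/-- The map from the presheaf of pushouts to the associated log structure. -/
def chartι (γ : P →* Γ(X, ⊤)) : preChart γ ⟶ (chartLog γ).M :=
  toSheafify X.smallEtaleTopology (preChart γ)

lemma chartι_α (γ : P →* Γ(X, ⊤)) : chartι γ ≫ (chartLog γ).α = preChartα γ :=
  toSheafify_sheafifyLift _ _ _

/-- The sections of the associated log structure given by the elements of `P`. -/
def chartSection (γ : P →* Γ(X, ⊤)) (V : X.Etale) : P →* (chartLog γ).M.obj (op V) :=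
  ((chartι γ).app (op V)).hom.comp ((logCon (resTop γ (str V))).mk'.comp (MonoidHom.inl P _))

/-- For `f : Y ⟶ X` and compatible homomorphisms `γ : P → Γ(X, 𝒪)`, `γ' : P' → Γ(Y, 𝒪)`,
`h : P → P'`, the induced map of presheaves of pushouts. -/
def prePull {γ : P →* Γ(X, ⊤)} {γ' : P' →* Γ(Y, ⊤)} (f : Y ⟶ X) (h : P →* P')
    (e : γ'.comp h = resTop γ f) : preChart γ ⟶ (etalePullback f).op ⋙ preChart γ' where
  app V := CommMonCat.ofHom (LogPushout.map h
    ((pullback.fst (str V.unop) f).appTop.hom :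
      Γ(src V.unop, ⊤) →* Γ(pullback (str V.unop) f, ⊤)) (by
    have h1 : (resTop γ' (pullback.snd (str V.unop) f)).comp h =
        resTop (γ'.comp h) (pullback.snd (str V.unop) f) := rfl
    refine h1.trans ?_
    rw [e, resTop_resTop, ← pullback.condition, ← resTop_resTop]
    rfl))
  naturality V W g := by
    refine CommMonCat.hom_ext (MonoidHom.ext fun x => ?_)
    induction x using Con.induction_on with | _ x
    refine congrArg (logCon (resTop γ' (pullback.snd (str W.unop) f))).mk'
      (Prod.ext rfl (Units.ext ?_))
    have := Scheme.Hom.comp_appTop (baseChangeMap f g.unop) (pullback.fst (str V.unop) f)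
    rw [baseChangeMap_fst, Scheme.Hom.comp_appTop] at this
    exact ConcreteCategory.congr_hom this _

/-- The morphism `(Y, M_{γ'}) ⟶ (X, M_γ)` of log schemes over `f : Y ⟶ X` which is induced by a
homomorphism `h : P → P'`, as a map of sheaves `M_γ ⟶ f_* M_{γ'}`. -/
def chartPull {γ : P →* Γ(X, ⊤)} {γ' : P' →* Γ(Y, ⊤)} (f : Y ⟶ X) (h : P →* P')
    (e : γ'.comp h = resTop γ f) :
    (chartLog γ).M ⟶ (etalePullback f).op ⋙ (chartLog γ').M :=
  sheafifyLift _
    (prePull f h e ≫ Functor.whiskerLeft (etalePullback f).op (chartι γ'))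
    ((etalePullback f).op_comp_isSheaf_of_isSheaf X.smallEtaleTopology Y.smallEtaleTopology _
      (chartLog γ').isSheaf)

lemma chartι_chartPull {γ : P →* Γ(X, ⊤)} {γ' : P' →* Γ(Y, ⊤)} (f : Y ⟶ X) (h : P →* P')
    (e : γ'.comp h = resTop γ f) : chartι γ ≫ chartPull f h e =
      prePull f h e ≫ Functor.whiskerLeft (etalePullback f).op (chartι γ') :=
  toSheafify_sheafifyLift _ _ _

end Charts
end LogStructures

section Characteristic

variable {X Y : Scheme.{u}}

/-- The presheaf `V ↦ M(V) / M(V)ˣ`. -/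
def LogStructure.preChar (L : LogStructure X) : X.Etaleᵒᵖ ⥤ CommMonCat.{u} where
  obj V := .of (Associates (L.M.obj V))
  map {V W} f := CommMonCat.ofHom
    { toFun := Quotient.map (L.M.map f).hom fun _ _ h => h.map (L.M.map f).hom
      map_one' := congrArg Associates.mk (map_one (L.M.map f).hom)
      map_mul' := by
        rintro ⟨x⟩ ⟨y⟩
        exact congrArg Associates.mk (map_mul (L.M.map f).hom x y) }
  map_id V := by
    refine CommMonCat.hom_ext (MonoidHom.ext ?_)
    rintro ⟨x⟩
    exact congrArg Associates.mk (ConcreteCategory.congr_hom (L.M.map_id V) x)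
  map_comp f g := by
    refine CommMonCat.hom_ext (MonoidHom.ext ?_)
    rintro ⟨x⟩
    exact congrArg Associates.mk (ConcreteCategory.congr_hom (L.M.map_comp f g) x)

/-- The characteristic sheaf (ghost sheaf) `M / 𝒪ˣ` of a log structure. -/
def LogStructure.characteristic (L : LogStructure X) : X.Etaleᵒᵖ ⥤ CommMonCat.{u} :=
  sheafify X.smallEtaleTopology L.preChar

/-- The class in the characteristic sheaf of a section of a log structure. -/
def LogStructure.toCharacteristic (L : LogStructure X) (V : X.Etale) :
    L.M.obj (op V) →* L.characteristic.obj (op V) :=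
  ((toSheafify X.smallEtaleTopology L.preChar).app (op V)).hom.comp
    { toFun := Associates.mk
      map_one' := rfl
      map_mul' := fun _ _ => rfl }

/-- A homomorphism `β : P → M(V)` is a chart of the log structure over the étale `X`-scheme `V`:
the induced map from the log structure on `V` associated with `α ∘ β` to the restriction of the log
structure to `V` is an isomorphism. -/
def LogStructure.IsChart (L : LogStructure X) (V : X.Etale) {P : Type} [CommMonoid P]
    (β : P →* L.M.obj (op V)) : Prop :=
  ∃ e : chartLog (X := src V) ((L.α.app (op V)).hom.comp β) ⟶ L.restrict (str V), IsIso e ∧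
    ∀ (W : (src V).Etale) (p : P),
      (e.hom.app (op W)).hom (chartSection (X := src V) ((L.α.app (op V)).hom.comp β) W p) =
        (L.M.map (mkHom (V := (etaleMap (str V)).obj W) (W := V) (str W) rfl).op).hom (β p)

/-- A commutative monoid is fine, saturated and sharp: it is finitely generated and cancellative;
an element of the group of fractions with a positive power in the monoid lies in the monoid; the
only unit is `1`. -/
structure IsFineSaturatedSharp (P : Type) [CommMonoid P] : Prop where
  fg : Monoid.FG P
  cancel : IsCancelMul P
  saturated : ∀ (a b c : P) (n : ℕ), 0 < n → a ^ n = b ^ n * c → ∃ d, a = b * d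
  sharp : ∀ a : P, IsUnit a → a = 1

/-- A log structure is generalized Deligne–Faltings: there are a fine, saturated and sharp monoid
`P` and a homomorphism `ρ` from `P` to the global sections of the characteristic sheaf which
(étale) locally lifts to a chart of the log structure. -/
def LogStructure.IsGeneralizedDeligneFaltings (L : LogStructure X) : Prop :=
  ∃ (P : Type) (_ : CommMonoid P), IsFineSaturatedSharp P ∧
    ∃ ρ : P →* L.characteristic.obj (op (Scheme.Etale.mk (𝟙 X))),
      ∀ x : X, ∃ V : X.Etale, x ∈ Set.range (str V) ∧
        ∃ β : P →* L.M.obj (op V), L.IsChart V β ∧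
          ∀ p, L.toCharacteristic V (β p) =
            (L.characteristic.map (mkHom (W := Scheme.Etale.mk (𝟙 X)) (str V)
              (Category.comp_id _)).op).hom (ρ p)

end Characteristic

section Pulling

variable {X Y : Scheme.{u}}

/-- The pullback of functions along `f : Y ⟶ X`, as a map `𝒪_X ⟶ f_* 𝒪_Y`. -/
def mulPull (f : Y ⟶ X) : mulSheaf X ⟶ (etalePullback f).op ⋙ mulSheaf Y where
  app V := CommMonCat.ofHom ((pullback.fst (str V.unop) f).appTop.hom :
      Γ(src V.unop, ⊤) →* Γ(pullback (str V.unop) f, ⊤))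
  naturality V W g := by
    refine CommMonCat.hom_ext (MonoidHom.ext fun x => ?_)
    have := Scheme.Hom.comp_appTop (baseChangeMap f g.unop) (pullback.fst (str V.unop) f)
    rw [baseChangeMap_fst, Scheme.Hom.comp_appTop] at this
    exact ConcreteCategory.congr_hom this x

/-- The map on sections `M(V) → N(V')` induced by a map of sheaves `M ⟶ f_* N` and a map `V' ⟶ V`
over `f`. -/
def pullSection {f : Y ⟶ X} {M : X.Etaleᵒᵖ ⥤ CommMonCat.{u}} {N : Y.Etaleᵒᵖ ⥤ CommMonCat.{u}}
    (φ : M ⟶ (etalePullback f).op ⋙ N) {V : X.Etale} {V' : Y.Etale} (g : src V' ⟶ src V)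
    (hg : g ≫ str V = str V' ≫ f) : M.obj (op V) →* N.obj (op V') :=
  (N.map (mkHom (W := (etalePullback f).obj V) (pullback.lift g (str V') hg)
    (pullback.lift_snd _ _ _)).op).hom.comp (φ.app (op V)).hom

lemma pullSection_map {f : Y ⟶ X} {M : X.Etaleᵒᵖ ⥤ CommMonCat.{u}}
    {N : Y.Etaleᵒᵖ ⥤ CommMonCat.{u}} (φ : M ⟶ (etalePullback f).op ⋙ N)
    {V W : X.Etale} {V' W' : Y.Etale} (g : src V' ⟶ src V) (hg : g ≫ str V = str V' ≫ f)
    (k : src W' ⟶ src W) (hk : k ≫ str W = str W' ≫ f) (h : W ⟶ V) (h' : W' ⟶ V')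
    (e : k ≫ srcMap h = srcMap h' ≫ g) (m : M.obj (op V)) :
    pullSection φ k hk ((M.map h.op).hom m) = (N.map h'.op).hom (pullSection φ g hg m) := by
  have h1 := ConcreteCategory.congr_hom (φ.naturality h.op) m
  have h1 : (φ.app (op W)).hom ((M.map h.op).hom m) =
    (N.map ((etalePullback f).map h).op).hom ((φ.app (op V)).hom m) := h1
  unfold pullSection
  rw [MonoidHom.comp_apply, MonoidHom.comp_apply, h1]
  let i : W' ⟶ (etalePullback f).obj W := mkHom (W := (etalePullback f).obj W)
    (pullback.lift k (str W') hk) (pullback.lift_snd _ _ _)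
  let j : V' ⟶ (etalePullback f).obj V := mkHom (W := (etalePullback f).obj V)
    (pullback.lift g (str V') hg) (pullback.lift_snd _ _ _)
  have h2 : i ≫ (etalePullback f).map h = h' ≫ j := by
    apply hom_ext_srcMap
    change pullback.lift k (str W') hk ≫ baseChangeMap f h = srcMap h' ≫ pullback.lift g (str V') hg
    apply pullback.hom_ext
    · rw [Category.assoc, baseChangeMap_fst, pullback.lift_fst_assoc, Category.assoc,
        pullback.lift_fst, e]
    · rw [Category.assoc, baseChangeMap_snd, pullback.lift_snd, Category.assoc,
        pullback.lift_snd, srcMap_str]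
  have h3 : N.map ((etalePullback f).map h).op ≫ N.map i.op = N.map j.op ≫ N.map h'.op := by
    rw [← N.map_comp, ← N.map_comp, ← op_comp, ← op_comp, h2]
  exact ConcreteCategory.congr_hom h3 _

variable {P P' : Type} [CommMonoid P] [CommMonoid P']

lemma chartPull_α {γ : P →* Γ(X, ⊤)} {γ' : P' →* Γ(Y, ⊤)} (f : Y ⟶ X) (h : P →* P')
    (e : γ'.comp h = resTop γ f) :
    chartPull f h e ≫ Functor.whiskerLeft (etalePullback f).op (chartLog γ').α =
      (chartLog γ).α ≫ mulPull f := by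
  have hsh : Presheaf.IsSheaf X.smallEtaleTopology ((etalePullback f).op ⋙ mulSheaf Y) :=
    (etalePullback f).op_comp_isSheaf_of_isSheaf X.smallEtaleTopology Y.smallEtaleTopology _
      (mulSheaf_isSheaf Y)
  refine sheafify_hom_ext _ _ _ hsh ?_
  change chartι γ ≫ _ ≫ _ = chartι γ ≫ _ ≫ _
  rw [← Category.assoc, ← Category.assoc, chartι_chartPull, chartι_α, Category.assoc,
    ← Functor.whiskerLeft_comp, chartι_α]
  ext V x
  induction x using Con.induction_on with | _ x
  change resTop γ' (pullback.snd (str V.unop) f) (h x.1) *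
      ((pullback.fst (str V.unop) f).appTop.hom x.2) =
    (pullback.fst (str V.unop) f).appTop.hom (resTop γ (str V.unop) x.1 * x.2)
  rw [map_mul]
  congr 1
  change resTop (γ'.comp h) (pullback.snd (str V.unop) f) x.1 =
    resTop (resTop γ (str V.unop)) (pullback.fst (str V.unop) f) x.1
  rw [e, resTop_resTop, resTop_resTop, pullback.condition]

lemma α_pullSection {γ : P →* Γ(X, ⊤)} {γ' : P' →* Γ(Y, ⊤)} (f : Y ⟶ X) (h : P →* P')
    (e : γ'.comp h = resTop γ f) {V : X.Etale} {V' : Y.Etale} (g : src V' ⟶ src V)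
    (hg : g ≫ str V = str V' ≫ f) (m : (chartLog γ).M.obj (op V)) :
    ((chartLog γ').α.app (op V')).hom (pullSection (chartPull f h e) g hg m) =
      g.appTop.hom (((chartLog γ).α.app (op V)).hom m) := by
  let j : V' ⟶ (etalePullback f).obj V := mkHom (W := (etalePullback f).obj V)
    (pullback.lift g (str V') hg) (pullback.lift_snd _ _ _)
  have h1 := ConcreteCategory.congr_hom ((chartLog γ').α.naturality j.op)
    (((chartPull f h e).app (op V)).hom m)
  have h2 := ConcreteCategory.congr_hom (NatTrans.congr_app (chartPull_α f h e) (op V)) m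
  refine h1.trans ((congrArg ((mulSheaf Y).map j.op).hom h2).trans ?_)
  have h3 := Scheme.Hom.comp_appTop (pullback.lift g (str V') hg) (pullback.fst (str V) f)
  rw [pullback.lift_fst] at h3
  exact (ConcreteCategory.congr_hom h3 _).symm

end Pulling

section Subpresheaf

variable {C : Type*} [Category C] (J : GrothendieckTopology C)

/-- The subpresheaf of monoids given by submonoids which are stable under restriction. -/
def subPresheaf (F : Cᵒᵖ ⥤ CommMonCat.{u}) (S : ∀ V : Cᵒᵖ, Submonoid (F.obj V))
    (hS : ∀ {V W : Cᵒᵖ} (f : V ⟶ W) (x : F.obj V), x ∈ S V → (F.map f).hom x ∈ S W) :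
    Cᵒᵖ ⥤ CommMonCat.{u} where
  obj V := .of (S V)
  map {V W} f := CommMonCat.ofHom
    (((F.map f).hom.comp (S V).subtype).codRestrict (S W) fun x => hS f x.1 x.2)
  map_id V := by
    refine CommMonCat.hom_ext (MonoidHom.ext fun x => Subtype.ext ?_)
    exact ConcreteCategory.congr_hom (F.map_id V) _
  map_comp f g := by
    refine CommMonCat.hom_ext (MonoidHom.ext fun x => Subtype.ext ?_)
    exact ConcreteCategory.congr_hom (F.map_comp f g) _

lemma subPresheaf_isSheaf (F : Cᵒᵖ ⥤ CommMonCat.{u}) (S : ∀ V : Cᵒᵖ, Submonoid (F.obj V))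
    (hS : ∀ {V W : Cᵒᵖ} (f : V ⟶ W) (x : F.obj V), x ∈ S V → (F.map f).hom x ∈ S W)
    (hF : Presheaf.IsSheaf J F)
    (hloc : ∀ (V : C) (x : F.obj (op V)) (R : Sieve V), R ∈ J V →
      (∀ (W : C) (f : W ⟶ V), R f → (F.map f.op).hom x ∈ S (op W)) → x ∈ S (op V)) :
    Presheaf.IsSheaf J (subPresheaf F S hS) := by
  rw [isSheaf_iff_types] at hF ⊢
  intro V R hR x hx
  obtain ⟨t, ht, ht'⟩ := hF R hR (fun W f hf => (x f hf).1) (by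
    intro Y₁ Y₂ Z g₁ g₂ f₁ f₂ h₁ h₂ e
    exact congrArg Subtype.val (hx g₁ g₂ h₁ h₂ e))
  refine ⟨⟨t, hloc V t R hR fun W f hf => ?_⟩, ?_, ?_⟩
  · have h1 : (F.map f.op).hom t = (x f hf).1 := ht f hf
    rw [h1]
    exact (x f hf).2
  · intro W f hf
    exact Subtype.ext (ht f hf)
  · intro s hs
    exact Subtype.ext (ht' s.1 fun W f hf => congrArg Subtype.val (hs f hf))

/-- The product of two presheaves of monoids. -/
def prodPresheaf (F G : Cᵒᵖ ⥤ CommMonCat.{u}) : Cᵒᵖ ⥤ CommMonCat.{u} where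
  obj V := .of (F.obj V × G.obj V)
  map f := CommMonCat.ofHom ((F.map f).hom.prodMap (G.map f).hom)
  map_id V := by
    refine CommMonCat.hom_ext (MonoidHom.ext fun x => Prod.ext ?_ ?_)
    · exact ConcreteCategory.congr_hom (F.map_id V) x.1
    · exact ConcreteCategory.congr_hom (G.map_id V) x.2
  map_comp f g := by
    refine CommMonCat.hom_ext (MonoidHom.ext fun x => Prod.ext ?_ ?_)
    · exact ConcreteCategory.congr_hom (F.map_comp f g) x.1
    · exact ConcreteCategory.congr_hom (G.map_comp f g) x.2

lemma prodPresheaf_isSheaf (F G : Cᵒᵖ ⥤ CommMonCat.{u}) (hF : Presheaf.IsSheaf J F)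
    (hG : Presheaf.IsSheaf J G) : Presheaf.IsSheaf J (prodPresheaf F G) := by
  rw [isSheaf_iff_types] at hF hG ⊢
  intro V R hR x hx
  obtain ⟨s, hs, hs'⟩ := hF R hR (fun W f hf => (x f hf).1) (by
    intro Y₁ Y₂ Z g₁ g₂ f₁ f₂ h₁ h₂ e
    exact congrArg Prod.fst (hx g₁ g₂ h₁ h₂ e))
  obtain ⟨t, ht, ht'⟩ := hG R hR (fun W f hf => (x f hf).2) (by
    intro Y₁ Y₂ Z g₁ g₂ f₁ f₂ h₁ h₂ e
    exact congrArg Prod.snd (hx g₁ g₂ h₁ h₂ e))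
  refine ⟨(s, t), fun W f hf => Prod.ext (hs f hf) (ht f hf), fun w hw => Prod.ext ?_ ?_⟩
  · exact hs' w.1 fun W f hf => congrArg Prod.fst (hw f hf)
  · exact ht' w.2 fun W f hf => congrArg Prod.snd (hw f hf)

end Subpresheaf

section Compactifying

variable {X T : Scheme.{u}} (j : T ⟶ X)

lemma isUnit_iff_basicOpen {Z : Scheme.{u}} (f : Γ(Z, ⊤)) : IsUnit f ↔ Z.basicOpen f = ⊤ := by
  refine ⟨fun h => Z.basicOpen_of_isUnit h, fun h => ?_⟩
  refine RingedSpace.isUnit_of_isUnit_germ _ ⊤ f fun x hx => ?_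
  have : x ∈ Z.basicOpen f := h.symm ▸ hx
  exact (Scheme.mem_basicOpen Z f x hx).1 this

lemma mulPull_naturality {V W : X.Etale} (g : W ⟶ V) (f : Γ(src V, ⊤)) :
    (pullback.fst (str W) j).appTop.hom ((srcMap g).appTop.hom f) =
      (baseChangeMap j g).appTop.hom ((pullback.fst (str V) j).appTop.hom f) :=
  ConcreteCategory.congr_hom ((mulPull j).naturality g.op) f

/-- The functions whose pullback along `j` is invertible. -/
def compactifyingSubmonoid (V : X.Etale) : Submonoid Γ(src V, ⊤) :=
  (IsUnit.submonoid Γ(pullback (str V) j, ⊤)).comap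
    ((pullback.fst (str V) j).appTop.hom : Γ(src V, ⊤) →* Γ(pullback (str V) j, ⊤))

lemma mem_compactifyingSubmonoid {V : X.Etale} {f : Γ(src V, ⊤)} :
    f ∈ compactifyingSubmonoid j V ↔ IsUnit ((pullback.fst (str V) j).appTop.hom f) := Iff.rfl

lemma compactifyingSubmonoid_map {V W : X.Etale} (g : W ⟶ V) (f : Γ(src V, ⊤))
    (hf : f ∈ compactifyingSubmonoid j V) :
    (srcMap g).appTop.hom f ∈ compactifyingSubmonoid j W := by
  rw [mem_compactifyingSubmonoid] at hf ⊢
  rw [mulPull_naturality]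
  exact hf.map _

lemma compactifyingSubmonoid_of_locally (V : X.Etale) (f : Γ(src V, ⊤)) (R : Sieve V)
    (hR : R ∈ X.smallEtaleTopology V)
    (h : ∀ (W : X.Etale) (g : W ⟶ V), R g →
      (srcMap g).appTop.hom f ∈ compactifyingSubmonoid j W) :
    f ∈ compactifyingSubmonoid j V := by
  rw [mem_compactifyingSubmonoid, isUnit_iff_basicOpen, eq_top_iff]
  intro x _
  rw [mem_smallEtale_iff] at hR
  obtain ⟨W, g, y, hg, hy⟩ := hR (pullback.fst (str V) j x)
  obtain ⟨z, hz1, hz2⟩ := Scheme.Pullback.exists_preimage_pullback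
    (f := srcMap g) (g := pullback.fst (str V) j) y x hy
  have h1 := h W g hg
  rw [mem_compactifyingSubmonoid, mulPull_naturality, isUnit_iff_basicOpen,
    ← Scheme.preimage_basicOpen_top] at h1
  have h2 : baseChangeMap j g ((isPullback_baseChangeMap j g).isoPullback.inv z) = x := by
    rw [← Scheme.Hom.comp_apply, IsPullback.isoPullback_inv_snd, hz2]
  have h3 : (isPullback_baseChangeMap j g).isoPullback.inv z ∈
      (baseChangeMap j g) ⁻¹ᵁ (Scheme.basicOpen _ ((pullback.fst (str V) j).appTop.hom f)) := by
    rw [h1]; trivial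
  rw [← h2]
  exact h3

/-- The log structure `j_*^{log} 𝒪_Tˣ` on `X` associated with `j : T ⟶ X` (an open immersion): its
sections are the functions on `X` whose restriction to `T` is invertible. -/
def compactifyingLog : LogStructure X where
  M := subPresheaf (mulSheaf X) (fun V => compactifyingSubmonoid j V.unop)
    (fun f x hx => compactifyingSubmonoid_map j f.unop x hx)
  isSheaf := subPresheaf_isSheaf _ _ _ _ (mulSheaf_isSheaf X) fun V x R hR h =>
    compactifyingSubmonoid_of_locally j V x R hR h
  α :=
    { app := fun V => CommMonCat.ofHom (X := compactifyingSubmonoid j V.unop)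
          (compactifyingSubmonoid j V.unop).subtype
      naturality := fun _ _ _ => rfl }
  existsUnique_of_isUnit V f hf := ⟨⟨f, hf.map (pullback.fst (str V) j).appTop.hom⟩, rfl,
    fun _ hm => Subtype.ext hm⟩

end Compactifying

section Descent

variable {X U W A B : Scheme.{u}} {P P' : Type} [CommMonoid P] [CommMonoid P']

/-- For `c : W ⟶ U` over `X`, the map `V ×_X W ⟶ V ×_X U`. -/
def overMap {π : U ⟶ X} {q : W ⟶ X} (c : W ⟶ U) (hc : c ≫ π = q) (V : X.Etale) :
    pullback (str V) q ⟶ pullback (str V) π :=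
  pullback.lift (pullback.fst (str V) q) (pullback.snd (str V) q ≫ c)
    (by rw [Category.assoc, hc, pullback.condition])

lemma overMap_baseChangeMap {π : U ⟶ X} {q : W ⟶ X} (c : W ⟶ U) (hc : c ≫ π = q) {V V' : X.Etale}
    (g : V' ⟶ V) : overMap c hc V' ≫ baseChangeMap π g = baseChangeMap q g ≫ overMap c hc V := by
  unfold overMap
  apply pullback.hom_ext
  · rw [Category.assoc, baseChangeMap_fst, pullback.lift_fst_assoc, Category.assoc,
      pullback.lift_fst, baseChangeMap_fst]
  · rw [Category.assoc, baseChangeMap_snd, pullback.lift_snd, Category.assoc,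
      pullback.lift_snd, ← Category.assoc, baseChangeMap_snd]

/-- For an étale `X`-scheme `V` and `U` étale over `A`, the scheme `V ×_X U` as an étale
`A`-scheme. -/
def liftEtale (π : U ⟶ X) (ι : U ⟶ A) [Etale ι] : X.Etale ⥤ A.Etale :=
  etalePullback π ⋙ etaleMap ι

lemma liftEtale_isSheaf (π : U ⟶ X) (ι : U ⟶ A) [Etale ι] (F : A.Etaleᵒᵖ ⥤ CommMonCat.{u})
    (hF : Presheaf.IsSheaf A.smallEtaleTopology F) :
    Presheaf.IsSheaf X.smallEtaleTopology ((liftEtale π ι).op ⋙ F) :=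
  (etalePullback π).op_comp_isSheaf_of_isSheaf X.smallEtaleTopology U.smallEtaleTopology _
    ((etaleMap ι).op_comp_isSheaf_of_isSheaf U.smallEtaleTopology A.smallEtaleTopology _ hF)

/-- For a commutative square with sides `c : W ⟶ U` and `f : B ⟶ A`, the pullback of sections over
`V ×_X U` of the log structure on `A` to sections over `V ×_X W` of the log structure on `B`. -/
def descentPull {π : U ⟶ X} {q : W ⟶ X} (ι : U ⟶ A) [Etale ι] (κ : W ⟶ B) [Etale κ]
    (c : W ⟶ U) (hc : c ≫ π = q) (f : B ⟶ A) (hf : c ≫ ι = κ ≫ f)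
    {γ : P →* Γ(A, ⊤)} {γ' : P' →* Γ(B, ⊤)} (h : P →* P') (e : γ'.comp h = resTop γ f)
    (V : X.Etale) :
    (chartLog γ).M.obj (op ((liftEtale π ι).obj V)) →*
      (chartLog γ').M.obj (op ((liftEtale q κ).obj V)) :=
  pullSection (V := (liftEtale π ι).obj V) (V' := (liftEtale q κ).obj V) (chartPull f h e)
    (overMap c hc V) (by
      change overMap c hc V ≫ pullback.snd (str V) π ≫ ι = (pullback.snd (str V) q ≫ κ) ≫ f
      unfold overMap
      rw [pullback.lift_snd_assoc, Category.assoc, hf, Category.assoc])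

lemma descentPull_map {π : U ⟶ X} {q : W ⟶ X} (ι : U ⟶ A) [Etale ι] (κ : W ⟶ B) [Etale κ]
    (c : W ⟶ U) (hc : c ≫ π = q) (f : B ⟶ A) (hf : c ≫ ι = κ ≫ f)
    {γ : P →* Γ(A, ⊤)} {γ' : P' →* Γ(B, ⊤)} (h : P →* P') (e : γ'.comp h = resTop γ f)
    {V V' : X.Etale} (g : V' ⟶ V) (m : (chartLog γ).M.obj (op ((liftEtale π ι).obj V))) :
    descentPull ι κ c hc f hf h e V' (((chartLog γ).M.map ((liftEtale π ι).map g).op).hom m) =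
      ((chartLog γ').M.map ((liftEtale q κ).map g).op).hom
        (descentPull ι κ c hc f hf h e V m) :=
  pullSection_map _ _ _ _ _ ((liftEtale π ι).map g) ((liftEtale q κ).map g)
    (overMap_baseChangeMap c hc g) m

lemma α_descentPull {π : U ⟶ X} {q : W ⟶ X} (ι : U ⟶ A) [Etale ι] (κ : W ⟶ B) [Etale κ]
    (c : W ⟶ U) (hc : c ≫ π = q) (f : B ⟶ A) (hf : c ≫ ι = κ ≫ f)
    {γ : P →* Γ(A, ⊤)} {γ' : P' →* Γ(B, ⊤)} (h : P →* P') (e : γ'.comp h = resTop γ f)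
    (V : X.Etale) (m : (chartLog γ).M.obj (op ((liftEtale π ι).obj V))) :
    ((chartLog γ').α.app (op ((liftEtale q κ).obj V))).hom (descentPull ι κ c hc f hf h e V m) =
      (overMap c hc V).appTop.hom (((chartLog γ).α.app (op ((liftEtale π ι).obj V))).hom m) :=
  α_pullSection _ _ _ _ _ m

variable {π : U ⟶ X} {q : W ⟶ X} (ι : U ⟶ A) [Etale ι] (κ : W ⟶ B) [Etale κ]
    (c : W ⟶ U) (hc : c ≫ π = q) (f : B ⟶ A) (hf : c ≫ ι = κ ≫ f)
    (d : W ⟶ U) (hd : d ≫ π = q) (g : B ⟶ A) (hg : d ≫ ι = κ ≫ g)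
    {γ : P →* Γ(A, ⊤)} {γ' : P' →* Γ(B, ⊤)} (h : P →* P') (eh : γ'.comp h = resTop γ f)
    (k : P →* P') (ek : γ'.comp k = resTop γ g)

/-- The pairs `(t, m)` of a function `t` on `V` and a section `m` over `V ×_X U` of the log
structure, which have the same image in the functions on `V ×_X U` and such that the two pullbacks
of `m` to `V ×_X W` agree. -/
def descentSubmonoid (V : X.Etale) :
    Submonoid (Γ(src V, ⊤) × (chartLog γ).M.obj (op ((liftEtale π ι).obj V))) where
  carrier := {x |
    ((chartLog γ).α.app (op ((liftEtale π ι).obj V))).hom x.2 =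
      (pullback.fst (str V) π).appTop.hom x.1 ∧
    descentPull ι κ c hc f hf h eh V x.2 = descentPull ι κ d hd g hg k ek V x.2}
  one_mem' := ⟨(map_one ((chartLog γ).α.app _).hom).trans
    (map_one (pullback.fst (str V) π).appTop.hom).symm, (map_one _).trans (map_one _).symm⟩
  mul_mem' := by
    rintro x y ⟨h1, h2⟩ ⟨h3, h4⟩
    refine ⟨(map_mul ((chartLog γ).α.app _).hom _ _).trans (Eq.trans ?_
      (map_mul (pullback.fst (str V) π).appTop.hom _ _).symm), (map_mul _ _ _).trans
      (Eq.trans ?_ (map_mul _ _ _).symm)⟩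
    · exact congrArg₂ (fun s t : Γ(pullback (str V) π, ⊤) => s * t) h1 h3
    · rw [h2, h4]

/-- The presheaf of pairs of a function on `V` and a section over `V ×_X U`. -/
def descentAmbient (π : U ⟶ X) (ι : U ⟶ A) [Etale ι] (γ : P →* Γ(A, ⊤)) :
    X.Etaleᵒᵖ ⥤ CommMonCat.{u} :=
  prodPresheaf (mulSheaf X) ((liftEtale π ι).op ⋙ (chartLog γ).M)

lemma α_liftEtale_map {V V' : X.Etale} (t : V' ⟶ V)
    (m : (chartLog γ).M.obj (op ((liftEtale π ι).obj V))) :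
    ((chartLog γ).α.app (op ((liftEtale π ι).obj V'))).hom
      (((chartLog γ).M.map ((liftEtale π ι).map t).op).hom m) =
    (baseChangeMap π t).appTop.hom
      (((chartLog γ).α.app (op ((liftEtale π ι).obj V))).hom m) :=
  ConcreteCategory.congr_hom ((chartLog γ).α.naturality ((liftEtale π ι).map t).op) m

lemma descentSubmonoid_map {V V' : X.Etale} (t : V' ⟶ V)
    (x : (descentAmbient π ι γ).obj (op V))
    (hx : x ∈ descentSubmonoid ι κ c hc f hf d hd g hg h eh k ek V) :
    ((descentAmbient π ι γ).map t.op).hom x ∈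
      descentSubmonoid ι κ c hc f hf d hd g hg h eh k ek V' := by
  obtain ⟨h1, h2⟩ := hx
  refine ⟨?_, ?_⟩
  · refine (α_liftEtale_map ι t x.2).trans ?_
    rw [h1]
    exact (mulPull_naturality π t x.1).symm
  · refine (descentPull_map ι κ c hc f hf h eh t x.2).trans (Eq.trans ?_
      (descentPull_map ι κ d hd g hg k ek t x.2).symm)
    rw [h2]

lemma descentSubmonoid_of_locally (V : X.Etale) (x : (descentAmbient π ι γ).obj (op V))
    (R : Sieve V) (hR : R ∈ X.smallEtaleTopology V)
    (H : ∀ (V' : X.Etale) (t : V' ⟶ V), R t → ((descentAmbient π ι γ).map t.op).hom x ∈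
      descentSubmonoid ι κ c hc f hf d hd g hg h eh k ek V') :
    x ∈ descentSubmonoid ι κ c hc f hf d hd g hg h eh k ek V := by
  have s1 := ((isSheaf_iff_types _ _).1 ((etalePullback π).op_comp_isSheaf_of_isSheaf
    X.smallEtaleTopology U.smallEtaleTopology _ (mulSheaf_isSheaf U)) R hR).isSeparatedFor
  have s2 := ((isSheaf_iff_types _ _).1 (liftEtale_isSheaf q κ _
    (chartLog γ').isSheaf) R hR).isSeparatedFor
  refine ⟨s1.ext fun V' t ht => ?_, s2.ext fun V' t ht => ?_⟩
  · refine (α_liftEtale_map ι t x.2).symm.trans ((H V' t ht).1.trans ?_)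
    exact mulPull_naturality π t x.1
  · exact (descentPull_map ι κ c hc f hf h eh t x.2).symm.trans ((H V' t ht).2.trans
      (descentPull_map ι κ d hd g hg k ek t x.2))

/-- The log structure on `X` which is obtained by descending, along `π : U ⟶ X`, the restriction
to `U` of the log structure on `A` associated with `γ : P → Γ(A, 𝒪_A)`. The descent datum is the
pair of maps `c, d : W ⟶ U` of log schemes over `X`, where `W` is étale over `B`, carries the
restriction of the log structure associated with `γ' : P' → Γ(B, 𝒪_B)`, and the maps `c`, `d` of
log schemes are induced by maps `f, g : B ⟶ A` and homomorphisms `h, k : P → P'`. -/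
def descentLog : LogStructure X where
  M := subPresheaf (descentAmbient π ι γ)
    (fun V => descentSubmonoid ι κ c hc f hf d hd g hg h eh k ek V.unop)
    (fun t x hx => descentSubmonoid_map ι κ c hc f hf d hd g hg h eh k ek t.unop x hx)
  isSheaf := subPresheaf_isSheaf _ _ _ _
    (prodPresheaf_isSheaf _ _ _ (mulSheaf_isSheaf X) (liftEtale_isSheaf π ι _ (chartLog γ).isSheaf))
    fun V x R hR H => descentSubmonoid_of_locally ι κ c hc f hf d hd g hg h eh k ek V x R hR H
  α :=
    { app := fun V => CommMonCat.ofHom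
        (X := descentSubmonoid ι κ c hc f hf d hd g hg h eh k ek V.unop)
        ((MonoidHom.fst _ _).comp
          (descentSubmonoid ι κ c hc f hf d hd g hg h eh k ek V.unop).subtype)
      naturality := fun _ _ _ => rfl }
  existsUnique_of_isUnit := by
    intro V t ht
    obtain ⟨m, hm, hm'⟩ := (chartLog γ).existsUnique_of_isUnit ((liftEtale π ι).obj V)
      ((pullback.fst (str V) π).appTop.hom t) (ht.map _)
    have key : (overMap c hc V).appTop.hom ((pullback.fst (str V) π).appTop.hom t) =
        (overMap d hd V).appTop.hom ((pullback.fst (str V) π).appTop.hom t) := by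
      have e1 := Scheme.Hom.comp_appTop (overMap c hc V) (pullback.fst (str V) π)
      have e2 := Scheme.Hom.comp_appTop (overMap d hd V) (pullback.fst (str V) π)
      unfold overMap at e1 e2
      rw [pullback.lift_fst] at e1 e2
      exact ConcreteCategory.congr_hom (e1.symm.trans e2) t
    refine ⟨⟨(t, m), hm, ?_⟩, rfl, ?_⟩
    · refine ((chartLog γ').existsUnique_of_isUnit ((liftEtale q κ).obj V)
        ((overMap c hc V).appTop.hom ((pullback.fst (str V) π).appTop.hom t))
        ((ht.map _).map _)).unique ?_ ?_
      · refine (α_descentPull ι κ c hc f hf h eh V m).trans ?_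
        rw [hm]
      · refine (α_descentPull ι κ d hd g hg k ek V m).trans ?_
        rw [hm, key]
    · rintro ⟨⟨t', m'⟩, h1, h2⟩ rfl
      exact Subtype.ext (Prod.ext rfl (hm' m' h1))

end Descent

section ProjMaps

open HomogeneousLocalization

variable {R : Type u} [CommRing R] {σ : Type*} [SetLike σ R] [AddSubgroupClass σ R]
  (𝒜 : ℕ → σ) [GradedRing 𝒜]

/-- For a unit `f t`, the ring map `(R_t)_0 → S` induced by `f : R → S`. -/
def awayLift {S : Type u} [CommRing S] (f : R →+* S) {t : R} (hu : IsUnit (f t)) :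
    Away 𝒜 t →+* S :=
  (IsLocalization.Away.lift (S := Localization.Away t) t hu).comp
    (algebraMap (Away 𝒜 t) (Localization.Away t))

lemma awayLift_mk {S : Type u} [CommRing S] (f : R →+* S) {t : R} (hu : IsUnit (f t)) {d : ℕ}
    (ht : t ∈ 𝒜 d) (n : ℕ) (x : R) (hx : x ∈ 𝒜 (n • d)) :
    awayLift 𝒜 f hu (Away.mk 𝒜 ht n x hx) * f t ^ n = f x := by
  have h1 : algebraMap (Away 𝒜 t) (Localization.Away t) (Away.mk 𝒜 ht n x hx) *
      algebraMap R (Localization.Away t) t ^ n = algebraMap R (Localization.Away t) x := by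
    rw [HomogeneousLocalization.algebraMap_apply, Away.val_mk, ← map_pow]
    rw [Localization.mk_eq_mk']
    exact IsLocalization.mk'_spec (Localization.Away t) x
      (⟨t ^ n, n, rfl⟩ : Submonoid.powers t)
  have h2 := congrArg (IsLocalization.Away.lift (S := Localization.Away t) t hu) h1
  rw [map_mul, map_pow, IsLocalization.Away.lift_eq, IsLocalization.Away.lift_eq] at h2
  exact h2

/-- The morphism `Z ⟶ Spec (R_t)_0 ⟶ Proj R` given by a ring map `f : R → Γ(Z, 𝒪_Z)` which sends
the homogeneous element `t` of positive degree to a unit. -/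
def projOfUnit {Z : Scheme.{u}} (f : R →+* Γ(Z, ⊤)) {t : R} {d : ℕ} (ht : t ∈ 𝒜 d) (hd : 0 < d)
    (hu : IsUnit (f t)) : Z ⟶ Proj 𝒜 :=
  Z.toSpecΓ ≫ Spec.map (CommRingCat.ofHom (awayLift 𝒜 f hu)) ≫ Proj.awayι 𝒜 t ht hd

lemma comp_projOfUnit {Y Z : Scheme.{u}} (g : Y ⟶ Z) (f : R →+* Γ(Z, ⊤)) {t : R} {d : ℕ}
    (ht : t ∈ 𝒜 d) (hd : 0 < d) (hu : IsUnit (f t)) (f' : R →+* Γ(Y, ⊤))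
    (hf' : f' = g.appTop.hom.comp f) (hu' : IsUnit (f' t)) :
    g ≫ projOfUnit 𝒜 f ht hd hu = projOfUnit 𝒜 f' ht hd hu' := by
  subst hf'
  unfold projOfUnit
  rw [← Category.assoc, Scheme.toSpecΓ_naturality, Category.assoc, ← Category.assoc (Spec.map _),
    ← Spec.map_comp]
  congr 3
  ext x
  obtain ⟨n, a, ha, rfl⟩ := Away.mk_surjective 𝒜 ht x
  refine (hu'.pow n).mul_right_cancel ?_
  refine Eq.trans ?_ (awayLift_mk 𝒜 _ hu' ht n a ha).symm
  change g.appTop.hom (awayLift 𝒜 f hu _) * g.appTop.hom (f t) ^ n = g.appTop.hom (f a)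
  rw [← map_pow, ← map_mul, awayLift_mk]

lemma projOfUnit_mul {Z : Scheme.{u}} (f : R →+* Γ(Z, ⊤)) {s t : R} {c d : ℕ} (ht : t ∈ 𝒜 d)
    (hd : 0 < d) (hu : IsUnit (f t)) (hs : s ∈ 𝒜 c) (hst : t * s ∈ 𝒜 (d + c)) (hdc : 0 < d + c)
    (hu' : IsUnit (f (t * s))) :
    projOfUnit 𝒜 f ht hd hu = projOfUnit 𝒜 f hst hdc hu' := by
  unfold projOfUnit
  rw [← Proj.SpecMap_awayMap_awayι 𝒜 ht hd hs rfl, ← Spec.map_comp_assoc]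
  congr 3
  ext x
  obtain ⟨n, a, ha, rfl⟩ := Away.mk_surjective 𝒜 ht x
  refine (hu'.pow n).mul_right_cancel ?_
  change _ = awayLift 𝒜 f hu' (awayMap 𝒜 hs rfl (Away.mk 𝒜 ht n a ha)) * f (t * s) ^ n
  rw [awayMap_mk, awayLift_mk, map_mul, mul_pow, ← mul_assoc, map_mul, map_pow]
  congr 1
  exact awayLift_mk 𝒜 f hu ht n a ha

lemma projOfUnit_eq {Z : Scheme.{u}} (f : R →+* Γ(Z, ⊤)) {s t : R} {c d : ℕ} (ht : t ∈ 𝒜 d)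
    (hd : 0 < d) (hu : IsUnit (f t)) (hs : s ∈ 𝒜 c) (hc : 0 < c) (hu' : IsUnit (f s)) :
    projOfUnit 𝒜 f ht hd hu = projOfUnit 𝒜 f hs hc hu' := by
  have h : IsUnit (f (t * s)) := by rw [map_mul]; exact hu.mul hu'
  have h' : IsUnit (f (s * t)) := by rw [mul_comm]; exact h
  rw [projOfUnit_mul 𝒜 f ht hd hu hs (SetLike.mul_mem_graded ht hs) (by omega) h,
    projOfUnit_mul 𝒜 f hs hc hu' ht (SetLike.mul_mem_graded hs ht) (by omega) h']
  congr 1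
  · exact mul_comm _ _
  · exact add_comm _ _

lemma projOfUnit_scale {Z : Scheme.{u}} (f f' : R →+* Γ(Z, ⊤)) (z : Γ(Z, ⊤))
    (hff' : ∀ (d : ℕ) (x : R), x ∈ 𝒜 d → f' x = f x * z ^ d) {t : R} {d : ℕ} (ht : t ∈ 𝒜 d)
    (hd : 0 < d) (hu : IsUnit (f t)) (hu' : IsUnit (f' t)) :
    projOfUnit 𝒜 f ht hd hu = projOfUnit 𝒜 f' ht hd hu' := by
  unfold projOfUnit
  congr 4
  ext x
  obtain ⟨n, a, ha, rfl⟩ := Away.mk_surjective 𝒜 ht x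
  refine (hu'.pow n).mul_right_cancel ?_
  rw [awayLift_mk, hff' d t ht, mul_pow, ← mul_assoc, awayLift_mk, hff' _ a ha, ← pow_mul,
    smul_eq_mul, mul_comm d n]

/-- The complement in `Spec R` of the zero locus of the irrelevant ideal. -/
def punctured : (Spec (.of R)).Opens :=
  ⟨(PrimeSpectrum.zeroLocus ((HomogeneousIdeal.irrelevant 𝒜).toIdeal : Set R))ᶜ,
    (PrimeSpectrum.isClosed_zeroLocus _).isOpen_compl⟩

lemma exists_of_mem_punctured {x : Spec (.of R)} (hx : x ∈ punctured 𝒜) :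
    ∃ (d : ℕ) (t : R), 0 < d ∧ t ∈ 𝒜 d ∧ t ∉ x.asIdeal := by
  classical
  by_contra! H
  refine hx fun z hz => ?_
  rw [← DirectSum.sum_support_decompose 𝒜 z]
  refine Ideal.sum_mem _ fun c hc ↦ ?_
  have : c ≠ 0 := by
    rintro rfl
    rw [DFinsupp.mem_support_toFun] at hc
    refine hc (Subtype.ext ?_)
    exact (HomogeneousIdeal.mem_irrelevant_iff 𝒜 z).1 hz
  exact H c _ (Nat.pos_of_ne_zero this) (SetLike.coe_mem _)

lemma mem_punctured {x : Spec (.of R)} {d : ℕ} {t : R} (hd : 0 < d) (ht : t ∈ 𝒜 d)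
    (htx : t ∉ x.asIdeal) : x ∈ punctured 𝒜 := by
  intro h
  refine htx (h ?_)
  change t ∈ HomogeneousIdeal.irrelevant 𝒜
  rw [HomogeneousIdeal.mem_irrelevant_iff]
  exact DirectSum.decompose_of_mem_ne 𝒜 ht hd.ne'

/-- The functions on an `R`-scheme given by the elements of `R`. -/
def pullFun {Z : Scheme.{u}} (c : Z ⟶ Spec (.of R)) : R →+* Γ(Z, ⊤) :=
  c.appTop.hom.comp (Scheme.ΓSpecIso (.of R)).inv.hom

lemma pullFun_comp {Y Z : Scheme.{u}} (g : Y ⟶ Z) (c : Z ⟶ Spec (.of R)) :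
    pullFun (g ≫ c) = g.appTop.hom.comp (pullFun c) := by
  unfold pullFun
  rw [Scheme.Hom.comp_appTop]
  rfl

/-- The basic open set `D(t)` in `Spec R`. -/
def specOpen (t : R) : (Spec (.of R)).Opens := PrimeSpectrum.basicOpen t

lemma basicOpen_pullFun {Z : Scheme.{u}} (c : Z ⟶ Spec (.of R)) (t : R) :
    Z.basicOpen (pullFun c t) = c ⁻¹ᵁ specOpen t := by
  have h : specOpen t = (Spec (.of R)).basicOpen ((Scheme.ΓSpecIso (.of R)).inv.hom t) :=
    (basicOpen_eq_of_affine (R := .of R) t).symm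
  rw [h, Scheme.preimage_basicOpen_top]
  rfl

lemma isUnit_pullFun_iff {Z : Scheme.{u}} (c : Z ⟶ Spec (.of R)) (t : R) :
    IsUnit (pullFun c t) ↔ ∀ z : Z, t ∉ (c z).asIdeal := by
  rw [isUnit_iff_basicOpen, basicOpen_pullFun, eq_top_iff]
  exact ⟨fun h z => h (trivial : z ∈ (⊤ : Z.Opens)), fun h z _ => h z⟩

/-- The homogeneous elements of positive degree. -/
abbrev PosElt : Type u := {x : ℕ × R // 0 < x.1 ∧ x.2 ∈ 𝒜 x.1}

/-- The trace on the complement of the irrelevant locus of the basic open set `D(t)`. -/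
def puncturedOpen (i : PosElt 𝒜) : (punctured 𝒜).toScheme.Opens :=
  (punctured 𝒜).ι ⁻¹ᵁ specOpen i.1.2

lemma isOpenCover_puncturedOpen : TopologicalSpace.IsOpenCover (puncturedOpen 𝒜) := by
  rw [TopologicalSpace.IsOpenCover, eq_top_iff]
  intro x _
  obtain ⟨d, t, hd, ht, h⟩ := exists_of_mem_punctured 𝒜 x.2
  exact TopologicalSpace.Opens.mem_iSup.2 ⟨⟨(d, t), hd, ht⟩, h⟩

lemma isUnit_puncturedOpen (i : PosElt 𝒜) :
    IsUnit (pullFun ((puncturedOpen 𝒜 i).ι ≫ (punctured 𝒜).ι) i.1.2) := by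
  rw [isUnit_pullFun_iff]
  exact fun z => z.2

/-- The quotient map from the complement of the irrelevant locus in `Spec R` to `Proj R`: on
`D(t) = Spec R_t` it is given by the inclusion `(R_t)_0 → R_t`. -/
def toProj : (punctured 𝒜).toScheme ⟶ Proj 𝒜 :=
  ((punctured 𝒜).toScheme.openCoverOfIsOpenCover _
    (isOpenCover_puncturedOpen 𝒜)).glueMorphisms
    (fun i => projOfUnit 𝒜 (Z := (puncturedOpen 𝒜 i).toScheme)
      (pullFun ((puncturedOpen 𝒜 i).ι ≫ (punctured 𝒜).ι)) i.2.2 i.2.1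
      (isUnit_puncturedOpen 𝒜 i)) (by
    intro i k
    let p := pullback.fst (puncturedOpen 𝒜 i).ι (puncturedOpen 𝒜 k).ι
    let q := pullback.snd (puncturedOpen 𝒜 i).ι (puncturedOpen 𝒜 k).ι
    have h : p ≫ (puncturedOpen 𝒜 i).ι ≫ (punctured 𝒜).ι =
        q ≫ (puncturedOpen 𝒜 k).ι ≫ (punctured 𝒜).ι := pullback.condition_assoc _
    have hi : IsUnit (pullFun (p ≫ (puncturedOpen 𝒜 i).ι ≫ (punctured 𝒜).ι) i.1.2) := by
      rw [pullFun_comp]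
      exact (isUnit_puncturedOpen 𝒜 i).map p.appTop.hom
    have hk : IsUnit (pullFun (p ≫ (puncturedOpen 𝒜 i).ι ≫ (punctured 𝒜).ι) k.1.2) := by
      rw [h, pullFun_comp]
      exact (isUnit_puncturedOpen 𝒜 k).map q.appTop.hom
    refine (comp_projOfUnit 𝒜 p _ _ _ _ _ (pullFun_comp _ _) hi).trans
      ((projOfUnit_eq 𝒜 _ _ _ _ k.2.2 k.2.1 hk).trans ?_)
    refine (comp_projOfUnit 𝒜 q _ _ _ _ _ ?_ hk).symm
    rw [h, pullFun_comp])

lemma comp_toProj {Z : Scheme.{u}} (c : Z ⟶ (punctured 𝒜).toScheme) {t : R} {d : ℕ}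
    (ht : t ∈ 𝒜 d) (hd : 0 < d) (hu : IsUnit (pullFun (c ≫ (punctured 𝒜).ι) t)) :
    c ≫ toProj 𝒜 = projOfUnit 𝒜 (pullFun (c ≫ (punctured 𝒜).ι)) ht hd hu := by
  let i : PosElt 𝒜 := ⟨(d, t), hd, ht⟩
  have hr : Set.range c ⊆ Set.range (puncturedOpen 𝒜 i).ι := by
    rintro _ ⟨z, rfl⟩
    rw [Scheme.Opens.range_ι]
    exact (isUnit_pullFun_iff _ _).1 hu z
  let c' := IsOpenImmersion.lift (puncturedOpen 𝒜 i).ι c hr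
  have hc : c' ≫ (puncturedOpen 𝒜 i).ι = c := IsOpenImmersion.lift_fac _ _ _
  have h1 : (puncturedOpen 𝒜 i).ι ≫ toProj 𝒜 = _ :=
    ((punctured 𝒜).toScheme.openCoverOfIsOpenCover _
      (isOpenCover_puncturedOpen 𝒜)).ι_glueMorphisms _ _ i
  have h2 : c ≫ toProj 𝒜 = c' ≫ (puncturedOpen 𝒜 i).ι ≫ toProj 𝒜 := by
    rw [← Category.assoc, hc]
  rw [h2, h1]
  refine comp_projOfUnit 𝒜 c' _ _ _ _ _ ?_ hu
  rw [← pullFun_comp, ← Category.assoc, hc]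

end ProjMaps

section Toric

variable {n : ℕ}

/-- The polytope in `ℝⁿ` which is the convex hull of a finite set of lattice points. -/
def latticePolytope (A : Finset (Fin n → ℤ)) : Set (Fin n → ℝ) :=
  convexHull ℝ ((fun (m : Fin n → ℤ) (i : Fin n) => (m i : ℝ)) '' (A : Set (Fin n → ℤ)))

/-- The monoid of lattice points of the cone over the polytope placed at height one, that is of the
points `(m, h)` in `ℤⁿ × ℤ` with `(m, h) = h • (q, 1)` for a point `q` of the polytope. -/
def coneMonoid (A : Finset (Fin n → ℤ)) : AddSubmonoid ((Fin n → ℤ) × ℕ) where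
  carrier := {x | x = 0 ∨ ∃ q ∈ latticePolytope A, ∀ i, (x.1 i : ℝ) = x.2 * q i}
  zero_mem' := Or.inl rfl
  add_mem' := by
    rintro x y (rfl | ⟨q, hq, hx⟩) hy
    · rwa [zero_add]
    rcases hy with rfl | ⟨r, hr, hy⟩
    · rw [add_zero]; exact Or.inr ⟨q, hq, hx⟩
    refine Or.inr ?_
    rcases Nat.eq_zero_or_pos (x.2 + y.2) with h0 | h0
    · refine ⟨q, hq, fun i => ?_⟩
      obtain ⟨h1, h2⟩ := Nat.add_eq_zero_iff.1 h0
      have hx := hx i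
      have hy := hy i
      rw [h1] at hx
      rw [h2] at hy
      rw [Prod.snd_add, h0, Prod.fst_add, Pi.add_apply, Int.cast_add, hx, hy]
      simp
    · have h1 : (0 : ℝ) < x.2 + y.2 := by exact_mod_cast h0
      refine ⟨((x.2 : ℝ) / (x.2 + y.2)) • q + ((y.2 : ℝ) / (x.2 + y.2)) • r,
        (convex_convexHull ℝ _) hq hr (by positivity) (by positivity)
          (by rw [← add_div, div_self h1.ne']), fun i => ?_⟩
      rw [Prod.fst_add, Pi.add_apply, Int.cast_add, hx, hy]
      simp only [Pi.add_apply, Pi.smul_apply, smul_eq_mul, Prod.snd_add, Nat.cast_add]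
      field_simp

variable (A : Finset (Fin n → ℤ))

/-- The degree (the height) on the cone monoid. -/
def coneDeg : coneMonoid A →+ ℕ := (AddMonoidHom.snd _ _).comp (coneMonoid A).subtype

/-- The degree as an integer. -/
def coneDegInt : coneMonoid A →+ ℤ := (Nat.castAddMonoidHom ℤ).comp (coneDeg A)

/-- The homomorphism `p ↦ (p, 0)` from `P` to `P ⊕ ℤ`. -/
def coneIncl : coneMonoid A →+ coneMonoid A × ℤ := AddMonoidHom.inl _ _

/-- The homomorphism `p ↦ (p, deg p)` from `P` to `P ⊕ ℤ`. -/
def coneShift : coneMonoid A →+ coneMonoid A × ℤ := (AddMonoidHom.id _).prod (coneDegInt A)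

/-- The homomorphism `(m, h) ↦ m` from `P` to `ℤⁿ`. -/
def coneToLattice : coneMonoid A →+ (Fin n → ℤ) :=
  (AddMonoidHom.fst _ _).comp (coneMonoid A).subtype

variable (k : Type u) [Field k]

/-- The monoid algebra `k[P]`. -/
abbrev coneAlg : Type u := AddMonoidAlgebra k (coneMonoid A)

/-- The grading on `k[P]` by the degree. -/
abbrev coneGrading : ℕ → Submodule k (coneAlg A k) := AddMonoidAlgebra.gradeBy k (coneDeg A)

/-- The projective toric variety `X = Proj k[P]` of the polytope. -/
abbrev toricVariety : Scheme.{u} := Proj (coneGrading A k)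

/-- The affine toric scheme `Spec k[M]` of a commutative monoid `M`. -/
abbrev affineToric (M : Type) [AddCommMonoid M] : Scheme.{u} :=
  Spec (.of (AddMonoidAlgebra k M))

section Affine

variable {M N : Type} [AddCommMonoid M] [AddCommMonoid N]

/-- The characters, as functions on `Spec k[M]`. The associated log structure is the standard log
structure of `Spec k[M]`. -/
def toricChar (M : Type) [AddCommMonoid M] : Multiplicative M →* Γ(affineToric k M, ⊤) :=
  ((pullFun (𝟙 (affineToric k M)) : AddMonoidAlgebra k M →+* _) :
    AddMonoidAlgebra k M →* Γ(affineToric k M, ⊤)).comp (AddMonoidAlgebra.of k M)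

/-- The morphism `Spec k[N] ⟶ Spec k[M]` induced by a homomorphism `M → N`. -/
def toricMap (f : M →+ N) : affineToric k N ⟶ affineToric k M :=
  Spec.map (CommRingCat.ofHom (AddMonoidAlgebra.mapDomainRingHom k f))

lemma pullFun_toricMap (f : M →+ N) {Z : Scheme.{u}} (c : Z ⟶ affineToric k N)
    (x : AddMonoidAlgebra k M) :
    pullFun (c ≫ toricMap k f) x = pullFun c (AddMonoidAlgebra.mapDomainRingHom k f x) := by
  rw [pullFun_comp]
  refine congrArg c.appTop.hom ?_
  exact (ConcreteCategory.congr_hom (Scheme.ΓSpecIso_inv_naturality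
    (CommRingCat.ofHom (AddMonoidAlgebra.mapDomainRingHom k f))) x).symm

lemma toricChar_comp (f : M →+ N) :
    (toricChar k N).comp (AddMonoidHom.toMultiplicative f) =
      resTop (toricChar k M) (toricMap k f) := by
  ext x
  have h := pullFun_toricMap k f (𝟙 _) (AddMonoidAlgebra.of k M x)
  rw [Category.id_comp] at h
  change pullFun (𝟙 _) (AddMonoidAlgebra.of k N (AddMonoidHom.toMultiplicative f x)) =
    (toricMap k f).appTop.hom (pullFun (𝟙 _) (AddMonoidAlgebra.of k M x))
  have h2 := pullFun_comp (toricMap k f) (𝟙 (affineToric k M))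
  rw [Category.comp_id] at h2
  rw [h2] at h
  refine Eq.trans ?_ h.symm
  congr 1
  exact (AddMonoidAlgebra.mapDomain_single (f := f)).symm

end Affine

/-- The complement `U` of the irrelevant locus in `Spec k[P]`. -/
abbrev coneOpen : (affineToric k (coneMonoid A)).Opens := punctured (coneGrading A k)

/-- The preimage of `U` under the projection `Spec k[P ⊕ ℤ] = 𝔾ₘ × Spec k[P] ⟶ Spec k[P]`. -/
abbrev coneOpenProd : (affineToric k (coneMonoid A × ℤ)).Opens :=
  (toricMap k (coneIncl A)) ⁻¹ᵁ coneOpen A k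

/-- The projection `𝔾ₘ × U ⟶ U`. -/
def conePr : (coneOpenProd A k).toScheme ⟶ (coneOpen A k).toScheme :=
  toricMap k (coneIncl A) ∣_ coneOpen A k

lemma conePr_ι : conePr A k ≫ (coneOpen A k).ι = (coneOpenProd A k).ι ≫ toricMap k (coneIncl A) :=
  morphismRestrict_ι _ _

/-- The unit of `k[P ⊕ ℤ]` which is the coordinate of `𝔾ₘ`. -/
def coneCoord : AddMonoidAlgebra k (coneMonoid A × ℤ) :=
  AddMonoidAlgebra.single (0, 1) 1

lemma isUnit_coneCoord : IsUnit (coneCoord A k) := by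
  refine IsUnit.of_mul_eq_one (AddMonoidAlgebra.single (0, -1) 1) ?_
  rw [coneCoord, AddMonoidAlgebra.single_mul_single]
  simp [AddMonoidAlgebra.one_def, ← Prod.zero_eq_mk]

lemma coneShift_apply (d : ℕ) (x : coneAlg A k) (hx : x ∈ coneGrading A k d) :
    AddMonoidAlgebra.mapDomainRingHom k (coneShift A) x =
      AddMonoidAlgebra.mapDomainRingHom k (coneIncl A) x * coneCoord A k ^ d := by
  have h0 : coneCoord A k ^ d = AddMonoidAlgebra.single (0, (d : ℤ)) 1 := by
    rw [coneCoord, AddMonoidAlgebra.single_pow]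
    simp
  have h1 : ∀ m ∈ x.coeff.support,
      AddMonoidAlgebra.mapDomainRingHom k (coneShift A) (AddMonoidAlgebra.single m (x.coeff m)) =
      AddMonoidAlgebra.mapDomainRingHom k (coneIncl A) (AddMonoidAlgebra.single m (x.coeff m)) *
        coneCoord A k ^ d := by
    intro m hm
    have h2 : coneDeg A m = d := hx m hm
    have h3 : coneShift A m = coneIncl A m + (0, (d : ℤ)) := by
      refine Prod.ext (add_zero _).symm ?_
      change ((coneDeg A m : ℕ) : ℤ) = 0 + (d : ℤ)
      rw [h2, zero_add]
    rw [h0]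
    change AddMonoidAlgebra.mapDomain _ _ = AddMonoidAlgebra.mapDomain _ _ * _
    rw [AddMonoidAlgebra.mapDomain_single, AddMonoidAlgebra.mapDomain_single,
      AddMonoidAlgebra.single_mul_single, mul_one, h3]
  have h4 : x = ∑ m ∈ x.coeff.support, AddMonoidAlgebra.single m (x.coeff m) :=
    (AddMonoidAlgebra.sum_coeff_single x).symm
  rw [h4, map_sum, map_sum, Finset.sum_mul]
  exact Finset.sum_congr rfl h1

lemma mapsTo_coneOpen : Set.range ((coneOpenProd A k).ι ≫ toricMap k (coneShift A)) ⊆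
    Set.range (coneOpen A k).ι := by
  rintro _ ⟨w, rfl⟩
  rw [Scheme.Opens.range_ι]
  have hw : toricMap k (coneIncl A) w.1 ∈ coneOpen A k := w.2
  obtain ⟨d, t, hd, ht, h⟩ := exists_of_mem_punctured _ hw
  refine mem_punctured _ hd ht fun h' => h ?_
  have h1 : AddMonoidAlgebra.mapDomainRingHom k (coneShift A) t ∈ (w.1).asIdeal := h'
  rw [coneShift_apply A k d t ht] at h1
  rcases w.1.isPrime.mem_or_mem h1 with h2 | h2
  · exact h2
  · exact (w.1.isPrime.ne_top (Ideal.eq_top_of_isUnit_mem _ h2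
      ((isUnit_coneCoord A k).pow d))).elim

/-- The action `𝔾ₘ × U ⟶ U` of the multiplicative group which is given by the grading. -/
def coneAct : (coneOpenProd A k).toScheme ⟶ (coneOpen A k).toScheme :=
  IsOpenImmersion.lift (coneOpen A k).ι ((coneOpenProd A k).ι ≫ toricMap k (coneShift A))
    (mapsTo_coneOpen A k)

lemma coneAct_ι :
    coneAct A k ≫ (coneOpen A k).ι = (coneOpenProd A k).ι ≫ toricMap k (coneShift A) :=
  IsOpenImmersion.lift_fac _ _ _

/-- The quotient map `U ⟶ X`. -/
abbrev coneProj : (coneOpen A k).toScheme ⟶ toricVariety A k := toProj (coneGrading A k)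

lemma coneAct_coneProj : coneAct A k ≫ coneProj A k = conePr A k ≫ coneProj A k := by
  refine Scheme.hom_ext_of_forall _ _ fun w => ?_
  have hw : toricMap k (coneIncl A) w.1 ∈ coneOpen A k := w.2
  obtain ⟨d, t, hd, ht, h⟩ := exists_of_mem_punctured _ hw
  let O : (coneOpenProd A k).toScheme.Opens :=
    (conePr A k ≫ (coneOpen A k).ι) ⁻¹ᵁ specOpen (R := coneAlg A k) t
  refine ⟨O, ?_, ?_⟩
  · change (conePr A k ≫ (coneOpen A k).ι) w ∈ specOpen (R := coneAlg A k) t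
    rw [conePr_ι]
    exact h
  let i : O.toScheme ⟶ affineToric k (coneMonoid A × ℤ) := O.ι ≫ (coneOpenProd A k).ι
  have e1 : (O.ι ≫ conePr A k) ≫ (coneOpen A k).ι = i ≫ toricMap k (coneIncl A) := by
    rw [Category.assoc, conePr_ι, Category.assoc]
  have e2 : (O.ι ≫ coneAct A k) ≫ (coneOpen A k).ι = i ≫ toricMap k (coneShift A) := by
    rw [Category.assoc, coneAct_ι, Category.assoc]
  have hs : ∀ (c : ℕ) (x : coneAlg A k), x ∈ coneGrading A k c →
      pullFun ((O.ι ≫ coneAct A k) ≫ (coneOpen A k).ι) x =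
        pullFun ((O.ι ≫ conePr A k) ≫ (coneOpen A k).ι) x * pullFun i (coneCoord A k) ^ c := by
    intro c x hx
    rw [e1, e2, pullFun_toricMap, pullFun_toricMap, coneShift_apply A k c x hx, map_mul, map_pow]
  have u1 : IsUnit (pullFun ((O.ι ≫ conePr A k) ≫ (coneOpen A k).ι) t) := by
    rw [Category.assoc, isUnit_pullFun_iff]
    exact fun z => z.2
  have u2 : IsUnit (pullFun ((O.ι ≫ coneAct A k) ≫ (coneOpen A k).ι) t) := by
    rw [hs d t ht]
    exact u1.mul (((isUnit_coneCoord A k).map (pullFun i)).pow d)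
  rw [← Category.assoc, ← Category.assoc, comp_toProj _ _ ht hd u1, comp_toProj _ _ ht hd u2]
  exact (projOfUnit_scale _ _ _ _ hs ht hd u1 u2).symm

/-- The log structure `M_P` on `X = Proj k[P]`: the descent along `U ⟶ X` of the restriction to `U`
of the standard log structure of `Spec k[P]`, with respect to the action of `𝔾ₘ` on the log scheme
which is induced by `p ↦ (p, deg p)`. -/
def descendedLog : LogStructure (toricVariety A k) :=
  descentLog (π := coneProj A k) (coneOpen A k).ι (coneOpenProd A k).ι
    (coneAct A k) (coneAct_coneProj A k) (toricMap k (coneShift A)) (coneAct_ι A k)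
    (conePr A k) rfl (toricMap k (coneIncl A)) (conePr_ι A k)
    (AddMonoidHom.toMultiplicative (coneShift A)) (toricChar_comp k _)
    (AddMonoidHom.toMultiplicative (coneIncl A)) (toricChar_comp k _)

lemma exists_degree_one {A : Finset (Fin n → ℤ)} (hA : A.Nonempty) :
    ∃ p : coneMonoid A, coneDeg A p = 1 := by
  obtain ⟨m, hm⟩ := hA
  exact ⟨⟨(m, 1), Or.inr ⟨_, subset_convexHull ℝ _ ⟨m, hm, rfl⟩, fun i => by simp⟩⟩, rfl⟩

lemma torus_mapsTo {A : Finset (Fin n → ℤ)} (hA : A.Nonempty) :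
    Set.range (toricMap k (coneToLattice A)) ⊆ Set.range (coneOpen A k).ι := by
  rintro _ ⟨w, rfl⟩
  rw [Scheme.Opens.range_ι]
  obtain ⟨p, hp⟩ := exists_degree_one hA
  refine mem_punctured _ (d := 1) (t := AddMonoidAlgebra.single p 1) one_pos
    (hp ▸ AddMonoidAlgebra.single_mem_gradeBy _ _ _) fun h => ?_
  have h1 : AddMonoidAlgebra.mapDomain (coneToLattice A) (AddMonoidAlgebra.single p (1 : k)) ∈
    w.asIdeal := h
  rw [AddMonoidAlgebra.mapDomain_single] at h1
  refine w.isPrime.ne_top (Ideal.eq_top_of_isUnit_mem _ h1 ?_)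
  refine IsUnit.of_mul_eq_one (AddMonoidAlgebra.single (-coneToLattice A p) 1) ?_
  rw [AddMonoidAlgebra.single_mul_single, add_neg_cancel, mul_one]
  rfl

/-- The inclusion `T = Spec k[ℤⁿ] ⟶ X` of the torus, induced by `P → ℤⁿ`, `(m, h) ↦ m`. -/
def torusIncl {A : Finset (Fin n → ℤ)} (hA : A.Nonempty) :
    affineToric k (Fin n → ℤ) ⟶ toricVariety A k :=
  IsOpenImmersion.lift (coneOpen A k).ι (toricMap k (coneToLattice A)) (torus_mapsTo k hA) ≫
    coneProj A k

/-- The standard log structure `M_X = j_*^{log} 𝒪_Tˣ` of the toric variety `X`. -/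
def standardLog {A : Finset (Fin n → ℤ)} (hA : A.Nonempty) : LogStructure (toricVariety A k) :=
  compactifyingLog (torusIncl k hA)

end Toric

end LogToric

end

/-! A log structure whose map `α` is injective on sections is the same thing as a subsheaf of the
functions containing the units. Into such a log structure there is at most one morphism, and two of
them with the same functions are isomorphic (`LogStructure.IsInjective.exists_isIso`). The standard
log structure has this property by construction, so the first assertion amounts to two facts: the
descended log structure has it too, and its functions over an étale `V ⟶ X` are exactly those which
are invertible over the torus.

Both facts are checked upstairs, on the affine cone. Once the log structure on `𝔾ₘ × Spec k[P]` is
injective, the descent condition on a section is automatic, so a function belongs to the descended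
log structure iff its pullback to `V ×_X U` belongs to the toric log structure of `Spec k[P]`. For
an interior point `q` of the cone, `D(χ^q)` is the open torus orbit of `Spec k[P]` and the preimage
of `T` in `U`. It remains to show that, on an étale scheme over `Spec k[P]`, a function `f` which is
invertible on `D(χ^q)` is locally a monomial times a unit (`FacetData.exists_factorization`), and
that two associated monomials differ locally by monomials which are units
(`FacetData.exists_relation`).

For this, Fourier–Motzkin elimination presents `P` as the points of a lattice `L` where finitely
many irredundant primitive functionals `ν i` are nonnegative, one for each facet. In the local ring
`S` of an étale algebra `B` over `k[P]` there is a relation `f g = χ^{Nq}`. Each facet ideal remains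
prime in `S` or becomes the unit ideal: the facet ring is integrally closed in the fraction field
`K` of `k[L]`, formation of integral closures commutes with étale base change, and hence the
idempotents of `B ⊗ K` come from `B`. A facet ideal is principal after inverting a monomial outside
it, so the order of `χ^{Nq}` along facet `i` splits as `a i + b i` between `f` and `g`. Flatness
turns these orders into membership of `f` and `g` in the ideals generated by the monomials of values
at least `a` and at least `b`. All products of such monomials are multiples of `χ^{Nq} = f g`; as
`S` is local, one of them is `χ^{Nq}` times a unit, and this forces `f` to be a monomial times a
unit.

For the Deligne–Faltings property, `U ⟶ X` has a section over `D₊(χ^a)`, for `a` in `A`, defined by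
`χ^a = 1`. Pulling the toric log structure back along it gives the chart `p ↦ χ^p / (χ^a)^{deg p}`.
Replacing `a` by `b` multiplies this by the unit `(χ^a / χ^b)^{deg p}`, so the classes of the charts
glue to a homomorphism from `P` to the global sections of the characteristic sheaf. -/

namespace LogToric

/-! ### Flat and étale base change of ideals -/

section Flat

open TensorProduct

/-- If `f ⊗ m` vanishes in `S ⊗ M` for a flat algebra `S`, then `f` lies in the ideal of `S`
generated by the annihilator of `m`. -/
lemma mem_map_of_tmul_eq_zero {R S M : Type*} [CommRing R] [CommRing S] [Algebra R S]
    [AddCommGroup M] [Module R M] [Module.Flat R S] (I : Ideal R) (m : M)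
    (hI : ∀ r : R, r • m = 0 → r ∈ I) (f : S) (h : f ⊗ₜ[R] m = 0) :
    f ∈ I.map (algebraMap R S) := by
  let l : R →ₗ[R] M := LinearMap.toSpanSingleton R M m
  -- Flatness keeps `ker l → R → M` exact, so `f ⊗ 1` comes from `S ⊗ ker l`.
  have hex := Module.Flat.lTensor_exact S (f := (LinearMap.ker l).subtype) (g := l)
    (LinearMap.exact_subtype_ker_map l)
  obtain ⟨z, hz⟩ := (hex (f ⊗ₜ 1)).1 (by
    rw [LinearMap.lTensor_tmul, LinearMap.toSpanSingleton_apply, one_smul, h])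
  have key : ∀ z : S ⊗[R] LinearMap.ker l,
      TensorProduct.rid R S (LinearMap.lTensor S (LinearMap.ker l).subtype z) ∈
        I.map (algebraMap R S) := by
    intro z
    induction z with
    | zero => simp
    | add x y hx hy => rw [map_add, map_add]; exact add_mem hx hy
    | tmul s r =>
      rw [LinearMap.lTensor_tmul, TensorProduct.rid_tmul, Algebra.smul_def]
      exact Ideal.mul_mem_right _ _ (Ideal.mem_map_of_mem _ (hI _ r.2))
  have := key z
  rwa [hz, TensorProduct.rid_tmul, one_smul] at this

/-- For a flat algebra `S`, the kernel of `S → S ⊗ C` is generated by the kernel of `R → C`. -/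
lemma mem_map_ker_iff {R S C : Type*} [CommRing R] [CommRing S] [Algebra R S] [CommRing C]
    [Algebra R C] [Module.Flat R S] (I : Ideal R) (hI : RingHom.ker (algebraMap R C) = I) (b : S) :
    b ∈ I.map (algebraMap R S) ↔ b ⊗ₜ[R] (1 : C) = 0 := by
  constructor
  · intro hb
    induction hb using Submodule.span_induction with
    | mem x hx =>
      obtain ⟨r, hr, rfl⟩ := hx
      rw [← hI] at hr
      rw [Algebra.algebraMap_eq_smul_one, TensorProduct.smul_tmul,
        ← Algebra.algebraMap_eq_smul_one, show algebraMap R C r = 0 from hr,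
        TensorProduct.tmul_zero]
    | zero => exact TensorProduct.zero_tmul _ _
    | add x y _ _ hx hy => rw [TensorProduct.add_tmul, hx, hy, add_zero]
    | smul a x _ hx =>
      have : (a • x) ⊗ₜ[R] (1 : C) = (a ⊗ₜ[R] (1 : C)) * (x ⊗ₜ[R] (1 : C)) := by
        rw [Algebra.TensorProduct.tmul_mul_tmul, one_mul, smul_eq_mul]
      rw [this, hx, mul_zero]
  · refine mem_map_of_tmul_eq_zero I (1 : C) (fun r hr => ?_) b
    rw [← hI]
    rwa [← Algebra.algebraMap_eq_smul_one] at hr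

/-- In an algebra which is étale over a field, principal ideals are generated by idempotents. -/
lemma exists_idempotent_of_etale {K C : Type*} [Field K] [CommRing C] [Algebra K C]
    [Algebra.Etale K C] (h : C) :
    ∃ e : C, IsIdempotentElem e ∧ (∃ c, e = h * c) ∧ h * (1 - e) = 0 := by
  classical
  have := Algebra.FormallyUnramified.finite_of_free K C
  have := Algebra.FormallyUnramified.isReduced_of_field K C
  have : IsArtinianRing C := isArtinian_of_tower K inferInstance
  let E := IsArtinianRing.equivPi C
  let _ (m : MaximalSpectrum C) : Field (C ⧸ m.asIdeal) := Ideal.Quotient.field m.asIdeal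
  -- By the convention `0⁻¹ = 0`, the product `E h * d` is the indicator of the factor fields in
  -- which `h` does not vanish.
  let d : ∀ m : MaximalSpectrum C, C ⧸ m.asIdeal := fun m => (E h m)⁻¹
  let e : ∀ m : MaximalSpectrum C, C ⧸ m.asIdeal := E h * d
  have he : ∀ m, E h m * e m = E h m := by
    intro m
    change E h m * (E h m * (E h m)⁻¹) = E h m
    by_cases h0 : E h m = 0
    · rw [h0, zero_mul]
    · rw [mul_inv_cancel₀ h0, mul_one]
  have he' : E h * e = E h := funext he
  refine ⟨E.symm e, ?_, ⟨E.symm d, ?_⟩, ?_⟩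
  · rw [IsIdempotentElem, ← map_mul]
    congr 1
    have h1 : e * e = E h * e * d := mul_right_comm _ _ _
    rw [h1, he']
  · apply E.injective
    rw [map_mul E h, E.apply_symm_apply, E.apply_symm_apply]
  · apply E.injective
    rw [map_mul, map_sub, map_one, E.apply_symm_apply, mul_sub, he', mul_one, sub_self, map_zero]

/-- Étale algebras over a ring whose image in a field is integrally closed: if the product of two
elements vanishes modulo the kernel, then locally one of the factors does. -/
lemma exists_sub_mul_mem_of_etale {R B K : Type*} [CommRing R] [CommRing B] [Algebra R B]
    [Algebra.Etale R B] [Field K] [Algebra R K] (I : Ideal R)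
    (hI : RingHom.ker (algebraMap R K) = I)
    (hK : ∀ z : K, IsIntegral R z → z ∈ (algebraMap R K).range) {h h' : B}
    (hh : h * h' ∈ I.map (algebraMap R B)) :
    ∃ e : B, h * (1 - e) ∈ I.map (algebraMap R B) ∧ h' * e ∈ I.map (algebraMap R B) := by
  have hmem : ∀ b : B, b ∈ I.map (algebraMap R B) ↔ b ⊗ₜ[R] (1 : K) = 0 :=
    mem_map_ker_iff I hI
  let _ : Algebra K (B ⊗[R] K) := Algebra.TensorProduct.rightAlgebra
  have : Algebra.Etale K (B ⊗[R] K) :=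
    Algebra.Etale.of_equiv (Algebra.TensorProduct.commRight R K B)
  obtain ⟨e, he, ⟨c, hc⟩, he'⟩ := exists_idempotent_of_etale (K := K) (h ⊗ₜ[R] (1 : K))
  have hint : IsIntegral B e :=
    ⟨Polynomial.X ^ 2 - Polynomial.X, Polynomial.monic_X_pow_sub
      (Polynomial.degree_X_le.trans_lt (by norm_num)), by
      simp [pow_two, he.eq]⟩
  -- An idempotent is a root of `X ^ 2 - X`. Integral closure commutes with smooth base change, so
  -- `e` comes from `B ⊗ integralClosure R K`, and `hK` reduces this to an element of the form `b ⊗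
  -- 1`.
  obtain ⟨z, hz⟩ := (TensorProduct.toIntegralClosure_bijective_of_smooth (R := R) (S := B)
    (B := K)).2 ⟨e, hint⟩
  have hz' : ∀ z : B ⊗[R] integralClosure R K, ∃ b : B,
      (TensorProduct.toIntegralClosure R B K z : B ⊗[R] K) = b ⊗ₜ[R] (1 : K) := by
    intro z
    induction z with
    | zero => exact ⟨0, by simp⟩
    | add x y hx hy =>
      obtain ⟨a, ha⟩ := hx
      obtain ⟨b, hb⟩ := hy
      exact ⟨a + b, by rw [map_add, TensorProduct.add_tmul, ← ha, ← hb]; rfl⟩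
    | tmul b w =>
      obtain ⟨r, hr⟩ := hK w.1 w.2
      refine ⟨r • b, ?_⟩
      change b ⊗ₜ[R] (w : K) = _
      rw [← hr, Algebra.algebraMap_eq_smul_one, TensorProduct.smul_tmul]
  obtain ⟨b, hb⟩ := hz' z
  rw [hz] at hb
  change e = _ at hb
  refine ⟨b, ?_, ?_⟩
  · rw [hmem]
    have : (h * (1 - b)) ⊗ₜ[R] (1 : K) = (h ⊗ₜ[R] (1 : K)) * (1 - b ⊗ₜ[R] (1 : K)) := by
      rw [Algebra.TensorProduct.one_def, ← TensorProduct.sub_tmul,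
        Algebra.TensorProduct.tmul_mul_tmul, one_mul]
    rw [this, ← hb, he']
  · rw [hmem] at hh ⊢
    have : (h' * b) ⊗ₜ[R] (1 : K) = (h' ⊗ₜ[R] (1 : K)) * (b ⊗ₜ[R] (1 : K)) := by
      rw [Algebra.TensorProduct.tmul_mul_tmul, one_mul]
    have h2 : (h * h') ⊗ₜ[R] (1 : K) = (h ⊗ₜ[R] (1 : K)) * (h' ⊗ₜ[R] (1 : K)) := by
      rw [Algebra.TensorProduct.tmul_mul_tmul, one_mul]
    rw [this, ← hb, hc, ← mul_assoc, mul_comm (h' ⊗ₜ[R] (1 : K)), ← h2, hh, zero_mul]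

end Flat

/-! ### Normality of lattice algebras and supports of integral elements -/

section Normality

open Polynomial LaurentPolynomial

/-- Laurent polynomials which are integral over the polynomials over a normal domain are
polynomials. -/
lemma exists_toLaurent_eq_of_isIntegral {D : Type*} [CommRing D] [IsDomain D] [IsIntegrallyClosed D]
    (z : D[T;T⁻¹]) (hz : _root_.IsIntegral D[X] z) : ∃ q : D[X], toLaurent q = z := by
  -- `K` is also the fraction field of the Laurent polynomials, and `D[X]` is integrally closed in
  -- it.
  let K := FractionRing D[X]
  have hM : Submonoid.powers (X : D[X]) ≤ nonZeroDivisors D[X] :=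
    powers_le_nonZeroDivisors_of_noZeroDivisors X_ne_zero
  let g : D[T;T⁻¹] →+* K := IsLocalization.map _ (T := nonZeroDivisors D[X])
    (RingHom.id D[X]) hM
  let _ := g.toAlgebra
  have : IsScalarTower D[X] D[T;T⁻¹] K := IsScalarTower.of_algebraMap_eq'
    (IsLocalization.map_comp (S := D[T;T⁻¹]) (Q := K) (g := RingHom.id D[X]) hM).symm
  have := IsFractionRing.isFractionRing_of_isDomain_of_isLocalization
    (Submonoid.powers (X : D[X])) D[T;T⁻¹] K
  obtain ⟨q, hq⟩ := IsIntegrallyClosed.algebraMap_eq_of_integral (K := K)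
    (hz.map (IsScalarTower.toAlgHom D[X] D[T;T⁻¹] K))
  refine ⟨q, IsFractionRing.injective D[T;T⁻¹] K ?_⟩
  refine Eq.trans ?_ hq
  exact (IsScalarTower.algebraMap_apply D[X] D[T;T⁻¹] K q).symm

lemma isIntegrallyClosed_laurent (D : Type*) [CommRing D] [IsDomain D] [IsIntegrallyClosed D] :
    IsIntegrallyClosed D[T;T⁻¹] :=
  isIntegrallyClosed_of_isLocalization (R := D[X]) _ (Submonoid.powers (X : D[X]))
    (powers_le_nonZeroDivisors_of_noZeroDivisors X_ne_zero)

/-- Currying turns `D[ℤ × L]` into the Laurent polynomials over `D[L]`. -/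
lemma isIntegrallyClosed_addMonoidAlgebra_prod_int (D : Type*) [CommRing D] [IsDomain D]
    (L : Type*) [AddCommMonoid L] [IsDomain (AddMonoidAlgebra D L)]
    [IsIntegrallyClosed (AddMonoidAlgebra D L)] :
    IsIntegrallyClosed (AddMonoidAlgebra D (ℤ × L)) :=
  have := isIntegrallyClosed_laurent (AddMonoidAlgebra D L)
  IsIntegrallyClosed.of_equiv (R := AddMonoidAlgebra (AddMonoidAlgebra D L) ℤ)
    (AddMonoidAlgebra.curryRingEquiv (R := D) (M := ℤ) (N := L)).symm

/-- One Laurent variable is split off at a time, down to the field itself. -/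
lemma isIntegrallyClosed_addMonoidAlgebra_pi_int (D : Type*) [Field D] (n : ℕ) :
    IsIntegrallyClosed (AddMonoidAlgebra D (Fin n → ℤ)) := by
  induction n with
  | zero =>
    refine IsIntegrallyClosed.of_equiv (R := D) (RingEquiv.ofBijective
      (algebraMap D (AddMonoidAlgebra D (Fin 0 → ℤ))) ⟨?_, fun x => ?_⟩)
    · exact FaithfulSMul.algebraMap_injective _ _
    · refine ⟨x.coeff 0, ?_⟩
      refine AddMonoidAlgebra.coeff_injective (Finsupp.ext fun m => ?_)
      rw [Subsingleton.elim m 0]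
      simp
  | succ n ih =>
    have := isIntegrallyClosed_addMonoidAlgebra_prod_int D (Fin n → ℤ)
    let e : ℤ × (Fin n → ℤ) ≃+ (Fin (n + 1) → ℤ) :=
      { Fin.consEquiv (fun _ => ℤ) with
        map_add' := fun x y => by
          ext i
          refine Fin.cases ?_ (fun j => ?_) i <;> simp [Fin.consEquiv] }
    exact IsIntegrallyClosed.of_equiv (AddMonoidAlgebra.mapDomainRingEquiv D e)

lemma isIntegrallyClosed_addMonoidAlgebra_lattice (D : Type*) [Field D] (n : ℕ) :
    IsIntegrallyClosed (AddMonoidAlgebra D ((Fin n → ℤ) × ℤ)) := by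
  have := isIntegrallyClosed_addMonoidAlgebra_pi_int D n
  have := isIntegrallyClosed_addMonoidAlgebra_prod_int D (Fin n → ℤ)
  exact IsIntegrallyClosed.of_equiv
    (AddMonoidAlgebra.mapDomainRingEquiv D (AddEquiv.prodComm (M := ℤ) (N := Fin n → ℤ)))

section Degree

variable {k L : Type*} [Field k] [AddCommGroup L] (μ : L →+ ℤ)

/-- The homomorphism `χ^m ↦ χ^m T^{μ(m)}`. -/
noncomputable def degreeMap : AddMonoidAlgebra k L →+* (AddMonoidAlgebra k L)[T;T⁻¹] :=
  (AddMonoidAlgebra.curryRingEquiv (R := k) (M := ℤ) (N := L)).toRingHom.comp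
    (AddMonoidAlgebra.mapDomainRingHom k (μ.prod (AddMonoidHom.id L)))

lemma degreeMap_single (m : L) (c : k) : degreeMap μ (AddMonoidAlgebra.single m c) =
    AddMonoidAlgebra.single (μ m) (AddMonoidAlgebra.single m c) := by
  change AddMonoidAlgebra.curryRingEquiv (AddMonoidAlgebra.mapDomain _ _) = _
  rw [AddMonoidAlgebra.mapDomain_single]
  exact AddMonoidAlgebra.curryRingEquiv_single _ _ _

/-- `degreeMap` sorts monomials by their value under `μ`, so no coefficient is lost and the support
of `z` can be read off from its image. -/
lemma coeff_degreeMap (z : AddMonoidAlgebra k L) (d : ℤ) (m : L) :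
    ((degreeMap μ z).coeff d).coeff m = if μ m = d then z.coeff m else 0 := by
  classical
  induction z using AddMonoidAlgebra.induction_linear with
  | zero => simp
  | add x y hx hy =>
    rw [map_add, AddMonoidAlgebra.coeff_add, Finsupp.add_apply, AddMonoidAlgebra.coeff_add,
      Finsupp.add_apply, hx, hy]
    split_ifs <;> simp
  | single m' c =>
    rw [degreeMap_single]
    simp only [AddMonoidAlgebra.coeff_single, Finsupp.single_apply]
    by_cases h : m' = m
    · subst h
      by_cases h' : μ m' = d <;> simp [h']
    · split_ifs <;> simp [h]

lemma exists_toLaurent_degreeMap (z : AddMonoidAlgebra k L)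
    (hz : ∀ m, z.coeff m ≠ 0 → 0 ≤ μ m) : ∃ q, toLaurent q = degreeMap μ z := by
  have : z = ∑ m ∈ z.coeff.support, AddMonoidAlgebra.single m (z.coeff m) :=
    (AddMonoidAlgebra.sum_coeff_single z).symm
  have h2 : ∀ m ∈ z.coeff.support, ∃ q, toLaurent q =
      degreeMap μ (AddMonoidAlgebra.single m (z.coeff m)) := by
    intro m hm
    refine ⟨Polynomial.monomial (μ m).toNat (AddMonoidAlgebra.single m (z.coeff m)), ?_⟩
    rw [degreeMap_single, ← Polynomial.C_mul_X_pow_eq_monomial, Polynomial.toLaurent_C_mul_X_pow,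
      Int.toNat_of_nonneg (hz m (Finsupp.mem_support_iff.1 hm)), ← LaurentPolynomial.single_eq_C_mul_T]
  choose q hq using h2
  refine ⟨∑ m ∈ z.coeff.support.attach, q m.1 m.2, ?_⟩
  rw [map_sum]
  conv_rhs => rw [this, map_sum, ← Finset.sum_attach]
  exact Finset.sum_congr rfl fun m _ => hq m.1 m.2

/-- An element of `k[L]` which is integral over a ring of elements which are supported in
the half space `0 ≤ μ` is supported in this half space. -/
lemma nonneg_of_isIntegral [IsDomain (AddMonoidAlgebra k L)]
    [IsIntegrallyClosed (AddMonoidAlgebra k L)] {R : Type*} [CommRing R]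
    (θ : R →+* AddMonoidAlgebra k L) (hθ : ∀ r m, (θ r).coeff m ≠ 0 → 0 ≤ μ m)
    (z : AddMonoidAlgebra k L) (hz : θ.IsIntegralElem z) (m : L) (hm : z.coeff m ≠ 0) :
    0 ≤ μ m := by
  -- Under `degreeMap`, support in the half space `0 ≤ μ` becomes membership in the polynomial ring,
  -- where `exists_toLaurent_eq_of_isIntegral` applies.
  let S : Subring (AddMonoidAlgebra k L)[T;T⁻¹] := (toLaurent (R := AddMonoidAlgebra k L)).range
  have hS : ∀ r, degreeMap μ (θ r) ∈ S := fun r => exists_toLaurent_degreeMap μ (θ r) (hθ r)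
  let θ' : R →+* S := ((degreeMap μ).comp θ).codRestrict S hS
  obtain ⟨p, hp, hp'⟩ := hz
  have h1 : S.subtype.IsIntegralElem (degreeMap μ z) := by
    refine ⟨p.map θ', hp.map _, ?_⟩
    rw [Polynomial.eval₂_map]
    change Polynomial.eval₂ ((degreeMap μ).comp θ) _ _ = 0
    rw [← Polynomial.hom_eval₂, hp', map_zero]
  -- The monic equation has coefficients in the range of `toLaurent`; it is lifted to a monic
  -- equation over the polynomial ring.
  have h2 : (toLaurent (R := AddMonoidAlgebra k L)).IsIntegralElem (degreeMap μ z) := by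
    obtain ⟨p, hp, hp'⟩ := h1
    have hsurj : Function.Surjective (toLaurent (R := AddMonoidAlgebra k L)).rangeRestrict :=
      RingHom.rangeRestrict_surjective _
    obtain ⟨p', h3, -, h4⟩ := Polynomial.lifts_and_natDegree_eq_and_monic
      (f := (toLaurent (R := AddMonoidAlgebra k L)).rangeRestrict) (p := p)
      (by rw [Polynomial.lifts_iff_coeff_lifts]; exact fun n => hsurj _) hp
    refine ⟨p', h4, ?_⟩
    rw [← h3, Polynomial.eval₂_map] at hp'
    exact hp'
  obtain ⟨q, hq⟩ := exists_toLaurent_eq_of_isIntegral (degreeMap μ z) h2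
  by_contra hneg
  refine hm ?_
  have h3 := coeff_degreeMap μ z (μ m) m
  rw [if_pos rfl] at h3
  rw [← h3, ← hq]
  -- A polynomial has no coefficient at the negative exponent `μ m`.
  have h4 : (toLaurent q).coeff (μ m) = 0 := by
    rw [Polynomial.toLaurent_apply]
    rw [AddMonoidAlgebra.coeff_mapDomain]
    refine Finsupp.mapDomain_of_notMem_range _ _ ?_
    rintro ⟨a, ha⟩
    exact hneg (ha ▸ Int.natCast_nonneg a)
  rw [h4]
  rfl

end Degree

end Normality

/-! ### Monoids cut out by facet functionals -/

/-- A description of a monoid `P` as the set of points of a lattice `L` on which finitely many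
functionals, none of which is redundant, are nonnegative. -/
structure FacetData (P L : Type) [AddCommMonoid P] [AddCommGroup L] where
  /-- the inclusion -/
  incl : P →+ L
  incl_injective : Function.Injective incl
  /-- the set of facets -/
  ι : Type
  finite : Finite ι
  /-- the functional of a facet -/
  ν : ι → L →+ ℤ
  nonneg : ∀ i p, 0 ≤ ν i (incl p)
  exists_of_nonneg : ∀ x, (∀ i, 0 ≤ ν i x) → ∃ p, incl p = x
  /-- a point in the relative interior of a facet -/
  s : ι → P
  ν_s : ∀ i, ν i (incl (s i)) = 0
  ν_s_pos : ∀ i k, k ≠ i → 0 < ν k (incl (s i))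
  surjective : ∀ i, ∃ x, ν i x = 1

/-- A positive integer `b i` is at least one, so `N = ∑ |a i|` works for all indices at once. This
is how a multiple of an interior point absorbs finitely many negative values. -/
lemma exists_nat_add_mul_nonneg {ι : Type*} [Finite ι] (a b : ι → ℤ)
    (h : ∀ i, 0 < b i ∨ (b i = 0 ∧ 0 ≤ a i)) : ∃ N : ℕ, ∀ i, 0 ≤ a i + N * b i := by
  have := Fintype.ofFinite ι
  refine ⟨∑ i, (a i).natAbs, fun i => ?_⟩
  rcases h i with h | ⟨h, h'⟩
  · have h1 : (a i).natAbs ≤ ∑ i, (a i).natAbs :=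
      Finset.single_le_sum (f := fun i => (a i).natAbs) (fun _ _ => Nat.zero_le _)
        (Finset.mem_univ i)
    have h2 : ((a i).natAbs : ℤ) ≤ (∑ i, (a i).natAbs : ℕ) := by exact_mod_cast h1
    have h3 : -((a i).natAbs : ℤ) ≤ a i := by omega
    nlinarith
  · rw [h, mul_zero, add_zero]
    exact h'

/-! ### Orders of vanishing along a locally principal prime -/

section Valuation

variable {S : Type*} [CommRing S]

/-- If a prime `𝔭` becomes principal after inverting some `σ ∉ 𝔭`, then powers of the generator
which divide a product distribute over the factors. -/
lemma exists_pow_dvd_of_pow_dvd_mul (𝔭 : Ideal S) (h𝔭 : 𝔭.IsPrime) {σ t : S} (hσ : σ ∉ 𝔭)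
    (ht : IsRegular t) (htp : t ∈ 𝔭) (hx : ∀ x ∈ 𝔭, ∃ N : ℕ, t ∣ σ ^ N * x) (f g : S) (n N : ℕ)
    (h : t ^ n ∣ σ ^ N * (f * g)) :
    ∃ a b M : ℕ, a + b = n ∧ t ^ a ∣ σ ^ M * f ∧ t ^ b ∣ σ ^ M * g := by
  induction n with
  | zero => exact ⟨0, 0, 0, rfl, by simp, by simp⟩
  | succ n ih =>
    obtain ⟨a, b, M, hab, ⟨f', hf'⟩, ⟨g', hg'⟩⟩ := ih ((pow_dvd_pow t n.le_succ).trans h)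
    -- Dividing out the `t ^ n` already distributed leaves `t ∣ σ ^ N * (f' * g')`. As `σ ∉ 𝔭`, one
    -- of the cofactors lies in `𝔭`, and inverting `σ` allows one more `t` to be extracted from it.
    have h1 : t ^ n * t ∣ t ^ n * (σ ^ N * (f' * g')) := by
      have h2 : t ^ n * (σ ^ N * (f' * g')) = σ ^ (2 * M) * (σ ^ N * (f * g)) := by
        calc t ^ n * (σ ^ N * (f' * g')) = σ ^ N * ((t ^ a * f') * (t ^ b * g')) := by
              rw [← hab]; ring
          _ = _ := by rw [← hf', ← hg']; ring
      rw [h2, ← pow_succ]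
      exact h.mul_left _
    have h2 : t ∣ σ ^ N * (f' * g') := by
      obtain ⟨c, hc⟩ := h1
      refine ⟨c, (ht.pow n).left ?_⟩
      change t ^ n * _ = t ^ n * _
      rw [hc, mul_assoc]
    have h3 : f' * g' ∈ 𝔭 := by
      have : σ ^ N * (f' * g') ∈ 𝔭 := Ideal.mem_of_dvd _ h2 htp
      exact (h𝔭.mem_or_mem this).resolve_left fun h' => hσ (h𝔭.mem_of_pow_mem _ h')
    rcases h𝔭.mem_or_mem h3 with h4 | h4
    · obtain ⟨K, c, hc⟩ := hx f' h4
      refine ⟨a + 1, b, K + M, by omega, ⟨c, ?_⟩, ?_⟩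
      · rw [pow_add, mul_assoc, hf', mul_left_comm, hc, pow_succ]; ring
      · rw [pow_add, mul_assoc]
        exact Dvd.dvd.mul_left ⟨g', hg'⟩ _
    · obtain ⟨K, c, hc⟩ := hx g' h4
      refine ⟨a, b + 1, K + M, by omega, ?_, ⟨c, ?_⟩⟩
      · rw [pow_add, mul_assoc]
        exact Dvd.dvd.mul_left ⟨f', hf'⟩ _
      · rw [pow_add, mul_assoc, hg', mul_left_comm, hc, pow_succ]; ring

end Valuation

/-! ### Arithmetic of facets and normality of facet rings -/

namespace FacetData

variable {P L : Type} [AddCommMonoid P] [AddCommGroup L] (D : FacetData P L)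

/-- The functional of a facet on the monoid. -/
noncomputable def val (i : D.ι) (p : P) : ℤ := D.ν i (D.incl p)

lemma val_nonneg (i : D.ι) (p : P) : 0 ≤ D.val i p := D.nonneg i p

lemma val_add (i : D.ι) (p q : P) : D.val i (p + q) = D.val i p + D.val i q := by
  simp [val]

lemma val_nsmul (i : D.ι) (n : ℕ) (p : P) : D.val i (n • p) = n * D.val i p := by
  simp [val]

lemma val_zero (i : D.ι) : D.val i 0 = 0 := by
  simp [val]

lemma val_s (i : D.ι) : D.val i (D.s i) = 0 := D.ν_s i

/-- `P` contains every lattice point on which all `ν i` are nonnegative, so divisibility of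
monomials is tested facet by facet. -/
lemma exists_add_eq {p q : P} (h : ∀ i, D.val i p ≤ D.val i q) : ∃ r, p + r = q := by
  obtain ⟨r, hr⟩ := D.exists_of_nonneg (D.incl q - D.incl p) fun i => by
    rw [map_sub]; exact sub_nonneg.2 (h i)
  exact ⟨r, D.incl_injective (by rw [map_add, hr, add_sub_cancel])⟩

/-- The point `s i` is positive on every facet but the `i`-th, where it is zero; a large multiple of
it repairs all the other inequalities. -/
lemma exists_incl_eq_add (i : D.ι) (x : L) (hx : 0 ≤ D.ν i x) :
    ∃ (N : ℕ) (r : P), D.incl r = x + N • D.incl (D.s i) := by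
  have := D.finite
  obtain ⟨N, hN⟩ := exists_nat_add_mul_nonneg (fun k => D.ν k x)
    (fun k => D.ν k (D.incl (D.s i))) (fun k => by
      by_cases h : k = i
      · subst h; exact Or.inr ⟨D.ν_s k, hx⟩
      · exact Or.inl (D.ν_s_pos i k h))
  obtain ⟨r, hr⟩ := D.exists_of_nonneg (x + N • D.incl (D.s i)) fun k => by
    rw [map_add, map_nsmul, nsmul_eq_mul]; exact hN k
  exact ⟨N, r, hr⟩

/-- Inverting `s i` enlarges `P` to the half space `0 ≤ ν i`, in which divisibility is the
comparison of a single value. -/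
lemma exists_nsmul_add_eq (i : D.ι) {p q : P} (h : D.val i p ≤ D.val i q) :
    ∃ (N : ℕ) (r : P), N • D.s i + q = p + r ∧ D.val i r = D.val i q - D.val i p := by
  obtain ⟨N, r, hr⟩ := D.exists_incl_eq_add i (D.incl q - D.incl p) (by
    rw [map_sub]; exact sub_nonneg.2 h)
  have h1 : N • D.s i + q = p + r := D.incl_injective (by
    rw [map_add, map_add, hr, map_nsmul]; abel)
  refine ⟨N, r, h1, ?_⟩
  have h2 := congrArg (D.val i) h1
  rw [val_add, val_add, val_nsmul, val_s] at h2
  linarith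

lemma exists_val_eq_one (i : D.ι) : ∃ t : P, D.val i t = 1 := by
  obtain ⟨x, hx⟩ := D.surjective i
  obtain ⟨N, r, hr⟩ := D.exists_incl_eq_add i x (by rw [hx]; exact zero_le_one)
  refine ⟨r, ?_⟩
  rw [val, hr, map_add, map_nsmul, D.ν_s, hx, smul_zero, add_zero]

/-- An element of value one at a facet. -/
noncomputable def t (i : D.ι) : P := (D.exists_val_eq_one i).choose

lemma val_t (i : D.ι) : D.val i (D.t i) = 1 := (D.exists_val_eq_one i).choose_spec

variable (k : Type u) [Field k]

/-- The prime ideal of a facet. -/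
noncomputable def facetIdeal (i : D.ι) : Ideal (AddMonoidAlgebra k P) :=
  Ideal.span ((fun p => AddMonoidAlgebra.single p 1) '' {p | 0 < D.val i p})

open Classical in
/-- The projection `k[P] → k[L]` onto the monoid algebra of a facet. -/
noncomputable def facetMap (i : D.ι) : AddMonoidAlgebra k P →ₐ[k] AddMonoidAlgebra k L :=
  AddMonoidAlgebra.lift k (AddMonoidAlgebra k L) P
    { toFun := fun p => if D.val i p.toAdd = 0 then AddMonoidAlgebra.single (D.incl p.toAdd) 1
        else 0
      map_one' := by
        rw [toAdd_one, if_pos (D.val_zero i), map_zero]; rfl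
      map_mul' := fun p q => by
        -- Values are nonnegative, so a sum has value zero only if both terms do.
        have hp := D.val_nonneg i p.toAdd
        have hq := D.val_nonneg i q.toAdd
        rw [toAdd_mul, val_add]
        by_cases h1 : D.val i p.toAdd = 0
        · by_cases h2 : D.val i q.toAdd = 0
          · rw [if_pos (by omega), if_pos h1, if_pos h2, AddMonoidAlgebra.single_mul_single,
              map_add, mul_one]
          · rw [if_neg (by omega), if_neg h2, mul_zero]
        · rw [if_neg (by omega), if_neg h1, zero_mul] }

open Classical in
lemma facetMap_single (i : D.ι) (p : P) (c : k) : D.facetMap k i (AddMonoidAlgebra.single p c) =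
    if D.val i p = 0 then AddMonoidAlgebra.single (D.incl p) c else 0 := by
  rw [facetMap, AddMonoidAlgebra.lift_single]
  change c • (if D.val i p = 0 then AddMonoidAlgebra.single (D.incl p) 1 else 0) = _
  split_ifs <;> simp

lemma coeff_facetMap (i : D.ι) (f : AddMonoidAlgebra k P) (p : P) (hp : D.val i p = 0) :
    (D.facetMap k i f).coeff (D.incl p) = f.coeff p := by
  classical
  induction f using AddMonoidAlgebra.induction_linear with
  | zero => simp
  | add x y hx hy =>
    rw [map_add, AddMonoidAlgebra.coeff_add, Finsupp.add_apply, AddMonoidAlgebra.coeff_add,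
      Finsupp.add_apply, hx, hy]
  | single m c =>
    rw [facetMap_single]
    simp only [AddMonoidAlgebra.coeff_single, Finsupp.single_apply]
    by_cases h : m = p
    · subst h
      rw [if_pos hp]; simp
    · rw [if_neg h]
      split_ifs <;> simp [D.incl_injective.eq_iff, h]

lemma exists_of_coeff_facetMap_ne_zero (i : D.ι) (f : AddMonoidAlgebra k P) (m : L)
    (hm : (D.facetMap k i f).coeff m ≠ 0) : ∃ p, D.incl p = m ∧ D.val i p = 0 := by
  classical
  induction f using AddMonoidAlgebra.induction_linear with
  | zero => simp at hm
  | add x y hx hy =>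
    rw [map_add, AddMonoidAlgebra.coeff_add, Finsupp.add_apply] at hm
    by_cases h : (D.facetMap k i x).coeff m = 0
    · exact hy (by rwa [h, zero_add] at hm)
    · exact hx h
  | single p c =>
    rw [facetMap_single] at hm
    split_ifs at hm with h
    · rw [AddMonoidAlgebra.coeff_single, Finsupp.single_apply] at hm
      exact ⟨p, by by_contra h'; exact hm (if_neg h'), h⟩
    · simp at hm

lemma mem_of_forall_single {R M : Type*} [Semiring R] [AddCommMonoid M]
    (I : Ideal (AddMonoidAlgebra R M)) (f : AddMonoidAlgebra R M)
    (h : ∀ p, f.coeff p ≠ 0 → AddMonoidAlgebra.single p 1 ∈ I) : f ∈ I := by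
  rw [← AddMonoidAlgebra.sum_coeff_single f]
  refine Ideal.sum_mem _ fun p hp => ?_
  have : (AddMonoidAlgebra.single p (f.coeff p) : AddMonoidAlgebra R M) =
      AddMonoidAlgebra.single 0 (f.coeff p) * AddMonoidAlgebra.single p 1 := by
    rw [AddMonoidAlgebra.single_mul_single, zero_add, mul_one]
  rw [this]
  exact Ideal.mul_mem_left _ _ (h p (Finsupp.mem_support_iff.1 hp))

/-- The monomials of value zero at the facet are sent to distinct monomials of `k[L]` and the others
to zero. Hence the facet ring `k[P] / facetIdeal` embeds in the domain `k[L]`. -/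
lemma ker_facetMap (i : D.ι) : RingHom.ker (D.facetMap k i).toRingHom = D.facetIdeal k i := by
  classical
  apply le_antisymm
  · intro f hf
    refine mem_of_forall_single _ _ fun p hp => Ideal.subset_span ⟨p, ?_, rfl⟩
    refine (D.val_nonneg i p).lt_of_ne fun h => hp ?_
    rw [← D.coeff_facetMap k i f p h.symm, show D.facetMap k i f = 0 from hf]
    rfl
  · rw [facetIdeal, Ideal.span_le]
    rintro _ ⟨p, hp, rfl⟩
    change D.facetMap k i _ = 0
    rw [facetMap_single, if_neg (ne_of_gt hp)]

lemma mem_range_facetMap (i : D.ι) (z : AddMonoidAlgebra k L)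
    (hz : ∀ m, z.coeff m ≠ 0 → D.ν i m = 0 ∧ ∀ j, 0 ≤ D.ν j m) :
    z ∈ (D.facetMap k i).range := by
  classical
  rw [← AddMonoidAlgebra.sum_coeff_single z]
  refine Subalgebra.sum_mem _ fun m hm => ?_
  obtain ⟨h1, h2⟩ := hz m (Finsupp.mem_support_iff.1 hm)
  obtain ⟨p, rfl⟩ := D.exists_of_nonneg m h2
  refine ⟨AddMonoidAlgebra.single p (z.coeff (D.incl p)), ?_⟩
  exact (D.facetMap_single k i _ _).trans (if_pos h1)

/-- The coordinate ring of a facet is integrally closed in the fraction field of `k[L]`. -/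
lemma mem_range_of_isIntegral [IsDomain (AddMonoidAlgebra k L)]
    [IsIntegrallyClosed (AddMonoidAlgebra k L)] (i : D.ι) (K : Type*) [Field K]
    [Algebra (AddMonoidAlgebra k L) K] [IsFractionRing (AddMonoidAlgebra k L) K] (z : K)
    (hz : ((algebraMap (AddMonoidAlgebra k L) K).comp (D.facetMap k i).toRingHom).IsIntegralElem z) :
    z ∈ ((algebraMap (AddMonoidAlgebra k L) K).comp (D.facetMap k i).toRingHom).range := by
  have h1 : _root_.IsIntegral (AddMonoidAlgebra k L) z := by
    obtain ⟨p, hp, hp'⟩ := hz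
    refine ⟨p.map (D.facetMap k i).toRingHom, hp.map _, ?_⟩
    rwa [Polynomial.eval₂_map]
  obtain ⟨y, rfl⟩ := IsIntegrallyClosed.algebraMap_eq_of_integral h1
  have hy : (D.facetMap k i).toRingHom.IsIntegralElem y := by
    obtain ⟨p, hp, hp'⟩ := hz
    refine ⟨p, hp, IsFractionRing.injective (AddMonoidAlgebra k L) K ?_⟩
    rw [Polynomial.hom_eval₂, hp', map_zero]
  -- The half-space lemma, applied to `ν i`, `-ν i` and every other `ν j`, confines the support of
  -- `y` to the lattice points of the facet.
  have h2 : ∀ μ : L →+ ℤ, (∀ p, D.val i p = 0 → 0 ≤ μ (D.incl p)) → ∀ m, y.coeff m ≠ 0 →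
      0 ≤ μ m := fun μ hμ => nonneg_of_isIntegral μ (D.facetMap k i).toRingHom (fun r m hm => by
    obtain ⟨p, rfl, hp⟩ := D.exists_of_coeff_facetMap_ne_zero k i r m hm
    exact hμ p hp) y hy
  obtain ⟨r, hr⟩ := D.mem_range_facetMap k i y fun m hm => ⟨le_antisymm (by
    have := h2 (-D.ν i) (fun p hp => by
      rw [AddMonoidHom.neg_apply, show D.ν i (D.incl p) = 0 from hp, neg_zero]) m hm
    rw [AddMonoidHom.neg_apply] at this
    linarith) (h2 (D.ν i) (fun p _ => D.nonneg i p) m hm),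
    fun j => h2 (D.ν j) (fun p _ => D.nonneg j p) m hm⟩
  exact ⟨r, congrArg _ hr⟩

end FacetData

/-! ### Monomials in algebras over a monoid algebra -/

section Chi

variable (k : Type u) [Field k] {P : Type} [AddCommMonoid P] (S : Type*) [CommRing S]
  [Algebra (AddMonoidAlgebra k P) S]

/-- The monomials in an algebra over a monoid algebra. -/
noncomputable def chi (p : P) : S := algebraMap (AddMonoidAlgebra k P) S (AddMonoidAlgebra.single p 1)

lemma chi_zero : chi k S (0 : P) = 1 := map_one _

lemma chi_add (p q : P) : chi k S (p + q) = chi k S p * chi k S q := by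
  rw [chi, chi, chi, ← map_mul, AddMonoidAlgebra.single_mul_single, mul_one]

lemma chi_nsmul (n : ℕ) (p : P) : chi k S (n • p) = chi k S p ^ n := by
  induction n with
  | zero => rw [zero_smul, pow_zero, chi_zero]
  | succ n ih => rw [succ_nsmul, chi_add, ih, pow_succ]

lemma isRegular_of_isSMulRegular {R S : Type*} [CommRing R] [CommRing S] [Algebra R S] {r : R}
    (h : IsSMulRegular S r) : IsRegular (algebraMap R S r) := by
  have hl : IsLeftRegular (algebraMap R S r) := by
    intro x y hxy
    apply h
    simpa only [Algebra.smul_def] using hxy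
  exact isLeftRegular_iff_isRegular.1 hl

end Chi

/-- Solutions in a flat algebra of divisibility conditions are generated by the solutions in the
base ring. -/
lemma mem_map_of_forall_dvd {R S ι : Type*} [CommRing R] [CommRing S] [Algebra R S]
    [Module.Flat R S] [Finite ι] (I : Ideal R) (x y : ι → R)
    (hI : ∀ r : R, (∀ i, y i ∣ x i * r) → r ∈ I) (f : S)
    (hf : ∀ i, algebraMap R S (y i) ∣ algebraMap R S (x i) * f) :
    f ∈ I.map (algebraMap R S) := by
  open TensorProduct in
  classical
  have := Fintype.ofFinite ι
  -- The divisibility conditions on `r` say that `r` annihilates the vector of the classes `x i` in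
  -- `∏ R / (y i)`; this product commutes with the tensor product because `ι` is finite.
  let J : ι → Ideal R := fun i => Ideal.span {y i}
  let m : ∀ i, R ⧸ J i := fun i => Ideal.Quotient.mk _ (x i)
  refine mem_map_of_tmul_eq_zero I m (fun r hr => hI r fun i => ?_) f ?_
  · have h1 : Ideal.Quotient.mk (J i) (r * x i) = 0 := congrFun hr i
    rwa [Ideal.Quotient.eq_zero_iff_mem, Ideal.mem_span_singleton, mul_comm] at h1
  · apply (TensorProduct.piRight R R S (fun i => R ⧸ J i)).injective
    rw [map_zero, TensorProduct.piRight_apply, TensorProduct.piRightHom_tmul]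
    funext i
    obtain ⟨g, hg⟩ := hf i
    have h1 : m i = x i • (1 : R ⧸ J i) := by
      rw [Algebra.smul_def, mul_one]; rfl
    have h2 : x i • f = y i • g := by
      rw [Algebra.smul_def, Algebra.smul_def]
      exact hg
    have h3 : y i • (1 : R ⧸ J i) = 0 := by
      rw [Algebra.smul_def, mul_one]
      exact Ideal.Quotient.eq_zero_iff_mem.2 (Ideal.mem_span_singleton_self _)
    change f ⊗ₜ m i = 0
    rw [h1, ← TensorProduct.smul_tmul, h2, TensorProduct.smul_tmul, h3, TensorProduct.tmul_zero]

/-! ### Facet ideals in flat algebras -/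

namespace FacetData

variable {P L : Type} [AddCommMonoid P] [AddCommGroup L] (D : FacetData P L)
  (k : Type u) [Field k]

/-- A monomial becomes invertible in `k[L]`, which contains `k[P]`; regularity then passes to flat
algebras. -/
lemma isRegular_chi (D : FacetData P L) (S : Type*) [CommRing S] [Algebra (AddMonoidAlgebra k P) S]
    [Module.Flat (AddMonoidAlgebra k P) S] (p : P) : IsRegular (chi k S p) := by
  refine isRegular_of_isSMulRegular (Module.Flat.isSMulRegular_of_isRegular ?_)
  refine isLeftRegular_iff_isRegular.1 fun x y hxy => ?_
  have hinj : Function.Injective (AddMonoidAlgebra.mapDomainRingHom k D.incl) :=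
    AddMonoidAlgebra.mapDomain_injective D.incl_injective
  apply hinj
  have h := congrArg (AddMonoidAlgebra.mapDomainRingHom k D.incl) hxy
  simp only [map_mul] at h
  have h2 : AddMonoidAlgebra.single (-D.incl p) 1 *
      AddMonoidAlgebra.mapDomainRingHom k D.incl (AddMonoidAlgebra.single p 1) = 1 := by
    change _ * AddMonoidAlgebra.mapDomain _ _ = _
    rw [AddMonoidAlgebra.mapDomain_single, AddMonoidAlgebra.single_mul_single, neg_add_cancel,
      mul_one]
    rfl
  have h3 := congrArg (AddMonoidAlgebra.single (-D.incl p) (1 : k) * ·) h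
  simpa only [← mul_assoc, h2, one_mul] using h3

section Local

variable (S : Type*) [CommRing S] [Algebra (AddMonoidAlgebra k P) S]

/-- The ideal of a facet in an algebra over the monoid algebra. -/
noncomputable def facetIdealMap (i : D.ι) : Ideal S :=
  (D.facetIdeal k i).map (algebraMap (AddMonoidAlgebra k P) S)

lemma facetIdealMap_eq (i : D.ι) : D.facetIdealMap k S i =
    Ideal.span (chi k S '' {p | 0 < D.val i p}) := by
  rw [facetIdealMap, facetIdeal, Ideal.map_span, Set.image_image]
  rfl

lemma chi_mem_facetIdealMap {i : D.ι} {p : P} (h : 0 < D.val i p) :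
    chi k S p ∈ D.facetIdealMap k S i := by
  rw [facetIdealMap_eq]
  exact Ideal.subset_span ⟨p, h, rfl⟩

/-- By flatness the quotient of `S` by the facet ideal embeds in `S ⊗ k[L]`, where a monomial of the
facet becomes a unit. If this unit is zero, the quotient is trivial. -/
lemma facetIdealMap_eq_top_of_chi_mem [Module.Flat (AddMonoidAlgebra k P) S] {i : D.ι} {p : P}
    (hp : D.val i p = 0) (h : chi k S p ∈ D.facetIdealMap k S i) :
    D.facetIdealMap k S i = ⊤ := by
  open TensorProduct in
  let _ := (D.facetMap k i).toRingHom.toAlgebra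
  have hm := mem_map_ker_iff (S := S) (C := AddMonoidAlgebra k L) (D.facetIdeal k i)
    (D.ker_facetMap k i)
  rw [Ideal.eq_top_iff_one]
  refine (hm 1).2 ?_
  have h1 : (chi k S p) ⊗ₜ[AddMonoidAlgebra k P] (1 : AddMonoidAlgebra k L) = 0 := (hm _).1 h
  have h2 : (chi k S p) ⊗ₜ[AddMonoidAlgebra k P] (1 : AddMonoidAlgebra k L) =
      1 ⊗ₜ AddMonoidAlgebra.single (D.incl p) 1 := by
    rw [chi, Algebra.algebraMap_eq_smul_one, TensorProduct.smul_tmul,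
      ← Algebra.algebraMap_eq_smul_one]
    congr 1
    exact (D.facetMap_single k i p 1).trans (if_pos hp)
  have h3 := congrArg (· * ((1 : S) ⊗ₜ[AddMonoidAlgebra k P]
    (AddMonoidAlgebra.single (-D.incl p) 1 : AddMonoidAlgebra k L))) (h2.symm.trans h1)
  simp only [Algebra.TensorProduct.tmul_mul_tmul, AddMonoidAlgebra.single_mul_single,
    add_neg_cancel, mul_one, zero_mul] at h3
  exact h3

/-- After inverting `χ^{s i}` the facet ideal is generated by `χ^{t i}`, since each of its
generators has value at least one, the value of `t i`. -/
lemma exists_dvd_of_mem_facetIdealMap {i : D.ι} {x : S} (hx : x ∈ D.facetIdealMap k S i) :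
    ∃ N : ℕ, chi k S (D.t i) ∣ chi k S (D.s i) ^ N * x := by
  rw [facetIdealMap_eq] at hx
  induction hx using Submodule.span_induction with
  | mem x hx =>
    obtain ⟨p, hp, rfl⟩ := hx
    obtain ⟨N, r, h, -⟩ := D.exists_nsmul_add_eq i (p := D.t i) (q := p) (by
      rw [val_t]; exact Int.add_one_le_iff.2 hp)
    exact ⟨N, chi k S r, by rw [← chi_nsmul, ← chi_add, h, chi_add]⟩
  | zero => exact ⟨0, by simp⟩
  | add x y _ _ hx hy =>
    obtain ⟨N, hN⟩ := hx
    obtain ⟨M, hM⟩ := hy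
    refine ⟨N + M, ?_⟩
    have : chi k S (D.s i) ^ (N + M) * (x + y) = chi k S (D.s i) ^ M * (chi k S (D.s i) ^ N * x) +
        chi k S (D.s i) ^ N * (chi k S (D.s i) ^ M * y) := by ring
    rw [this]
    exact dvd_add (hN.mul_left _) (hM.mul_left _)
  | smul a x _ hx =>
    obtain ⟨N, hN⟩ := hx
    refine ⟨N, ?_⟩
    rw [smul_eq_mul, mul_left_comm]
    exact hN.mul_left _

lemma val_eq_zero_of_isUnit {i : D.ι} (h : D.facetIdealMap k S i ≠ ⊤) {p : P}
    (hp : IsUnit (chi k S p)) : D.val i p = 0 := by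
  by_contra h'
  exact h (Ideal.eq_top_of_isUnit_mem _
    (D.chi_mem_facetIdealMap k S ((D.val_nonneg i p).lt_of_ne (Ne.symm h'))) hp)

/-- If `p'` had the larger value at facet `i`, cancelling `χ^p` would put a unit multiple of `χ^{N s
i}` into the facet ideal, although `s i` has value zero there. -/
lemma val_le_of_chi_mul_eq [Module.Flat (AddMonoidAlgebra k P) S] {i : D.ι} (h : D.facetIdealMap k S i ≠ ⊤) {p p' : P} {v v' : S}
    (hv : IsUnit v) (e : chi k S p * v = chi k S p' * v') : D.val i p' ≤ D.val i p := by
  by_contra! hlt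
  obtain ⟨N, r, h1, h2⟩ := D.exists_nsmul_add_eq i hlt.le
  have h3 : chi k S p * (chi k S (N • D.s i) * v) = chi k S p * (chi k S r * v') := by
    calc chi k S p * (chi k S (N • D.s i) * v) = chi k S (N • D.s i) * (chi k S p * v) := by ring
      _ = chi k S (N • D.s i + p') * v' := by rw [e, chi_add]; ring
      _ = _ := by rw [h1, chi_add]; ring
  have h4 : chi k S (N • D.s i) * v = chi k S r * v' := (D.isRegular_chi k S p).left h3
  have h5 : chi k S (N • D.s i) * v ∈ D.facetIdealMap k S i := by
    rw [h4]
    exact Ideal.mul_mem_right _ _ (D.chi_mem_facetIdealMap k S (by omega))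
  rw [Ideal.mul_unit_mem_iff_mem _ hv] at h5
  exact h (D.facetIdealMap_eq_top_of_chi_mem k S (by rw [val_nsmul, val_s, mul_zero]) h5)

/-- Only generators matter: for them `p' + p` dominates `q` at every facet. -/
lemma chi_dvd_mul_of_mem_span {p' q : P} {a : D.ι → ℕ} (hq : ∀ i, D.val i q ≤ a i + D.val i p')
    {f : S} (hf : f ∈ Ideal.span (chi k S '' {p | ∀ i, (a i : ℤ) ≤ D.val i p})) :
    chi k S q ∣ chi k S p' * f := by
  have : Ideal.span (chi k S '' {p | ∀ i, (a i : ℤ) ≤ D.val i p}) ≤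
      Submodule.comap (LinearMap.mulLeft S (chi k S p')) (Ideal.span {chi k S q}) := by
    rw [Ideal.span_le]
    rintro _ ⟨p, hp, rfl⟩
    obtain ⟨r, hr⟩ := D.exists_add_eq (p := q) (q := p' + p) (fun i => by
      rw [val_add]; linarith [hq i, hp i])
    change chi k S p' * chi k S p ∈ Ideal.span {chi k S q}
    rw [Ideal.mem_span_singleton, ← chi_add, ← hr, chi_add]
    exact dvd_mul_right _ _
  exact Ideal.mem_span_singleton.1 (this hf)

variable [IsLocalRing S]

/-- In a local ring an ideal generated by nonunits is proper. -/
lemma exists_isUnit_of_facetIdealMap_eq_top {i : D.ι} (h : D.facetIdealMap k S i = ⊤) :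
    ∃ p, 0 < D.val i p ∧ IsUnit (chi k S p) := by
  by_contra! H
  have : D.facetIdealMap k S i ≤ IsLocalRing.maximalIdeal S := by
    rw [facetIdealMap_eq, Ideal.span_le]
    rintro _ ⟨p, hp, rfl⟩
    exact H p hp
  rw [h] at this
  exact (IsLocalRing.maximalIdeal.isMaximal S).ne_top (top_le_iff.1 this)

variable [Module.Flat (AddMonoidAlgebra k P) S]

/-- In a local ring which is flat over the monoid algebra, monomials which are associated differ
by monomials which are units. -/
theorem exists_add_eq_add_of_chi_mul_eq (D : FacetData P L) {p p' : P} {v v' : S} (hv : IsUnit v) (hv' : IsUnit v')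
    (e : chi k S p * v = chi k S p' * v') :
    ∃ c c', IsUnit (chi k S c) ∧ IsUnit (chi k S c') ∧ p + c = p' + c' := by
  classical
  have := D.finite
  have := Fintype.ofFinite D.ι
  have h1 : ∀ i, ∃ h, IsUnit (chi k S h) ∧
      (D.facetIdealMap k S i = ⊤ → 0 < D.val i h) := by
    intro i
    by_cases h : D.facetIdealMap k S i = ⊤
    · obtain ⟨h, h2, h3⟩ := D.exists_isUnit_of_facetIdealMap_eq_top k S h
      exact ⟨h, h3, fun _ => h2⟩
    · exact ⟨0, by rw [chi_zero]; exact isUnit_one, fun h' => (h h').elim⟩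
  choose h hu hpos using h1
  -- `H` is a unit monomial, positive exactly at the facets whose ideal is the unit ideal. At the
  -- other facets `p` and `p'` have equal values, so a multiple of `H` makes up all the differences.
  let H : P := ∑ i, h i
  have hH : IsUnit (chi k S H) := by
    have : ∀ s : Finset D.ι, IsUnit (chi k S (∑ i ∈ s, h i)) := by
      intro s
      induction s using Finset.induction_on with
      | empty => rw [Finset.sum_empty, chi_zero]; exact isUnit_one
      | insert a s ha ih => rw [Finset.sum_insert ha, chi_add]; exact (hu a).mul ih
    exact this _
  have hH' : ∀ i, D.facetIdealMap k S i = ⊤ → 0 < D.val i H := by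
    intro i hi
    have : D.val i H = ∑ j, D.val i (h j) := by simp [val, H]
    rw [this]
    exact Finset.sum_pos' (fun j _ => D.val_nonneg _ _) ⟨i, Finset.mem_univ i, hpos i hi⟩
  have hH0 : ∀ i, D.facetIdealMap k S i ≠ ⊤ → D.val i H = 0 := fun i hi =>
    D.val_eq_zero_of_isUnit k S hi hH
  have heq : ∀ i, D.facetIdealMap k S i ≠ ⊤ → D.val i p = D.val i p' := fun i hi =>
    le_antisymm (D.val_le_of_chi_mul_eq k S hi hv' e.symm) (D.val_le_of_chi_mul_eq k S hi hv e)
  obtain ⟨N, hN⟩ := exists_nat_add_mul_nonneg (fun i => D.val i p - D.val i p')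
    (fun i => D.val i H) (fun i => by
      by_cases hi : D.facetIdealMap k S i = ⊤
      · exact Or.inl (hH' i hi)
      · exact Or.inr ⟨hH0 i hi, by rw [heq i hi, sub_self]⟩)
  obtain ⟨c', hc'⟩ := D.exists_add_eq (p := p') (q := p + N • H) (fun i => by
    rw [val_add, val_nsmul]; linarith [hN i])
  obtain ⟨M, hM⟩ := exists_nat_add_mul_nonneg (fun i => - D.val i c')
    (fun i => D.val i H) (fun i => by
      by_cases hi : D.facetIdealMap k S i = ⊤
      · exact Or.inl (hH' i hi)
      · refine Or.inr ⟨hH0 i hi, ?_⟩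
        have := congrArg (D.val i) hc'
        rw [val_add, val_add, val_nsmul, hH0 i hi, heq i hi] at this
        linarith)
  -- `χ^{c'}` divides a power of the unit `χ^H`, hence is itself a unit.
  obtain ⟨r, hr⟩ := D.exists_add_eq (p := c') (q := M • H) (fun i => by
    rw [val_nsmul]; linarith [hM i])
  refine ⟨N • H, c', ?_, ?_, hc'.symm⟩
  · rw [chi_nsmul]; exact hH.pow N
  · have : IsUnit (chi k S (c' + r)) := by rw [hr, chi_nsmul]; exact hH.pow M
    rw [chi_add] at this
    exact isUnit_of_mul_isUnit_left this

end Local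

/-! ### Divisors of monomials -/

section Factor

variable (S : Type*) [CommRing S] [Algebra (AddMonoidAlgebra k P) S]
  [Module.Flat (AddMonoidAlgebra k P) S]

/-- Comparison of coefficients at `M • s i + p`: a monomial occurring in a multiple of `χ^{a t i}`
has value at least `a` at the facet, and `s i` contributes nothing. -/
lemma le_val_of_dvd {i : D.ι} {a M : ℕ} {r : AddMonoidAlgebra k P}
    (h : (AddMonoidAlgebra.single (D.t i) 1 : AddMonoidAlgebra k P) ^ a ∣
      AddMonoidAlgebra.single (D.s i) 1 ^ M * r) {p : P} (hp : r.coeff p ≠ 0) :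
    (a : ℤ) ≤ D.val i p := by
  have hc : IsCancelAdd P :=
    { add_left_cancel := fun a b c h => D.incl_injective (by
        have := congrArg D.incl h
        simpa only [map_add, add_right_inj] using this)
      add_right_cancel := fun a b c h => D.incl_injective (by
        have := congrArg D.incl h
        simpa only [map_add, add_left_inj] using this) }
  obtain ⟨y, hy⟩ := h
  rw [AddMonoidAlgebra.single_pow, AddMonoidAlgebra.single_pow, one_pow, one_pow] at hy
  have h1 := congrArg (fun z => z.coeff (M • D.s i + p)) hy
  simp only [AddMonoidAlgebra.coeff_single_mul_add, one_mul] at h1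
  by_cases hd : ∃ d, a • D.t i + d = M • D.s i + p
  · obtain ⟨d, hd⟩ := hd
    have := congrArg (D.val i) hd
    rw [val_add, val_add, val_nsmul, val_nsmul, val_t, val_s] at this
    have := D.val_nonneg i d
    linarith
  · push Not at hd
    rw [AddMonoidAlgebra.coeff_single_mul_of_forall_add_ne _ _ hd] at h1
    exact (hp h1).elim

/-- Over `k[P]` the solutions of these finitely many divisibility conditions lie in the monomial
ideal, by `le_val_of_dvd`; flatness carries this over to `S`. -/
lemma mem_span_chi_of_dvd (a M : D.ι → ℕ) (f : S)
    (hf : ∀ i, chi k S (D.t i) ^ a i ∣ chi k S (D.s i) ^ M i * f) :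
    f ∈ Ideal.span (chi k S '' {p | ∀ i, (a i : ℤ) ≤ D.val i p}) := by
  have := D.finite
  have h := mem_map_of_forall_dvd (S := S) (Ideal.span ((fun p => AddMonoidAlgebra.single p 1) ''
    {p | ∀ i, (a i : ℤ) ≤ D.val i p}) : Ideal (AddMonoidAlgebra k P))
    (fun i => AddMonoidAlgebra.single (D.s i) 1 ^ M i)
    (fun i => AddMonoidAlgebra.single (D.t i) 1 ^ a i) (fun r hr => ?_) f fun i => ?_
  · rw [Ideal.map_span, Set.image_image] at h
    exact h
  · exact mem_of_forall_single _ _ fun p hp => Ideal.subset_span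
      ⟨p, fun i => D.le_val_of_dvd k (hr i) hp, rfl⟩
  · rw [map_pow, map_pow]
    exact hf i

variable [IsLocalRing S]

/-- Where the facet ideal is prime, the order of `χ^q` is distributed over `f` and `g` one step at a
time. A facet with unit ideal imposes no condition, and the whole order is assigned to `f`. -/
lemma exists_pow_dvd_of_mul_eq_chi (hprime : ∀ i, D.facetIdealMap k S i ≠ ⊤ →
    (D.facetIdealMap k S i).IsPrime) {f g : S} {q : P} (h : f * g = chi k S q) (i : D.ι) :
    ∃ a b M : ℕ, ((a + b : ℕ) : ℤ) = D.val i q ∧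
      chi k S (D.t i) ^ a ∣ chi k S (D.s i) ^ M * f ∧
      chi k S (D.t i) ^ b ∣ chi k S (D.s i) ^ M * g := by
  obtain ⟨n, hn⟩ := Int.eq_ofNat_of_zero_le (D.val_nonneg i q)
  by_cases hi : D.facetIdealMap k S i = ⊤
  · obtain ⟨p, hp, hu⟩ := D.exists_isUnit_of_facetIdealMap_eq_top k S hi
    -- Here `χ^p` is a unit with `p` of value at least one, so `χ^{n t i}` divides `χ^{N s i + n
    -- p}`, that is, `χ^{N s i}` up to a unit.
    obtain ⟨N, r, h1, -⟩ := D.exists_nsmul_add_eq i (p := n • D.t i) (q := n • p) (by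
      rw [val_nsmul, val_nsmul, val_t]
      nlinarith)
    have h2 : chi k S (D.t i) ^ n ∣ chi k S (D.s i) ^ N := by
      refine (hu.pow n).dvd_mul_right.1 ⟨chi k S r, ?_⟩
      rw [← chi_nsmul, ← chi_nsmul, ← chi_nsmul, ← chi_add, ← chi_add, h1]
    exact ⟨n, 0, N, by simpa using hn.symm, h2.mul_right _, by simp⟩
  · obtain ⟨N, r, h1, -⟩ := D.exists_nsmul_add_eq i (p := n • D.t i) (q := q) (by
      rw [val_nsmul, val_t, hn, mul_one])
    obtain ⟨a, b, M, h2, h3⟩ := exists_pow_dvd_of_pow_dvd_mul (D.facetIdealMap k S i)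
      (hprime i hi) (σ := chi k S (D.s i)) (t := chi k S (D.t i))
      (fun h => hi (D.facetIdealMap_eq_top_of_chi_mem k S (D.val_s i) h))
      (D.isRegular_chi k S _) (D.chi_mem_facetIdealMap k S (by rw [val_t]; exact one_pos))
      (fun x hx => D.exists_dvd_of_mem_facetIdealMap k S hx) f g n N
      ⟨chi k S r, by rw [h, ← chi_nsmul, ← chi_nsmul, ← chi_add, ← chi_add, h1]⟩
    exact ⟨a, b, M, by rw [h2, hn], h3⟩

/-- In a flat local algebra over the monoid algebra in which the facet ideals remain prime, a
divisor of a monomial is the product of a monomial and a unit. -/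
theorem exists_eq_chi_mul (hprime : ∀ i, D.facetIdealMap k S i ≠ ⊤ →
    (D.facetIdealMap k S i).IsPrime) {f g : S} {q : P} (h : f * g = chi k S q) :
    ∃ (p : P) (v : S), IsUnit v ∧ f = chi k S p * v := by
  choose a b M hab hf hg using D.exists_pow_dvd_of_mul_eq_chi k S hprime h
  have hf' := D.mem_span_chi_of_dvd k S a M f hf
  have hg' := D.mem_span_chi_of_dvd k S b M g hg
  -- If no product of generators were `χ^q` times a unit monomial, then `χ^q = f g` would lie in
  -- `χ^q` times the maximal ideal, and cancelling `χ^q` would put `1` there.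
  have hex : ∃ p p' r : P, (∀ i, (a i : ℤ) ≤ D.val i p) ∧ (∀ i, (b i : ℤ) ≤ D.val i p') ∧
      q + r = p + p' ∧ IsUnit (chi k S r) := by
    by_contra! H
    have h1 := Ideal.mul_mem_mul hf' hg'
    rw [Ideal.span_mul_span', h] at h1
    open Pointwise in
    have h2 : Ideal.span (chi k S '' {p | ∀ i, (a i : ℤ) ≤ D.val i p} *
        chi k S '' {p | ∀ i, (b i : ℤ) ≤ D.val i p}) ≤
        Ideal.span {chi k S q} * IsLocalRing.maximalIdeal S := by
      rw [Ideal.span_le]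
      rintro _ ⟨_, ⟨p, hp, rfl⟩, _, ⟨p', hp', rfl⟩, rfl⟩
      obtain ⟨r, hr⟩ := D.exists_add_eq (p := q) (q := p + p') (fun i => by
        rw [val_add, ← hab i]
        push_cast
        linarith [hp i, hp' i])
      change chi k S p * chi k S p' ∈ _
      rw [← chi_add, ← hr, chi_add]
      exact Ideal.mul_mem_mul (Ideal.mem_span_singleton_self _) (H p p' r hp hp' hr)
    obtain ⟨z, hz, hz'⟩ := Ideal.mem_span_singleton_mul.1 (h2 h1)
    have h3 : chi k S q * z = chi k S q * 1 := by rw [hz', mul_one]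
    rw [(D.isRegular_chi k S q).left h3] at hz
    exact (Ideal.ne_top_iff_one _).1 (IsLocalRing.maximalIdeal.isMaximal S).ne_top hz
  obtain ⟨p, p', r, hp, hp', hr, hu⟩ := hex
  obtain ⟨w, hw⟩ := hu.exists_right_inv
  -- From `χ^q ∣ χ^{p'} f` and `χ^{q+r} = χ^{p+p'}` with `χ^r` a unit, cancellation of `χ^q` gives
  -- `χ^p ∣ f`. Applied to `f` and to `g`, this leaves cofactors `c`, `c'` with `χ^r c c' = 1`.
  have key : ∀ {f : S} {p p' : P} (_ : q + r = p + p')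
      (hf : chi k S q ∣ chi k S p' * f), ∃ c, f = chi k S p * c := by
    intro f p p' hr hf
    obtain ⟨c, hc⟩ := hf
    refine ⟨c * w, (D.isRegular_chi k S q).left ?_⟩
    have h1 : chi k S q * chi k S r = chi k S p * chi k S p' := by
      rw [← chi_add, ← chi_add, hr]
    change chi k S q * f = chi k S q * (chi k S p * (c * w))
    calc chi k S q * f = chi k S q * f * (chi k S r * w) := by rw [hw, mul_one]
      _ = (chi k S q * chi k S r) * f * w := by ring
      _ = chi k S p * (chi k S p' * f) * w := by rw [h1]; ring
      _ = _ := by rw [hc]; ring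
  obtain ⟨c, hc⟩ := key hr (D.chi_dvd_mul_of_mem_span k S (fun i => by
    rw [← hab i]; push_cast; linarith [hp' i]) hf')
  obtain ⟨c', hc'⟩ := key (hr.trans (add_comm _ _)) (D.chi_dvd_mul_of_mem_span k S (fun i => by
    rw [← hab i]; push_cast; linarith [hp i]) hg')
  refine ⟨p, c, ?_, hc⟩
  have h1 : chi k S q * 1 = chi k S q * (chi k S r * (c * c')) := by
    rw [mul_one]
    conv_lhs => rw [← h, hc, hc', mul_mul_mul_comm, ← chi_add, ← hr, chi_add, mul_assoc]
  have h2 := (D.isRegular_chi k S q).left h1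
  refine IsUnit.of_mul_eq_one (chi k S r * c') ?_
  rw [mul_left_comm, ← h2]

end Factor

end FacetData

/-! ### Étale algebras over the monoid algebra -/

namespace FacetData

variable {P L : Type} [AddCommMonoid P] [AddCommGroup L] (D : FacetData P L)
  (k : Type u) [Field k] {B : Type*} [CommRing B] [Algebra (AddMonoidAlgebra k P) B]

/-- The facet ring has integrally closed image in `K`, so `exists_sub_mul_mem_of_etale` separates
the factors of a product in the facet ideal by an element `e`. At the prime `x` either `e` or `1 -
e` becomes invertible, and the corresponding factor lies in the ideal. -/
lemma facetIdealMap_isPrime_of_etale [IsDomain (AddMonoidAlgebra k L)]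
    [IsIntegrallyClosed (AddMonoidAlgebra k L)] [Algebra.Etale (AddMonoidAlgebra k P) B]
    (x : Ideal B) [x.IsPrime] (S : Type*) [CommRing S] [Algebra B S] [IsLocalization.AtPrime S x]
    [Algebra (AddMonoidAlgebra k P) S] [IsScalarTower (AddMonoidAlgebra k P) B S] (i : D.ι)
    (h : D.facetIdealMap k S i ≠ ⊤) : (D.facetIdealMap k S i).IsPrime := by
  -- In general `K` is larger than the fraction field of the facet ring. What is used is that the
  -- facet ring embeds in `K` and that its image is integrally closed there.
  let K := FractionRing (AddMonoidAlgebra k L)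
  let g := (algebraMap (AddMonoidAlgebra k L) K).comp (D.facetMap k i).toRingHom
  let _ := g.toAlgebra
  have hker : RingHom.ker (algebraMap (AddMonoidAlgebra k P) K) = D.facetIdeal k i := by
    rw [← D.ker_facetMap k i]
    exact RingHom.ker_comp_of_injective _ (IsFractionRing.injective _ K)
  let J := (D.facetIdeal k i).map (algebraMap (AddMonoidAlgebra k P) B)
  have hJ : D.facetIdealMap k S i = J.map (algebraMap B S) := by
    rw [Ideal.map_map, ← IsScalarTower.algebraMap_eq]
    rfl
  refine ⟨h, ?_⟩
  intro f f' hff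
  obtain ⟨a, m, rfl⟩ := IsLocalization.exists_mk'_eq x.primeCompl f
  obtain ⟨a', m', rfl⟩ := IsLocalization.exists_mk'_eq x.primeCompl f'
  rw [hJ] at hff ⊢
  rw [← IsLocalization.mk'_mul, IsLocalization.mk'_mem_map_algebraMap_iff] at hff
  rw [IsLocalization.mk'_mem_map_algebraMap_iff, IsLocalization.mk'_mem_map_algebraMap_iff]
  obtain ⟨c, hc, hca⟩ := hff
  rw [← mul_assoc] at hca
  obtain ⟨e, he, he'⟩ := exists_sub_mul_mem_of_etale (D.facetIdeal k i) hker
    (fun z hz => D.mem_range_of_isIntegral k i K z hz) hca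
  by_cases hex : e ∈ x
  · refine Or.inl ⟨c * (1 - e), mul_mem hc (fun h1 => ?_), by rwa [mul_right_comm]⟩
    refine Ideal.IsPrime.ne_top ‹x.IsPrime› ((Ideal.eq_top_iff_one _).2 ?_)
    have := x.add_mem h1 hex
    rwa [sub_add_cancel] at this
  · exact Or.inr ⟨e, hex, by rwa [mul_comm]⟩

/-- In an étale algebra over the monoid algebra, a function which is invertible where the
monomial `χ^q` is invertible is locally the product of a monomial and a unit. -/
theorem exists_mul_eq_chi_mul_of_etale (D : FacetData P L) [IsDomain (AddMonoidAlgebra k L)]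
    [IsIntegrallyClosed (AddMonoidAlgebra k L)] [Algebra.Etale (AddMonoidAlgebra k P) B]
    (x : Ideal B) [x.IsPrime] (f : B) (q : P)
    (hf : ∀ z : Ideal B, z.IsPrime → f ∈ z → chi k B q ∈ z) :
    ∃ (p : P) (m v : B), m ∉ x ∧ v ∉ x ∧ m * f = chi k B p * v := by
  -- The radical is the intersection of the primes containing `f`; so `f` divides a power of `χ^q`.
  have hrad : chi k B q ∈ (Ideal.span {f}).radical := by
    rw [Ideal.radical_eq_sInf, Ideal.mem_sInf]
    rintro z ⟨hz, hz'⟩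
    exact hf z hz' (hz (Ideal.mem_span_singleton_self f))
  obtain ⟨N, hN⟩ := hrad
  obtain ⟨g, hg⟩ := Ideal.mem_span_singleton.1 hN
  let S := Localization.AtPrime x
  have : Module.Flat (AddMonoidAlgebra k P) S := Module.Flat.trans _ B S
  have hchi : ∀ p : P, chi k S p = algebraMap B S (chi k B p) := fun p =>
    IsScalarTower.algebraMap_apply _ B S _
  obtain ⟨p, v, hv, h⟩ := D.exists_eq_chi_mul k S
    (D.facetIdealMap_isPrime_of_etale k x S) (f := algebraMap B S f) (g := algebraMap B S g)
    (q := N • q) (by rw [← map_mul, ← hg, hchi, chi_nsmul])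
  obtain ⟨w, m, rfl⟩ := IsLocalization.exists_mk'_eq x.primeCompl v
  have hw : w ∉ x := fun hw => by
    have := (IsLocalization.AtPrime.isUnit_mk'_iff S x w m).1 hv
    exact this hw
  rw [hchi, mul_comm, IsLocalization.mk'_eq_mul_mk'_one, mul_right_comm, ← map_mul,
    ← IsLocalization.mk'_eq_mul_mk'_one, IsLocalization.eq_mk'_iff_mul_eq, ← map_mul] at h
  obtain ⟨c, hc⟩ := (IsLocalization.eq_iff_exists x.primeCompl S).1 h
  refine ⟨p, c * m, c * w, x.primeCompl.mul_mem c.2 m.2,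
    x.primeCompl.mul_mem c.2 hw, ?_⟩
  rw [mul_assoc, mul_comm (m : B) f, hc]
  ring

/-- In a flat algebra over the monoid algebra, monomials which are locally associated differ by
monomials which are locally units. -/
theorem exists_add_eq_add_of_flat (D : FacetData P L) [Module.Flat (AddMonoidAlgebra k P) B]
    (x : Ideal B) [x.IsPrime] {p p' : P} {v v' : B} (hv : v ∉ x) (hv' : v' ∉ x)
    (e : chi k B p * v = chi k B p' * v') :
    ∃ c c' : P, chi k B c ∉ x ∧ chi k B c' ∉ x ∧ p + c = p' + c' := by
  let S := Localization.AtPrime x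
  have : Module.Flat (AddMonoidAlgebra k P) S := Module.Flat.trans _ B S
  have hchi : ∀ p : P, chi k S p = algebraMap B S (chi k B p) := fun p =>
    IsScalarTower.algebraMap_apply _ B S _
  have hu : ∀ v : B, IsUnit (algebraMap B S v) ↔ v ∉ x := fun v =>
    IsLocalization.AtPrime.isUnit_to_map_iff S x v
  obtain ⟨c, c', hc, hc', h⟩ := D.exists_add_eq_add_of_chi_mul_eq k S ((hu v).2 hv) ((hu v').2 hv')
    (p := p) (p' := p') (by rw [hchi, hchi, ← map_mul, e, map_mul])
  rw [hchi, hu] at hc hc'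
  exact ⟨c, c', hc, hc', h⟩

end FacetData

/-! ### Local factorization on étale schemes over an affine toric variety -/

section Spec

variable (k : Type u) [Field k] {P : Type} [AddCommMonoid P]

lemma exists_affine_nhd {Y : Scheme.{u}} (y : Y) : ∃ (B : CommRingCat.{u}) (i : Spec B ⟶ Y)
    (_ : IsOpenImmersion i) (x : Spec B), i x = y :=
  ⟨_, Y.affineOpenCover.f (Y.affineOpenCover.idx y), inferInstance,
    Y.affineOpenCover.covers y⟩

lemma pullFun_SpecMap {R : Type u} [CommRing R] {B : CommRingCat.{u}} (φ : CommRingCat.of R ⟶ B)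
    (r : R) : pullFun (Spec.map φ) r = (Scheme.ΓSpecIso B).inv.hom (φ.hom r) :=
  (ConcreteCategory.congr_hom (Scheme.ΓSpecIso_inv_naturality φ) r).symm

lemma appTop_SpecMap {A B : CommRingCat.{u}} (φ : A ⟶ B) (a : A) :
    (Spec.map φ).appTop.hom ((Scheme.ΓSpecIso A).inv.hom a) =
      (Scheme.ΓSpecIso B).inv.hom (φ.hom a) :=
  (ConcreteCategory.congr_hom (Scheme.ΓSpecIso_inv_naturality φ) a).symm

/-- The basic open subset `D(b)` of `Spec B`. -/
noncomputable abbrev awayMap (B : CommRingCat.{u}) (b : B) :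
    Spec (.of (Localization.Away b)) ⟶ Spec B :=
  Spec.map (CommRingCat.ofHom (algebraMap B (Localization.Away b)))

instance (B : CommRingCat.{u}) (b : B) : IsOpenImmersion (awayMap B b) :=
  IsOpenImmersion.of_isLocalization b

lemma mem_range_awayMap (B : CommRingCat.{u}) (b : B) (x : Spec B) (h : b ∉ x.asIdeal) :
    x ∈ Set.range (awayMap B b) := by
  have := PrimeSpectrum.localization_away_comap_range (Localization.Away b) b
  exact (Set.ext_iff.1 this x).2 h

variable {L : Type} [AddCommGroup L] (D : FacetData P L)

/-- On an étale scheme over an affine toric variety, a function which is invertible where `χ^q` is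
invertible is locally the product of a monomial and a unit. -/
theorem FacetData.exists_factorization (D : FacetData P L) [IsDomain (AddMonoidAlgebra k L)]
    [IsIntegrallyClosed (AddMonoidAlgebra k L)] {Y : Scheme.{u}} (c : Y ⟶ affineToric k P)
    [Etale c] (f : Γ(Y, ⊤)) (q : P)
    (hf : c ⁻¹ᵁ specOpen (AddMonoidAlgebra.single q 1) ≤ Y.basicOpen f) (y : Y) :
    ∃ (Z : Scheme.{u}) (i : Z ⟶ Y) (_ : IsOpenImmersion i) (p : P) (v : Γ(Z, ⊤)ˣ),
      y ∈ Set.range i ∧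
        i.appTop.hom f = pullFun (i ≫ c) (AddMonoidAlgebra.single p 1) * v := by
  obtain ⟨B, i, _, x, rfl⟩ := exists_affine_nhd y
  obtain ⟨φ, hφ⟩ := Spec.map_surjective (i ≫ c)
  let _ : Algebra (AddMonoidAlgebra k P) B := φ.hom.toAlgebra
  have hE : Etale (Spec.map φ) := by rw [hφ]; infer_instance
  have : Algebra.Etale (AddMonoidAlgebra k P) B :=
    (HasRingHomProperty.Spec_iff (P := @Etale)).1 hE
  let f₀ : B := (Scheme.ΓSpecIso B).hom.hom (i.appTop.hom f)
  have hf₀ : (Scheme.ΓSpecIso B).inv.hom f₀ = i.appTop.hom f :=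
    ConcreteCategory.congr_hom (Scheme.ΓSpecIso B).hom_inv_id _
  have hz : ∀ z : Ideal B, z.IsPrime → f₀ ∈ z → chi k B q ∈ z := by
    intro z hz hfz
    by_contra hq
    let z' : Spec B := ⟨z, hz⟩
    have h1 : i z' ∈ c ⁻¹ᵁ specOpen (AddMonoidAlgebra.single q 1) := by
      change (i ≫ c) z' ∈ specOpen (AddMonoidAlgebra.single q 1)
      rw [← hφ]
      exact hq
    have h2 : z' ∈ (Spec B).basicOpen (i.appTop.hom f) := by
      rw [← Scheme.preimage_basicOpen_top]
      exact hf h1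
    rw [← hf₀, basicOpen_eq_of_affine] at h2
    exact h2 hfz
  have := x.isPrime
  obtain ⟨p, m, v, hm, hv, h⟩ := D.exists_mul_eq_chi_mul_of_etale k x.asIdeal f₀ q hz
  -- On this neighbourhood of `x` both `m` and `v` are units, and `m f = χ^p v` gives the unit
  -- factor `v m⁻¹`.
  let Bl := Localization.Away (m * v)
  have hmv : IsUnit (algebraMap B Bl (m * v)) := IsLocalization.Away.algebraMap_isUnit _
  rw [map_mul] at hmv
  obtain ⟨m', hm'⟩ := isUnit_of_mul_isUnit_left hmv
  obtain ⟨v', hv'⟩ := isUnit_of_mul_isUnit_right hmv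
  let ι : Bl →+* Γ(Spec (.of Bl), ⊤) := (Scheme.ΓSpecIso (.of Bl)).inv.hom
  refine ⟨Spec (.of Bl), awayMap B (m * v) ≫ i, inferInstance, p,
    Units.map (ι : Bl →* _) (v' * m'⁻¹), ?_, ?_⟩
  · obtain ⟨z, hz⟩ := mem_range_awayMap B (m * v) x (fun h =>
      (x.isPrime.mem_or_mem h).elim hm hv)
    exact ⟨z, by rw [Scheme.Hom.comp_apply, hz]⟩
  · have h1 : (awayMap B (m * v) ≫ i).appTop.hom f = ι (algebraMap B Bl f₀) := by
      rw [Scheme.Hom.comp_appTop]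
      change (awayMap B (m * v)).appTop.hom (i.appTop.hom f) = _
      rw [← hf₀]
      exact appTop_SpecMap _ _
    have h2 : pullFun ((awayMap B (m * v) ≫ i) ≫ c) (AddMonoidAlgebra.single p 1) =
        ι (algebraMap B Bl (chi k B p)) := by
      rw [Category.assoc, ← hφ, pullFun_comp]
      change (awayMap B (m * v)).appTop.hom (pullFun (Spec.map φ) _) = _
      rw [pullFun_SpecMap]
      exact appTop_SpecMap _ _
    rw [h1, h2, Units.coe_map]
    change _ = _ * ι _
    rw [← map_mul]
    congr 1
    have h3 : (m' : Bl) * algebraMap B Bl f₀ = algebraMap B Bl (chi k B p) * v' := by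
      rw [hm', hv']
      exact ((map_mul _ _ _).symm.trans (congrArg _ h)).trans (map_mul _ _ _)
    rw [Units.val_mul, ← mul_assoc, ← h3, mul_comm (m' : Bl), Units.mul_inv_cancel_right]

/-- On an étale scheme over an affine toric variety, monomials which are associated are locally
related by monomials which are units. -/
theorem FacetData.exists_relation (D : FacetData P L) {Y : Scheme.{u}} (c : Y ⟶ affineToric k P)
    [Etale c] {p p' : P} (v v' : Γ(Y, ⊤)ˣ)
    (h : pullFun c (AddMonoidAlgebra.single p 1) * v =
      pullFun c (AddMonoidAlgebra.single p' 1) * v') (y : Y) :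
    ∃ (Z : Scheme.{u}) (i : Z ⟶ Y) (_ : IsOpenImmersion i) (a b : P), y ∈ Set.range i ∧
      IsUnit (pullFun (i ≫ c) (AddMonoidAlgebra.single a 1)) ∧
      IsUnit (pullFun (i ≫ c) (AddMonoidAlgebra.single b 1)) ∧ p + a = p' + b ∧
      i.appTop.hom v * pullFun (i ≫ c) (AddMonoidAlgebra.single b 1) =
        i.appTop.hom v' * pullFun (i ≫ c) (AddMonoidAlgebra.single a 1) := by
  obtain ⟨B, i, _, x, rfl⟩ := exists_affine_nhd y
  obtain ⟨φ, hφ⟩ := Spec.map_surjective (i ≫ c)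
  let _ : Algebra (AddMonoidAlgebra k P) B := φ.hom.toAlgebra
  have hE : Etale (Spec.map φ) := by rw [hφ]; infer_instance
  have : Algebra.Etale (AddMonoidAlgebra k P) B :=
    (HasRingHomProperty.Spec_iff (P := @Etale)).1 hE
  let g : Γ(Y, ⊤) →+* B := (Scheme.ΓSpecIso B).hom.hom.comp i.appTop.hom
  have hg : ∀ f, (Scheme.ΓSpecIso B).inv.hom (g f) = i.appTop.hom f := fun f =>
    ConcreteCategory.congr_hom (Scheme.ΓSpecIso B).hom_inv_id _
  have hg' : ∀ p, g (pullFun c (AddMonoidAlgebra.single p 1)) = chi k B p := by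
    intro p
    change (Scheme.ΓSpecIso B).hom.hom (i.appTop.hom (pullFun c _)) = _
    rw [← RingHom.comp_apply i.appTop.hom, ← pullFun_comp, ← hφ, pullFun_SpecMap]
    exact ConcreteCategory.congr_hom (Scheme.ΓSpecIso B).inv_hom_id _
  have hu : ∀ v : Γ(Y, ⊤)ˣ, g v ∉ x.asIdeal := fun v hv =>
    x.isPrime.ne_top (Ideal.eq_top_of_isUnit_mem _ hv (v.isUnit.map g))
  have h0 := congrArg g h
  rw [map_mul, map_mul, hg', hg'] at h0
  have := x.isPrime
  obtain ⟨a, b, ha, hb, hab⟩ := D.exists_add_eq_add_of_flat k x.asIdeal (hu v) (hu v') h0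
  let m := chi k B a * chi k B b
  let Bl := Localization.Away m
  have hmv : IsUnit (algebraMap B Bl m) := IsLocalization.Away.algebraMap_isUnit _
  rw [map_mul] at hmv
  let ι : Bl →+* Γ(Spec (.of Bl), ⊤) := (Scheme.ΓSpecIso (.of Bl)).inv.hom
  have h1 : ∀ f, (awayMap B m ≫ i).appTop.hom f = ι (algebraMap B Bl (g f)) := by
    intro f
    rw [Scheme.Hom.comp_appTop]
    change (awayMap B m).appTop.hom (i.appTop.hom f) = _
    rw [← hg]
    exact appTop_SpecMap _ _
  have h2 : ∀ p, pullFun ((awayMap B m ≫ i) ≫ c) (AddMonoidAlgebra.single p 1) =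
      ι (algebraMap B Bl (chi k B p)) := by
    intro p
    rw [pullFun_comp, ← hg']
    exact h1 _
  refine ⟨Spec (.of Bl), awayMap B m ≫ i, inferInstance, a, b, ?_, ?_, ?_, hab, ?_⟩
  · obtain ⟨z, hz⟩ := mem_range_awayMap B m x (fun h => (x.isPrime.mem_or_mem h).elim ha hb)
    exact ⟨z, by rw [Scheme.Hom.comp_apply, hz]⟩
  · rw [h2]
    exact (isUnit_of_mul_isUnit_left hmv).map ι
  · rw [h2]
    exact (isUnit_of_mul_isUnit_right hmv).map ι
  · rw [h1, h1, h2, h2, ← map_mul, ← map_mul, ← map_mul, ← map_mul]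
    congr 2
    -- The relation between the unit parts follows from the relation between the products by
    -- cancelling the regular monomial `χ^{p+a} = χ^{p'+b}`.
    refine (D.isRegular_chi k B (p + a)).left ?_
    calc chi k B (p + a) * (g v * chi k B b) = chi k B a * chi k B b * (chi k B p * g v) := by
          rw [chi_add]; ring
      _ = chi k B (p' + b) * (g v' * chi k B a) := by rw [h0, chi_add]; ring
      _ = _ := by rw [hab]

end Spec

/-! ### Log structures with injective structure morphism -/

section Sections

variable {X : Scheme.{u}}

lemma eq_of_locally_eq {F : X.Etaleᵒᵖ ⥤ CommMonCat.{u}}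
    (hF : Presheaf.IsSheaf X.smallEtaleTopology F) {V : X.Etale} (a b : F.obj (op V))
    (h : ∀ x : src V, ∃ (W : X.Etale) (g : W ⟶ V) (y : src W), srcMap g y = x ∧
      (F.map g.op).hom a = (F.map g.op).hom b) : a = b := by
  let R : Sieve V :=
    { arrows := fun W g => (F.map g.op).hom a = (F.map g.op).hom b
      downward_closed := fun {W Z g} hg h => by
        rw [op_comp, Functor.map_comp]
        exact congrArg (F.map h.op).hom hg }
  have hR : R ∈ X.smallEtaleTopology V := (mem_smallEtale_iff V R).2 fun x => by
    obtain ⟨W, g, y, hy, hg⟩ := h x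
    exact ⟨W, g, y, hg, hy⟩
  exact ((isSheaf_iff_types _ _).1 hF R hR).isSeparatedFor.ext fun W g hg => hg

namespace LogStructure

lemma α_map (L : LogStructure X) {V W : X.Etale} (g : W ⟶ V) (m : L.M.obj (op V)) :
    (L.α.app (op W)).hom ((L.M.map g.op).hom m) =
      (srcMap g).appTop.hom ((L.α.app (op V)).hom m) :=
  ConcreteCategory.congr_hom (L.α.naturality g.op) m

/-- The structure morphism of a log structure is injective on sections. -/
def IsInjective (L : LogStructure X) : Prop :=
  ∀ V : X.Etale, Function.Injective (L.α.app (op V)).hom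

lemma IsInjective.restrict {L : LogStructure X} (hL : L.IsInjective) {Y : Scheme.{u}} (g : Y ⟶ X)
    [Etale g] : (L.restrict g).IsInjective :=
  fun V => hL ((etaleMap g).obj V)

/-- The functions which come from sections of a log structure. -/
def sectionFunctions (L : LogStructure X) (V : X.Etale) : Set Γ(src V, ⊤) :=
  Set.range (L.α.app (op V)).hom

lemma hom_apply {L N : LogStructure X} (e : L ⟶ N) (V : X.Etale) (m : L.M.obj (op V)) :
    (N.α.app (op V)).hom ((e.hom.app (op V)).hom m) = (L.α.app (op V)).hom m :=
  ConcreteCategory.congr_hom (NatTrans.congr_app e.w (op V)) m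

/-- Morphisms commute with the maps to the functions, so an injective `N.α` leaves no choice. This
is the source of the uniqueness of `ψ`. -/
lemma IsInjective.hom_ext {L N : LogStructure X} (hN : N.IsInjective) (e e' : L ⟶ N) :
    e = e' := by
  refine Hom.ext (NatTrans.ext (funext fun V => ?_))
  refine CommMonCat.hom_ext (MonoidHom.ext fun m => hN V.unop ?_)
  exact (hom_apply e V.unop m).trans (hom_apply e' V.unop m).symm

lemma IsInjective.nonempty_hom {L N : LogStructure X} (hN : N.IsInjective)
    (h : ∀ V, L.sectionFunctions V ⊆ N.sectionFunctions V) : Nonempty (L ⟶ N) := by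
  choose φ hφ using fun (V : X.Etale) (m : L.M.obj (op V)) => h V ⟨m, rfl⟩
  refine ⟨⟨⟨fun V => CommMonCat.ofHom
    { toFun := φ V.unop
      map_one' := hN _ ?_
      map_mul' := fun x y => hN _ ?_ }, ?_⟩, ?_⟩⟩
  · rw [hφ, map_one, map_one]
  · rw [hφ, map_mul, map_mul]
    exact (congrArg₂ (· * ·) (hφ _ x) (hφ _ y)).symm
  · intro V W g
    refine CommMonCat.hom_ext (MonoidHom.ext fun m => hN W.unop ?_)
    change (N.α.app (op W.unop)).hom (φ W.unop ((L.M.map g).hom m)) =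
      (N.α.app (op W.unop)).hom ((N.M.map g).hom (φ V.unop m))
    rw [hφ]
    exact (L.α_map g.unop m).trans ((congrArg _ (hφ V.unop m)).symm.trans
      (N.α_map g.unop _).symm)
  · refine NatTrans.ext (funext fun V => ?_)
    exact CommMonCat.hom_ext (MonoidHom.ext fun m => hφ V.unop m)

/-- Equality of functions gives morphisms in both directions, and by uniqueness both composites are
identities. -/
lemma IsInjective.exists_isIso {L N : LogStructure X} (hL : L.IsInjective) (hN : N.IsInjective)
    (h : ∀ V, L.sectionFunctions V = N.sectionFunctions V) : ∃ e : L ⟶ N, IsIso e := by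
  obtain ⟨e⟩ := hN.nonempty_hom (L := L) fun V => (h V).subset
  obtain ⟨e'⟩ := hL.nonempty_hom (L := N) fun V => (h V).superset
  exact ⟨e, e', hL.hom_ext _ _, hN.hom_ext _ _⟩

/-- Local sections with prescribed images in the functions are unique by injectivity; they agree on
overlaps and glue. -/
lemma IsInjective.mem_of_locally_mem {L : LogStructure X} (hL : L.IsInjective) {V : X.Etale}
    (f : Γ(src V, ⊤)) (h : ∀ x : src V, ∃ (W : X.Etale) (g : W ⟶ V) (y : src W), srcMap g y = x ∧
      (srcMap g).appTop.hom f ∈ L.sectionFunctions W) : f ∈ L.sectionFunctions V := by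
  let R : Sieve V :=
    { arrows := fun W g => (srcMap g).appTop.hom f ∈ L.sectionFunctions W
      downward_closed := fun {W Z g} hg h => by
        obtain ⟨m, hm⟩ := hg
        refine ⟨(L.M.map h.op).hom m, ?_⟩
        rw [α_map, hm, srcMap_comp, Scheme.Hom.comp_appTop]
        rfl }
  have hR : R ∈ X.smallEtaleTopology V := (mem_smallEtale_iff V R).2 fun x => by
    obtain ⟨W, g, y, hy, hg⟩ := h x
    exact ⟨W, g, y, hg, hy⟩
  choose m hm using fun (W : X.Etale) (g : W ⟶ V) (hg : R g) => hg
  obtain ⟨t, ht, -⟩ := (isSheaf_iff_types _ _).1 L.isSheaf R hR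
    (fun W g hg => m W g hg) (by
      intro W₁ W₂ Z g₁ g₂ f₁ f₂ h₁ h₂ e
      apply hL Z
      refine (L.α_map g₁ _).trans (Eq.trans ?_ (L.α_map g₂ _).symm)
      rw [hm, hm]
      have e1 := Scheme.Hom.comp_appTop (srcMap g₁) (srcMap f₁)
      have e2 := Scheme.Hom.comp_appTop (srcMap g₂) (srcMap f₂)
      rw [← srcMap_comp] at e1 e2
      rw [e] at e1
      exact ConcreteCategory.congr_hom (e1.symm.trans e2) f)
  refine ⟨t, eq_of_locally_eq (mulSheaf_isSheaf X) _ _ fun x => ?_⟩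
  obtain ⟨W, g, y, hy, hg⟩ := h x
  refine ⟨W, g, y, hy, ?_⟩
  refine (L.α_map g t).symm.trans (Eq.trans ?_ (hm W g hg))
  exact congrArg _ (ht g hg)

end LogStructure

variable {P : Type} [CommMonoid P] (γ : P →* Γ(X, ⊤))

lemma chartι_apply_α (V : X.Etale) (p : P) (v : Γ(src V, ⊤)ˣ) :
    ((chartLog γ).α.app (op V)).hom (((chartι γ).app (op V)).hom
      ((logCon (resTop γ (str V))).mk' (p, v))) = resTop γ (str V) p * (v : Γ(src V, ⊤)) :=
  ConcreteCategory.congr_hom (NatTrans.congr_app (chartι_α γ) (op V)) _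

lemma mul_mem_sectionFunctions_chartLog (V : X.Etale) (p : P) (v : Γ(src V, ⊤)ˣ) :
    resTop γ (str V) p * (v : Γ(src V, ⊤)) ∈ (chartLog γ).sectionFunctions V :=
  ⟨_, chartι_apply_α γ V p v⟩

/-- Sheafification is locally surjective, so each section is locally the class of a pair `(p, v)`.
-/
lemma exists_chartι_eq (V : X.Etale) (m : (chartLog γ).M.obj (op V)) (x : src V) :
    ∃ (W : X.Etale) (g : W ⟶ V) (y : src W) (p : P) (v : Γ(src W, ⊤)ˣ), srcMap g y = x ∧
      ((chartι γ).app (op W)).hom ((logCon (resTop γ (str W))).mk' (p, v)) =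
        ((chartLog γ).M.map g.op).hom m := by
  have hs := Presheaf.imageSieve_mem X.smallEtaleTopology
    (toSheafify X.smallEtaleTopology (preChart γ)) (U := op V) m
  obtain ⟨W, g, y, ⟨z, hz⟩, hy⟩ := (mem_smallEtale_iff V _).1 hs x
  obtain ⟨⟨p, v⟩, rfl⟩ := (logCon (resTop γ (str W))).mk'_surjective z
  exact ⟨W, g, y, p, v, hy, hz⟩

lemma exists_eq_mul_of_mem_sectionFunctions (V : X.Etale) (f : Γ(src V, ⊤))
    (hf : f ∈ (chartLog γ).sectionFunctions V) (x : src V) :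
    ∃ (W : X.Etale) (g : W ⟶ V) (y : src W) (p : P) (v : Γ(src W, ⊤)ˣ), srcMap g y = x ∧
      (srcMap g).appTop.hom f = resTop γ (str W) p * (v : Γ(src W, ⊤)) := by
  obtain ⟨m, rfl⟩ := hf
  obtain ⟨W, g, y, p, v, hy, h⟩ := exists_chartι_eq γ V m x
  refine ⟨W, g, y, p, v, hy, ?_⟩
  rw [← chartι_apply_α, h, LogStructure.α_map]

lemma map_chartι {V W : X.Etale} (g : W ⟶ V) (p : P) (v : Γ(src V, ⊤)ˣ) :
    ((chartLog γ).M.map g.op).hom (((chartι γ).app (op V)).hom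
      ((logCon (resTop γ (str V))).mk' (p, v))) =
    ((chartι γ).app (op W)).hom ((logCon (resTop γ (str W))).mk' (p, Units.map
      ((srcMap g).appTop.hom : Γ(src V, ⊤) →* Γ(src W, ⊤)) v)) :=
  (ConcreteCategory.congr_hom ((chartι γ).naturality g.op) _).symm

/-- Criterion for the injectivity of the structure morphism of the log structure of a chart. -/
lemma chartLog_isInjective
    (H : ∀ (V : X.Etale) (p p' : P) (v v' : Γ(src V, ⊤)ˣ),
      resTop γ (str V) p * (v : Γ(src V, ⊤)) = resTop γ (str V) p' * (v' : Γ(src V, ⊤)) → ∀ x : src V,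
      ∃ (W : X.Etale) (g : W ⟶ V) (y : src W) (a b : P), srcMap g y = x ∧
        IsUnit (resTop γ (str W) a) ∧ IsUnit (resTop γ (str W) b) ∧ p * a = p' * b ∧
        (srcMap g).appTop.hom v * resTop γ (str W) b =
          (srcMap g).appTop.hom v' * resTop γ (str W) a) : (chartLog γ).IsInjective := by
  intro V m m' hm
  refine eq_of_locally_eq (chartLog γ).isSheaf _ _ fun x => ?_
  obtain ⟨W₁, g₁, y₁, p, v, hy₁, h₁⟩ := exists_chartι_eq γ V m x
  obtain ⟨W₂, g₂, y₂, p', v', hy₂, h₂⟩ := exists_chartι_eq γ W₁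
    (((chartLog γ).M.map g₁.op).hom m') y₁
  have h₁' := (congrArg ((chartLog γ).M.map g₂.op).hom h₁).symm.trans (map_chartι γ g₂ p v)
  have hα := congrArg (srcMap g₂).appTop.hom (congrArg (srcMap g₁).appTop.hom hm)
  rw [← LogStructure.α_map, ← LogStructure.α_map, ← LogStructure.α_map, ← LogStructure.α_map,
    h₁', ← h₂, chartι_apply_α, chartι_apply_α] at hα
  obtain ⟨W₃, g₃, y₃, a, b, hy₃, ha, hb, hab, hv⟩ := H W₂ _ _ _ _ hα y₂
  refine ⟨W₃, g₃ ≫ g₂ ≫ g₁, y₃, ?_, ?_⟩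
  · rw [srcMap_comp, srcMap_comp, Scheme.Hom.comp_apply, Scheme.Hom.comp_apply, hy₃, hy₂, hy₁]
  · simp only [op_comp, Functor.map_comp]
    change ((chartLog γ).M.map g₃.op).hom (((chartLog γ).M.map g₂.op).hom
      (((chartLog γ).M.map g₁.op).hom m)) = ((chartLog γ).M.map g₃.op).hom
      (((chartLog γ).M.map g₂.op).hom (((chartLog γ).M.map g₁.op).hom m'))
    rw [h₁', ← h₂, map_chartι, map_chartι]
    refine congrArg _ ((Con.eq _).2 ⟨a, b, ha, hb, hab, ?_⟩)
    exact hv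

/-- Local relations between the presentations of sections of the log structure of a chart. -/
lemma exists_relation_of_chartLog_isInjective (hγ : (chartLog γ).IsInjective) (V : X.Etale)
    (p p' : P) (v v' : Γ(src V, ⊤)ˣ) (h : resTop γ (str V) p * (v : Γ(src V, ⊤)) = resTop γ (str V) p' * (v' : Γ(src V, ⊤)))
    (x : src V) : ∃ (W : X.Etale) (g : W ⟶ V) (y : src W) (a b : P), srcMap g y = x ∧
      IsUnit (resTop γ (str W) a) ∧ IsUnit (resTop γ (str W) b) ∧ p * a = p' * b ∧
      (srcMap g).appTop.hom v * resTop γ (str W) b =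
        (srcMap g).appTop.hom v' * resTop γ (str W) a := by
  have h1 : ((chartι γ).app (op V)).hom ((logCon (resTop γ (str V))).mk' (p, v)) =
      ((chartι γ).app (op V)).hom ((logCon (resTop γ (str V))).mk' (p', v')) := by
    apply hγ V
    rw [chartι_apply_α, chartι_apply_α, h]
  have hs := Presheaf.equalizerSieve_mem X.smallEtaleTopology
    (toSheafify X.smallEtaleTopology (preChart γ)) (X := op V) _ _ h1
  obtain ⟨W, g, y, hz, hy⟩ := (mem_smallEtale_iff V _).1 hs x
  obtain ⟨a, b, ha, hb, hab, hv⟩ := (Con.eq (logCon (resTop γ (str W)))).1 hz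
  exact ⟨W, g, y, a, b, hy, ha, hb, hab, hv⟩

end Sections

/-! ### Fourier–Motzkin elimination and the existence of facet data -/

section FourierMotzkin

variable {L : Type} [AddCommGroup L]

/-- The finite set of functionals `F` cuts out the cone generated by the set `G`. -/
def CutsOut (F : Finset (L →+ ℤ)) (G : Set L) : Prop :=
  ∀ x, (∀ ν ∈ F, 0 ≤ ν x) ↔ ∃ N : ℕ, 0 < N ∧ N • x ∈ AddSubmonoid.closure G

/-- A step of Fourier–Motzkin elimination. -/
lemma exists_nsmul_sub_nonneg (F : Finset (L →+ ℤ)) (g x : L)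
    (h0 : ∀ ν ∈ F, 0 ≤ ν g → 0 ≤ ν x)
    (h1 : ∀ ν ∈ F, ∀ μ ∈ F, ν g < 0 → 0 < μ g → 0 ≤ μ g * ν x - ν g * μ x) :
    ∃ N t : ℕ, 0 < N ∧ ∀ ν ∈ F, 0 ≤ ν (N • x - t • g) := by
  classical
  by_cases hneg : ∃ ν ∈ F, ν g < 0 ∧ ν x < 0
  · obtain ⟨ν₀, hν₀, h₀⟩ := hneg
    obtain ⟨ν, hν, hmax⟩ := Finset.exists_max_image (F.filter fun ν => ν g < 0 ∧ ν x < 0)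
      (fun ν => (ν x : ℚ) / ν g) ⟨ν₀, by simp [hν₀, h₀]⟩
    simp only [Finset.mem_filter] at hν hmax
    obtain ⟨hνF, hg, hx⟩ := hν
    -- The quotient of the two constants is the largest ratio `ν x / ν g` among the functionals
    -- negative at both `g` and `x`: the least multiple of `g` whose subtraction makes all of these
    -- nonnegative. Hypothesis `h1` says that functionals positive at `g` survive it.
    refine ⟨(-ν g).toNat, (-ν x).toNat, by omega, fun μ hμ => ?_⟩
    have e1 : (((-ν g).toNat : ℕ) : ℤ) = -ν g := by omega
    have e2 : (((-ν x).toNat : ℕ) : ℤ) = -ν x := by omega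
    rw [map_sub, map_nsmul, map_nsmul, nsmul_eq_mul, nsmul_eq_mul, e1, e2]
    rcases lt_trichotomy (μ g) 0 with h | h | h
    · rcases lt_or_ge (μ x) 0 with h' | h'
      · have h2 := hmax μ ⟨hμ, h, h'⟩
        have hq1 : (μ g : ℚ) < 0 := by exact_mod_cast h
        have hq2 : (ν g : ℚ) < 0 := by exact_mod_cast hg
        rw [← neg_div_neg_eq, ← neg_div_neg_eq (ν x : ℚ), div_le_div_iff₀ (by linarith)
          (by linarith)] at h2
        have h3 : -μ x * -ν g ≤ -ν x * -μ g := by exact_mod_cast h2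
        linarith
      · nlinarith
    · rw [h]
      have := h0 μ hμ h.ge
      nlinarith
    · have := h1 ν hνF μ hμ hg h
      linarith
  · push Not at hneg
    refine ⟨1, 0, one_pos, fun ν hν => ?_⟩
    rw [one_nsmul, zero_nsmul, sub_zero]
    rcases lt_or_ge (ν g) 0 with h | h
    · exact hneg ν hν h
    · exact h0 ν hν h

/-- Fourier–Motzkin: a finitely generated cone is cut out by finitely many functionals. -/
lemma exists_cutsOut (F₀ : Finset (L →+ ℤ)) (hF₀ : ∀ x, (∀ ν ∈ F₀, 0 ≤ ν x) → x = 0)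
    (G : Finset L) : ∃ F : Finset (L →+ ℤ), CutsOut F (G : Set L) := by
  classical
  induction G using Finset.induction_on with
  | empty =>
    refine ⟨F₀, fun x => ⟨fun h => ⟨1, one_pos, ?_⟩, ?_⟩⟩
    · rw [hF₀ x h, nsmul_zero]
      exact zero_mem _
    · rintro ⟨N, hN, h⟩ ν -
      rw [Finset.coe_empty, AddSubmonoid.closure_empty, AddSubmonoid.mem_bot] at h
      have h1 := congrArg ν h
      rw [map_nsmul, map_zero, nsmul_eq_mul] at h1
      rcases mul_eq_zero.1 h1 with h2 | h2
      · omega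
      · exact h2.ge
  | insert g G _ ih =>
    obtain ⟨F, hF⟩ := ih
    -- Kept are the functionals which are nonnegative at the new generator `g`; each pair of
    -- opposite signs at `g` contributes its positive combination vanishing at `g`.
    refine ⟨F.filter (fun ν => 0 ≤ ν g) ∪ ((F ×ˢ F).filter
      (fun p => p.1 g < 0 ∧ 0 < p.2 g)).image (fun p => p.2 g • p.1 - p.1 g • p.2), fun x =>
      ⟨fun h => ?_, ?_⟩⟩
    · obtain ⟨N, t, hN, hx⟩ := exists_nsmul_sub_nonneg F g x
        (fun ν hν h' => h ν (by simp [hν, h']))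
        (fun ν hν μ hμ h1 h2 => by
          have := h (μ g • ν - ν g • μ) (Finset.mem_union_right _ (Finset.mem_image.2
            ⟨(ν, μ), by simp [hν, hμ, h1, h2], rfl⟩))
          simpa using this)
      obtain ⟨M, hM, hm⟩ := (hF _).1 hx
      refine ⟨M * N, Nat.mul_pos hM hN, ?_⟩
      have h1 : (M * N) • x = M • (N • x - t • g) + (M * t) • g := by
        rw [nsmul_sub, mul_nsmul', mul_nsmul', sub_add_cancel]
      rw [h1, Finset.coe_insert]
      exact add_mem (AddSubmonoid.closure_mono (Set.subset_insert _ _) hm)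
        (nsmul_mem (AddSubmonoid.subset_closure (Set.mem_insert _ _)) _)
    · rintro ⟨N, hN, h⟩
      rw [Finset.coe_insert, Set.insert_eq, AddSubmonoid.closure_union,
        AddSubmonoid.mem_sup] at h
      obtain ⟨z, hz, y, hy, e⟩ := h
      obtain ⟨t, rfl⟩ := AddSubmonoid.mem_closure_singleton.1 hz
      have hy' := (hF y).2 ⟨1, one_pos, by rwa [one_nsmul]⟩
      have e' : ∀ ν : L →+ ℤ, (N : ℤ) * ν x = t * ν g + ν y := fun ν => by
        have := congrArg ν e
        rw [map_add, map_nsmul, map_nsmul, nsmul_eq_mul, nsmul_eq_mul] at this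
        exact this.symm
      have hN' : (0 : ℤ) < N := by exact_mod_cast hN
      intro μ hμ
      refine nonneg_of_mul_nonneg_right (?_ : 0 ≤ (N : ℤ) * μ x) hN'
      rcases Finset.mem_union.1 hμ with hμ | hμ
      · obtain ⟨h1, h2⟩ := Finset.mem_filter.1 hμ
        rw [e' μ]
        have := hy' μ h1
        positivity
      · obtain ⟨⟨ν, μ'⟩, h1, rfl⟩ := Finset.mem_image.1 hμ
        simp only [Finset.mem_filter, Finset.mem_product] at h1
        obtain ⟨⟨h1, h2⟩, h3, h4⟩ := h1
        have h5 : (N : ℤ) * (μ' g * ν x - ν g * μ' x) = μ' g * ν y - ν g * μ' y := by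
          linear_combination (μ' g) * e' ν - (ν g) * e' μ'
        change 0 ≤ (N : ℤ) * (μ' g * ν x - ν g * μ' x)
        rw [h5]
        have := hy' ν h1
        have := hy' μ' h2
        nlinarith

/-- The values of `ν` form a nonzero subgroup `gℤ`; division by its generator makes the functional
primitive. -/
lemma exists_eq_smul_of_ne_zero (ν : L →+ ℤ) (h : ν ≠ 0) :
    ∃ (g : ℤ) (μ : L →+ ℤ), 0 < g ∧ (∀ x, ν x = g * μ x) ∧ ∃ x, μ x = 1 := by
  obtain ⟨g, hg⟩ := Int.subgroup_cyclic ν.range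
  have hg' : ν.range = AddSubgroup.closure {(g.natAbs : ℤ)} := by
    rw [hg, ← AddSubgroup.zmultiples_eq_closure, ← AddSubgroup.zmultiples_eq_closure,
      Int.zmultiples_natAbs]
  rw [← AddSubgroup.zmultiples_eq_closure] at hg'
  have hdvd : ∀ x, (g.natAbs : ℤ) ∣ ν x := fun x => by
    rw [← Int.mem_zmultiples_iff, ← hg']
    exact ⟨x, rfl⟩
  have h0 : (0 : ℤ) < g.natAbs := by
    rcases Nat.eq_zero_or_pos g.natAbs with h1 | h1
    · refine (h (AddMonoidHom.ext fun x => ?_)).elim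
      have := hdvd x
      rw [h1] at this
      simpa using this
    · exact_mod_cast h1
  refine ⟨g.natAbs, ⟨⟨fun x => ν x / g.natAbs, by simp⟩, fun x y => ?_⟩, h0, fun x => ?_, ?_⟩
  · change ν (x + y) / _ = ν x / _ + ν y / _
    rw [map_add, Int.add_ediv_of_dvd_left (hdvd x)]
  · exact (Int.mul_ediv_cancel' (hdvd x)).symm
  · obtain ⟨x, hx⟩ : (g.natAbs : ℤ) ∈ ν.range := by
      rw [hg']
      exact AddSubgroup.mem_zmultiples _
    exact ⟨x, by change ν x / _ = 1; rw [hx, Int.ediv_self h0.ne']⟩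

/-- A monoid which is cut out by finitely many functionals in a lattice, and which has a point at
which no nonzero functional of this kind vanishes, has facet data. -/
lemma exists_facetData {P : Type} [AddCommMonoid P] (incl : P →+ L)
    (hincl : Function.Injective incl) (F₀ : Finset (L →+ ℤ))
    (hF₀ : ∀ x, (∀ ν ∈ F₀, 0 ≤ ν x) ↔ ∃ p, incl p = x) (q : P)
    (hq : ∀ ν : L →+ ℤ, (∀ p, 0 ≤ ν (incl p)) → ν ≠ 0 → 0 < ν (incl q)) :
    ∃ D : FacetData P L, D.incl = incl ∧ ∀ i, 0 < D.ν i (incl q) := by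
  classical
  -- A family of least cardinality has no redundant member; this is what produces points in the
  -- relative interiors of the facets.
  obtain ⟨F, hF, hmin⟩ : ∃ F : Finset (L →+ ℤ), (∀ x, (∀ ν ∈ F, 0 ≤ ν x) ↔ ∃ p, incl p = x) ∧
      ∀ F' : Finset (L →+ ℤ), (∀ x, (∀ ν ∈ F', 0 ≤ ν x) ↔ ∃ p, incl p = x) → F.card ≤ F'.card := by
    have h : ∃ n, ∃ F : Finset (L →+ ℤ), (∀ x, (∀ ν ∈ F, 0 ≤ ν x) ↔ ∃ p, incl p = x) ∧
        F.card = n := ⟨_, F₀, hF₀, rfl⟩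
    obtain ⟨F, hF, hc⟩ := Nat.find_spec h
    exact ⟨F, hF, fun F' hF' => hc.symm ▸ Nat.find_min' h ⟨F', hF', rfl⟩⟩
  -- By minimality, dropping `i` enlarges the cone, so some `y` violates the `i`-th inequality and
  -- no other.
  have hy : ∀ i : {ν // ν ∈ F}, ∃ y : L, i.1 y < 0 ∧ ∀ ν ∈ F, ν ≠ i.1 → 0 ≤ ν y := by
    intro i
    by_contra! H
    have h1 := hmin (F.erase i.1) fun x => by
      rw [← hF]
      refine ⟨fun h ν hν => ?_, fun h ν hν => h ν (Finset.mem_of_mem_erase hν)⟩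
      by_cases e : ν = i.1
      · by_contra! hneg
        obtain ⟨μ, hμ, hμ', h2⟩ := H x (e ▸ hneg)
        exact absurd (h μ (Finset.mem_erase.2 ⟨hμ', hμ⟩)) (by omega)
      · exact h ν (Finset.mem_erase.2 ⟨e, hν⟩)
    have := Finset.card_erase_lt_of_mem i.2
    omega
  choose y hy hy' using hy
  have hne : ∀ i : {ν // ν ∈ F}, i.1 ≠ 0 := fun i h => by
    have := hy i
    rw [h] at this
    exact lt_irrefl _ this
  have hnn : ∀ (i : {ν // ν ∈ F}) p, 0 ≤ i.1 (incl p) := fun i p => (hF _).2 ⟨p, rfl⟩ _ i.2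
  have hq' : ∀ i : {ν // ν ∈ F}, 0 < i.1 (incl q) := fun i => hq _ (hnn i) (hne i)
  choose g μ hg hgμ hμ using fun i : {ν // ν ∈ F} => exists_eq_smul_of_ne_zero i.1 (hne i)
  -- The segment from the interior point `q` to `y i` crosses only the `i`-th wall. The integral
  -- combination used here lies on the ray through the crossing point: it is zero at `i` and
  -- positive at all other functionals.
  have hval : ∀ (i k : {ν // ν ∈ F}), k.1 (i.1 (incl q) • y i - i.1 (y i) • incl q) =
      i.1 (incl q) * k.1 (y i) - i.1 (y i) * k.1 (incl q) := fun i k => by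
    rw [map_sub, map_zsmul, map_zsmul, smul_eq_mul, smul_eq_mul]
  have hpos : ∀ (i k : {ν // ν ∈ F}), k ≠ i →
      0 < k.1 (i.1 (incl q) • y i - i.1 (y i) • incl q) := fun i k hk => by
    rw [hval]
    have h1 := hy' i k.1 k.2 fun e => hk (Subtype.ext e)
    nlinarith [hq' i, hq' k, hy i, mul_pos_of_neg_of_neg (hy i) (neg_neg_of_pos (hq' k)),
      mul_nonneg (hq' i).le h1]
  have hs : ∀ i : {ν // ν ∈ F}, ∃ s : P,
      incl s = i.1 (incl q) • y i - i.1 (y i) • incl q := fun i => (hF _).1 fun ν hν => by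
    by_cases e : ν = i.1
    · subst e
      rw [hval i i, mul_comm, sub_self]
    · exact (hpos i ⟨ν, hν⟩ fun h => e (congrArg Subtype.val h)).le
  choose s hs using hs
  refine ⟨⟨incl, hincl, {ν // ν ∈ F}, inferInstance, μ, fun i p => ?_, fun x hx => ?_, s,
    fun i => ?_, fun i k hk => ?_, hμ⟩, rfl, fun i => ?_⟩
  · exact nonneg_of_mul_nonneg_right (hgμ i _ ▸ hnn i p) (hg i)
  · refine (hF x).1 fun ν hν => ?_
    rw [hgμ ⟨ν, hν⟩]
    exact mul_nonneg (hg _).le (hx _)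
  · have h1 := hval i i
    rw [mul_comm, sub_self, ← hs, hgμ i] at h1
    exact (mul_eq_zero.1 h1).resolve_left (hg i).ne'
  · have h1 := hpos i k hk
    rw [← hs, hgμ k] at h1
    exact pos_of_mul_pos_right h1 (hg k).le
  · exact pos_of_mul_pos_right (hgμ i _ ▸ hq' i) (hg i).le

/-- The facet data of `P × ℤ`. -/
def FacetData.prodInt {P : Type} [AddCommMonoid P] (D : FacetData P L) :
    FacetData (P × ℤ) (L × ℤ) where
  incl := D.incl.prodMap (AddMonoidHom.id ℤ)
  incl_injective := D.incl_injective.prodMap Function.injective_id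
  ι := D.ι
  finite := D.finite
  ν i := (D.ν i).comp (AddMonoidHom.fst L ℤ)
  nonneg i p := D.nonneg i p.1
  exists_of_nonneg x hx := by
    obtain ⟨p, hp⟩ := D.exists_of_nonneg x.1 hx
    exact ⟨(p, x.2), Prod.ext hp rfl⟩
  s i := (D.s i, 0)
  ν_s i := D.ν_s i
  ν_s_pos i k := D.ν_s_pos i k
  surjective i := by
    obtain ⟨x, hx⟩ := D.surjective i
    exact ⟨(x, 0), hx⟩

end FourierMotzkin

/-! ### The cone over the polytope -/

section Cone

variable {n : ℕ} (A : Finset (Fin n → ℤ))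

/-- The inclusion of the cone monoid in the lattice. -/
def coneInclusion : coneMonoid A →+ (Fin n → ℤ) × ℤ :=
  ((AddMonoidHom.id _).prodMap (Nat.castAddMonoidHom ℤ)).comp (coneMonoid A).subtype

lemma coneInclusion_injective : Function.Injective (coneInclusion A) :=
  (Function.injective_id.prodMap Nat.cast_injective).comp Subtype.val_injective

/-- The generator of the cone monoid given by a vertex. -/
def coneGen (a : A) : coneMonoid A :=
  ⟨(a.1, 1), Or.inr ⟨_, subset_convexHull ℝ _ ⟨a.1, a.2, rfl⟩, fun i => by simp⟩⟩

lemma coneDeg_coneGen (a : A) : coneDeg A (coneGen A a) = 1 := rfl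

/-- The lattice points at height one which generate the cone. -/
def liftedVertices : Finset ((Fin n → ℤ) × ℤ) :=
  A.map ⟨fun a => (a, 1), fun _ _ h => congrArg Prod.fst h⟩

lemma mem_liftedVertices {x : (Fin n → ℤ) × ℤ} :
    x ∈ liftedVertices A ↔ ∃ a : A, coneInclusion A (coneGen A a) = x := by
  simp only [liftedVertices, Finset.mem_map, Subtype.exists]
  exact ⟨fun ⟨a, ha, h⟩ => ⟨a, ha, h⟩, fun ⟨a, ha, h⟩ => ⟨a, ha, h⟩⟩

/-- The real affine function which is induced by an integral functional. -/
noncomputable def realFunctional (ν : (Fin n → ℤ) × ℤ →+ ℤ) : (Fin n → ℝ) →ᵃ[ℝ] ℝ :=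
  (∑ i, (ν (Pi.single i 1, 0) : ℝ) • LinearMap.proj (R := ℝ) i).toAffineMap +
    AffineMap.const ℝ _ (ν (0, 1) : ℝ)

lemma realFunctional_apply (ν : (Fin n → ℤ) × ℤ →+ ℤ) (q : Fin n → ℝ) :
    realFunctional ν q = ∑ i, (ν (Pi.single i 1, 0) : ℝ) * q i + ν (0, 1) := by
  simp [realFunctional]

lemma apply_eq_sum (ν : (Fin n → ℤ) × ℤ →+ ℤ) (m : Fin n → ℤ) (h : ℤ) :
    ν (m, h) = ∑ i, ν (Pi.single i 1, 0) * m i + ν (0, 1) * h := by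
  have h1 : ((m, h) : (Fin n → ℤ) × ℤ) =
      ∑ i, m i • ((Pi.single i 1, 0) : (Fin n → ℤ) × ℤ) + h • (0, 1) := by
    refine Prod.ext ?_ ?_
    · rw [Prod.fst_add, Prod.fst_sum]
      ext j
      simp [Finset.sum_apply, Pi.single_apply]
    · rw [Prod.snd_add, Prod.snd_sum]
      simp
  rw [h1, map_add, map_sum, map_zsmul, smul_eq_mul, mul_comm h]
  congr 1
  exact Finset.sum_congr rfl fun i _ => by rw [map_zsmul, smul_eq_mul, mul_comm]

/-- The affine function is the restriction of `ν` to height one; homogeneity relates the two along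
the ray through `(q, 1)`. -/
lemma cast_apply_eq (ν : (Fin n → ℤ) × ℤ →+ ℤ) (m : Fin n → ℤ) (h : ℤ) (q : Fin n → ℝ)
    (hq : ∀ i, (m i : ℝ) = h * q i) : (ν (m, h) : ℝ) = h * realFunctional ν q := by
  rw [apply_eq_sum, realFunctional_apply]
  push_cast
  rw [mul_add, Finset.mul_sum, mul_comm (h : ℝ)]
  congr 1
  exact Finset.sum_congr rfl fun i _ => by rw [hq]; ring

/-- The locus where an affine function is nonnegative is convex, so the points of `A` decide. -/
lemma realFunctional_nonneg (ν : (Fin n → ℤ) × ℤ →+ ℤ)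
    (hν : ∀ a : A, 0 ≤ ν (coneInclusion A (coneGen A a))) (q : Fin n → ℝ)
    (hq : q ∈ latticePolytope A) : 0 ≤ realFunctional ν q := by
  have hc : Convex ℝ (realFunctional ν ⁻¹' Set.Ici (0 : ℝ)) :=
    (convex_Ici 0).affine_preimage _
  refine convexHull_min ?_ hc hq
  rintro _ ⟨a, ha, rfl⟩
  have h1 := cast_apply_eq ν a 1 (fun i => (a i : ℝ)) fun i => by simp
  rw [Int.cast_one, one_mul] at h1
  refine (?_ : (0 : ℝ) ≤ realFunctional ν _)
  rw [← h1]
  exact_mod_cast hν ⟨a, ha⟩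

lemma nonneg_of_mem_coneMonoid (ν : (Fin n → ℤ) × ℤ →+ ℤ)
    (hν : ∀ a : A, 0 ≤ ν (coneInclusion A (coneGen A a))) (p : coneMonoid A) :
    0 ≤ ν (coneInclusion A p) := by
  obtain ⟨⟨m, h⟩, hp⟩ := p
  rcases hp with hp | ⟨q, hq, hp⟩
  · obtain ⟨rfl, rfl⟩ := Prod.mk.inj hp
    exact (map_zero ν).ge
  · have h1 := cast_apply_eq ν m h q fun i => by simpa using hp i
    have h2 : (0 : ℝ) ≤ ν (m, (h : ℤ)) := by
      rw [h1]
      exact mul_nonneg (by positivity) (realFunctional_nonneg A ν hν q hq)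
    exact_mod_cast h2

lemma mem_coneMonoid_of_nsmul {N : ℕ} (hN : 0 < N) {m : Fin n → ℤ} {h : ℕ}
    (hx : N • ((m, h) : (Fin n → ℤ) × ℕ) ∈ coneMonoid A) : (m, h) ∈ coneMonoid A := by
  have hN' : (N : ℝ) ≠ 0 := by positivity
  rcases hx with hx | ⟨q, hq, hx⟩
  · left
    refine Prod.ext (funext fun i => ?_) ?_
    · have h1 := congrFun (congrArg Prod.fst hx) i
      simp only [Prod.smul_mk, nsmul_eq_mul, Pi.mul_apply] at h1
      rcases mul_eq_zero.1 h1 with h2 | h2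
      · simp at h2; omega
      · exact h2
    · have h1 := congrArg Prod.snd hx
      simp only [Prod.smul_mk, smul_eq_mul] at h1
      rcases mul_eq_zero.1 h1 with h2 | h2
      · omega
      · exact h2
  · refine Or.inr ⟨q, hq, fun i => mul_left_cancel₀ hN' ?_⟩
    have h1 := hx i
    simp only [Prod.smul_mk, nsmul_eq_mul, smul_eq_mul, Pi.mul_apply] at h1
    push_cast at h1
    rw [← mul_assoc, ← h1]
    simp

/-- Heights of generators are positive, so the height of `x` is nonnegative and `x` lifts to `ℤⁿ ×
ℕ`; rescaling does not change the point of the polytope, so `x` lies in the cone. -/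
lemma exists_coneInclusion_eq_of_nsmul {N : ℕ} (hN : 0 < N) {x : (Fin n → ℤ) × ℤ}
    (hx : N • x ∈ AddSubmonoid.closure (liftedVertices A : Set ((Fin n → ℤ) × ℤ))) :
    ∃ p, coneInclusion A p = x := by
  have h1 : AddSubmonoid.closure (liftedVertices A : Set ((Fin n → ℤ) × ℤ)) ≤
      AddMonoidHom.mrange (coneInclusion A) := by
    rw [AddSubmonoid.closure_le]
    intro y hy
    obtain ⟨a, ha⟩ := (mem_liftedVertices A).1 hy
    exact ⟨_, ha⟩
  obtain ⟨p, hp⟩ := h1 hx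
  have h2 : (p.1.2 : ℤ) = N * x.2 := by
    have := congrArg Prod.snd hp
    simpa [coneInclusion] using this
  have hN' : (0 : ℤ) < N := by exact_mod_cast hN
  have h3 : 0 ≤ x.2 := nonneg_of_mul_nonneg_right (h2 ▸ Nat.cast_nonneg _) hN'
  obtain ⟨h, hh⟩ := Int.eq_ofNat_of_zero_le h3
  have h4 : N • ((x.1, h) : (Fin n → ℤ) × ℕ) = p.1 := by
    refine Prod.ext (congrArg Prod.fst hp).symm ?_
    rw [hh] at h2
    rw [Prod.smul_mk, smul_eq_mul]
    exact_mod_cast h2.symm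
  refine ⟨⟨(x.1, h), mem_coneMonoid_of_nsmul A hN (h4 ▸ p.2)⟩, Prod.ext rfl hh.symm⟩

/-- The coordinates with both signs cut out the zero cone, the starting point of Fourier–Motzkin
elimination. -/
lemma exists_functionals_lattice : ∃ F : Finset ((Fin n → ℤ) × ℤ →+ ℤ),
    ∀ x, (∀ ν ∈ F, 0 ≤ ν x) → x = 0 := by
  classical
  let c : Fin n → (Fin n → ℤ) × ℤ →+ ℤ := fun i =>
    (Pi.evalAddMonoidHom (fun _ : Fin n => ℤ) i).comp (AddMonoidHom.fst _ _)
  refine ⟨{AddMonoidHom.snd _ _, -AddMonoidHom.snd _ _} ∪ (Finset.univ.image c ∪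
    Finset.univ.image fun i => -c i), fun x hx => ?_⟩
  have h1 := hx (AddMonoidHom.snd _ _) (by simp)
  have h2 := hx (-AddMonoidHom.snd _ _) (by simp)
  refine Prod.ext (funext fun i => ?_) ?_
  · have h1 : 0 ≤ x.1 i := hx (c i) (by simp)
    have h2 : 0 ≤ -x.1 i := hx (-c i) (by simp)
    exact le_antisymm (neg_nonneg.1 h2) h1
  · have h1 : 0 ≤ x.2 := h1
    have h2 : 0 ≤ -x.2 := h2
    exact le_antisymm (neg_nonneg.1 h2) h1

/-- Full-dimensionality enters here: the points of `A` span `ℝⁿ` affinely, so an affine function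
vanishing on them is zero, and with it all coefficients of `ν`. -/
lemma exists_coneGen_ne_zero (hfull : affineSpan ℝ (latticePolytope A) = ⊤)
    (ν : (Fin n → ℤ) × ℤ →+ ℤ) (hν : ν ≠ 0) :
    ∃ a : A, ν (coneInclusion A (coneGen A a)) ≠ 0 := by
  by_contra! H
  rw [latticePolytope, affineSpan_convexHull] at hfull
  have h1 : realFunctional ν = AffineMap.const ℝ _ 0 := AffineMap.ext_on hfull (by
    rintro _ ⟨a, ha, rfl⟩
    have h1 := cast_apply_eq ν a 1 (fun i => (a i : ℝ)) fun i => by simp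
    rw [Int.cast_one, one_mul] at h1
    refine h1.symm.trans ?_
    exact (congrArg (Int.cast : ℤ → ℝ) (H ⟨a, ha⟩)).trans Int.cast_zero)
  have h2 : ∀ q : Fin n → ℝ, ∑ i, (ν (Pi.single i 1, 0) : ℝ) * q i + ν (0, 1) = 0 := fun q => by
    rw [← realFunctional_apply, h1]
    rfl
  have h3 : ν (0, 1) = 0 := by
    have := h2 0
    simpa using this
  have h4 : ∀ i, ν (Pi.single i 1, 0) = 0 := fun i => by
    classical
    have := h2 (Pi.single i 1)
    simpa [Pi.single_apply, h3] using this
  refine hν (AddMonoidHom.ext fun x => ?_)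
  rw [← Prod.mk.eta (p := x), apply_eq_sum]
  simp [h3, h4]

/-- The sum of the vertices, a point in the interior of the cone. -/
noncomputable def coneInterior : coneMonoid A := ∑ a : A, coneGen A a

lemma coneInterior_pos (hfull : affineSpan ℝ (latticePolytope A) = ⊤)
    (ν : (Fin n → ℤ) × ℤ →+ ℤ) (hν : ν ≠ 0) (h : ∀ p, 0 ≤ ν (coneInclusion A p)) :
    0 < ν (coneInclusion A (coneInterior A)) := by
  obtain ⟨a, ha⟩ := exists_coneGen_ne_zero A hfull ν hν
  rw [coneInterior, map_sum, map_sum]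
  exact Finset.sum_pos' (fun a _ => h _) ⟨a, Finset.mem_univ _, lt_of_le_of_ne (h _) ha.symm⟩

lemma coneDeg_coneInterior_pos (hA : A.Nonempty) : 0 < coneDeg A (coneInterior A) := by
  rw [coneInterior, map_sum]
  simp only [coneDeg_coneGen]
  simpa using hA

/-- Elimination describes the rational cone generated by `A` at height one. Saturation puts its
lattice points into `coneMonoid A`, and convexity gives the converse. -/
lemma exists_functionals_cone : ∃ F : Finset ((Fin n → ℤ) × ℤ →+ ℤ),
    ∀ x, (∀ ν ∈ F, 0 ≤ ν x) ↔ ∃ p, coneInclusion A p = x := by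
  obtain ⟨F₀, hF₀⟩ := exists_functionals_lattice (n := n)
  obtain ⟨F, hF⟩ := exists_cutsOut F₀ hF₀ (liftedVertices A)
  refine ⟨F, fun x => ⟨fun h => ?_, ?_⟩⟩
  · obtain ⟨N, hN, hx⟩ := (hF x).1 h
    exact exists_coneInclusion_eq_of_nsmul A hN hx
  · rintro ⟨p, rfl⟩ ν hν
    refine nonneg_of_mem_coneMonoid A ν (fun a => ?_) p
    exact (hF _).2 ⟨1, one_pos, by
      rw [one_nsmul]
      exact AddSubmonoid.subset_closure ((mem_liftedVertices A).2 ⟨a, rfl⟩)⟩ ν hν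

lemma exists_facetData_cone (hfull : affineSpan ℝ (latticePolytope A) = ⊤) :
    ∃ D : FacetData (coneMonoid A) ((Fin n → ℤ) × ℤ), D.incl = coneInclusion A ∧
      ∀ i, 0 < D.ν i (coneInclusion A (coneInterior A)) := by
  obtain ⟨F, hF⟩ := exists_functionals_cone A
  exact exists_facetData (coneInclusion A) (coneInclusion_injective A) F hF (coneInterior A)
    fun ν h hν => coneInterior_pos A hfull ν hν h

/-- The real cone contains no lattice points outside the rational cone generated by `A`: the
functionals which cut out the latter are nonnegative on the former. -/
lemma exists_nsmul_mem_closure (p : coneMonoid A) : ∃ N : ℕ, 0 < N ∧ N • coneInclusion A p ∈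
    AddSubmonoid.closure (liftedVertices A : Set ((Fin n → ℤ) × ℤ)) := by
  obtain ⟨F₀, hF₀⟩ := exists_functionals_lattice (n := n)
  obtain ⟨F, hF⟩ := exists_cutsOut F₀ hF₀ (liftedVertices A)
  refine (hF _).1 fun ν hν => nonneg_of_mem_coneMonoid A ν (fun a => ?_) p
  exact (hF _).2 ⟨1, one_pos, by
    rw [one_nsmul]
    exact AddSubmonoid.subset_closure ((mem_liftedVertices A).2 ⟨a, rfl⟩)⟩ ν hν

/-- Positive degree excludes the empty sum of generators. This is what shows that the sets `D₊(χ^a)`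
cover `Proj`. -/
lemma exists_nsmul_eq_coneGen_add (p : coneMonoid A) (hp : 0 < coneDeg A p) :
    ∃ (N : ℕ) (a : A) (r : coneMonoid A), N • p = coneGen A a + r := by
  obtain ⟨N, hN, h⟩ := exists_nsmul_mem_closure A p
  have key : ∀ y ∈ AddSubmonoid.closure (liftedVertices A : Set ((Fin n → ℤ) × ℤ)),
      y = 0 ∨ ∃ (a : A) (r : coneMonoid A), y = coneInclusion A (coneGen A a + r) := by
    intro y hy
    induction hy using AddSubmonoid.closure_induction with
    | mem y hy =>
      obtain ⟨a, rfl⟩ := (mem_liftedVertices A).1 hy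
      exact Or.inr ⟨a, 0, by rw [add_zero]⟩
    | zero => exact Or.inl rfl
    | add y z _ _ hy hz =>
      rcases hy with rfl | ⟨a, r, rfl⟩
      · rwa [zero_add]
      rcases hz with rfl | ⟨b, r', rfl⟩
      · exact Or.inr ⟨a, r, add_zero _⟩
      · exact Or.inr ⟨a, r + (coneGen A b + r'), by rw [← map_add, add_assoc]⟩
  rw [← map_nsmul] at h
  rcases key _ h with h | ⟨a, r, h⟩
  · have h1 : N • p = 0 := coneInclusion_injective A (h.trans (map_zero _).symm)
    have h2 := congrArg (coneDeg A) h1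
    rw [map_nsmul, map_zero, smul_eq_mul] at h2
    exact absurd h2 (Nat.mul_pos hN hp).ne'
  · exact ⟨N, a, r, coneInclusion_injective A h⟩

/-- The vertices and the lattice points of a bounded part of the cone generate the cone monoid. -/
lemma fg_coneMonoid : AddMonoid.FG (coneMonoid A) := by
  classical
  -- The box contains every combination of the generators with coefficients of absolute value at
  -- most one.
  let b : (Fin n → ℤ) × ℤ :=
    (fun i => ∑ g ∈ liftedVertices A, |g.1 i|, ∑ g ∈ liftedVertices A, |g.2|)
  have hfin : {p : coneMonoid A | coneInclusion A p ∈ Set.Icc (-b) b}.Finite :=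
    (Set.finite_Icc (-b) b).preimage (coneInclusion_injective A).injOn
  refine AddMonoid.fg_def.2 ((AddSubmonoid.fg_iff _).2 ⟨_, ?_,
    hfin.union (Set.finite_range (coneGen A))⟩)
  rw [eq_top_iff]
  intro p _
  obtain ⟨N, hN, hx⟩ := exists_nsmul_mem_closure A p
  have hN' : (0 : ℤ) < N := by exact_mod_cast hN
  obtain ⟨f, -, hf⟩ := AddSubmonoid.mem_closure_finset.1 hx
  -- As in Gordan's lemma, `y` is the part with integral coefficients; what remains has the
  -- coefficients `(f g % N) / N < 1`, hence lies in the box.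
  let y : (Fin n → ℤ) × ℤ := ∑ g ∈ liftedVertices A, (f g / N) • g
  have hNx : N • (coneInclusion A p - y) = ∑ g ∈ liftedVertices A, (f g % N) • g := by
    rw [nsmul_sub, ← hf, Finset.smul_sum, ← Finset.sum_sub_distrib]
    refine Finset.sum_congr rfl fun g _ => ?_
    rw [← mul_nsmul', sub_eq_iff_eq_add, ← add_nsmul, Nat.mod_add_div]
  have hmem : N • (coneInclusion A p - y) ∈
      AddSubmonoid.closure (liftedVertices A : Set ((Fin n → ℤ) × ℤ)) := by
    rw [hNx]
    exact sum_mem fun g hg => nsmul_mem (AddSubmonoid.subset_closure hg) _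
  obtain ⟨r, hr⟩ := exists_coneInclusion_eq_of_nsmul A hN hmem
  obtain ⟨s, hs, hs'⟩ : ∃ s ∈ AddSubmonoid.closure (Set.range (coneGen A)),
      coneInclusion A s = y := by
    have h1 : y ∈ (AddSubmonoid.closure (Set.range (coneGen A))).map (coneInclusion A) :=
      sum_mem fun g hg => by
        obtain ⟨a, rfl⟩ := (mem_liftedVertices A).1 hg
        exact nsmul_mem (AddSubmonoid.mem_map_of_mem (coneInclusion A)
          (AddSubmonoid.subset_closure (Set.mem_range_self a))) _
    exact h1
  have hps : p = r + s := coneInclusion_injective A (by rw [map_add, hr, hs', sub_add_cancel])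
  rw [hps]
  refine add_mem (AddSubmonoid.subset_closure (Or.inl ?_))
    (AddSubmonoid.closure_mono Set.subset_union_right hs)
  have habs : ∀ c : (Fin n → ℤ) × ℤ →+ ℤ,
      |c (coneInclusion A r)| ≤ ∑ g ∈ liftedVertices A, |c g| := fun c => by
    have h1 := congrArg c (hr ▸ hNx)
    rw [map_nsmul, map_sum, nsmul_eq_mul] at h1
    refine le_of_mul_le_mul_left ?_ hN'
    rw [← abs_of_pos hN', ← abs_mul, h1, abs_of_pos hN', Finset.mul_sum]
    refine (Finset.abs_sum_le_sum_abs _ _).trans (Finset.sum_le_sum fun g _ => ?_)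
    rw [map_nsmul, nsmul_eq_mul, abs_mul, Nat.abs_cast]
    exact mul_le_mul_of_nonneg_right (by exact_mod_cast (Nat.mod_lt _ hN).le) (abs_nonneg _)
  have h1 := fun i => abs_le.1 (habs ((Pi.evalAddMonoidHom (fun _ : Fin n => ℤ) i).comp
    (AddMonoidHom.fst _ _)))
  have h2 := abs_le.1 (habs (AddMonoidHom.snd _ _))
  exact ⟨⟨fun i => (h1 i).1, h2.1⟩, ⟨fun i => (h1 i).2, h2.2⟩⟩

/-- Saturation is read off from the functionals. For sharpness, a unit has height zero, and the only
point of the cone at height zero is the origin. -/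
lemma isFineSaturatedSharp_coneMonoid :
    IsFineSaturatedSharp (Multiplicative (coneMonoid A)) where
  fg := AddMonoid.fg_iff_mul_fg.1 (fg_coneMonoid A)
  cancel := inferInstance
  saturated a b c N hN h := by
    obtain ⟨F, hF⟩ := exists_functionals_cone A
    have h1 : N • coneInclusion A a.toAdd =
        N • coneInclusion A b.toAdd + coneInclusion A c.toAdd := by
      have := congrArg (fun z => coneInclusion A (Multiplicative.toAdd z)) h
      simpa using this
    obtain ⟨d, hd⟩ := (hF (coneInclusion A a.toAdd - coneInclusion A b.toAdd)).1 fun ν hν => by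
      have hN' : (0 : ℤ) < N := by exact_mod_cast hN
      have h2 := congrArg ν h1
      rw [map_nsmul, map_add, map_nsmul, nsmul_eq_mul, nsmul_eq_mul] at h2
      have h3 := (hF _).2 ⟨c.toAdd, rfl⟩ ν hν
      refine nonneg_of_mul_nonneg_right (?_ : 0 ≤ (N : ℤ) * _) hN'
      rw [map_sub, mul_sub, h2]
      linarith
    refine ⟨Multiplicative.ofAdd d, ?_⟩
    apply Multiplicative.toAdd.injective
    apply coneInclusion_injective A
    change _ = coneInclusion A (b.toAdd + d)
    rw [map_add, hd, add_sub_cancel]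
  sharp a ha := by
    obtain ⟨b, hb⟩ := ha.exists_right_inv
    have h1 : (a.toAdd : (Fin n → ℤ) × ℕ) + b.toAdd = 0 :=
      congrArg (fun z => ((Multiplicative.toAdd z : coneMonoid A) : (Fin n → ℤ) × ℕ)) hb
    have h2 : (a.toAdd : (Fin n → ℤ) × ℕ).2 = 0 := by
      have := congrArg Prod.snd h1
      rw [Prod.snd_add, Prod.snd_zero] at this
      omega
    apply Multiplicative.toAdd.injective
    apply Subtype.ext
    rcases a.toAdd.2 with h3 | ⟨q, -, h3⟩
    · exact h3
    · refine Prod.ext (funext fun i => ?_) h2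
      have := h3 i
      rw [h2, Nat.cast_zero, zero_mul] at this
      exact_mod_cast this

end Cone

lemma mem_basicOpen_appTop_iff {Y Z : Scheme.{u}} (g : Z ⟶ Y) (f : Γ(Y, ⊤)) (z : Z) :
    z ∈ Z.basicOpen (g.appTop.hom f) ↔ g z ∈ Y.basicOpen f := by
  rw [← Scheme.preimage_basicOpen_top]
  rfl

lemma mem_basicOpen_mul_iff {Y : Scheme.{u}} (f g : Γ(Y, ⊤)) (y : Y) :
    y ∈ Y.basicOpen (f * g) ↔ y ∈ Y.basicOpen f ∧ y ∈ Y.basicOpen g := by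
  rw [Scheme.basicOpen_mul]
  rfl

lemma mem_basicOpen_of_isUnit {Y : Scheme.{u}} {f : Γ(Y, ⊤)} (hf : IsUnit f) (y : Y) :
    y ∈ Y.basicOpen f := by
  rw [Scheme.basicOpen_of_isUnit Y hf]
  trivial

/-! ### The toric log structure of an affine toric variety -/

section AffineToric

variable (k : Type u) [Field k] {P L : Type} [AddCommMonoid P] [AddCommGroup L]

lemma resTop_toricChar {Y : Scheme.{u}} (c : Y ⟶ affineToric k P) (p : Multiplicative P) :
    resTop (toricChar k P) c p = pullFun c (AddMonoidAlgebra.single p.toAdd 1) := by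
  have h := pullFun_comp c (𝟙 (affineToric k P))
  rw [Category.comp_id] at h
  rw [h]
  rfl

lemma chartLog_toricChar_isInjective (D : FacetData P L) :
    (chartLog (toricChar k P)).IsInjective := by
  refine chartLog_isInjective _ fun V p p' v v' h x => ?_
  rw [resTop_toricChar, resTop_toricChar] at h
  obtain ⟨Z, i, _, a, b, ⟨y, hy⟩, ha, hb, hab, hv⟩ :=
    FacetData.exists_relation k D (str V) v v' h x
  let W : (affineToric k P).Etale := Scheme.Etale.mk (i ≫ str V)
  refine ⟨W, mkHom (V := W) i rfl, y, Multiplicative.ofAdd a, Multiplicative.ofAdd b, hy,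
    ?_, ?_, hab, ?_⟩
  · rw [resTop_toricChar]
    exact ha
  · rw [resTop_toricChar]
    exact hb
  · rw [resTop_toricChar, resTop_toricChar]
    exact hv

/-- As `q` is positive at every facet, some multiple of it is `p + r`; thus `χ^p` divides a power of
`χ^q`. -/
lemma single_notMem_of_interior (D : FacetData P L) (q p : P) (hq : ∀ i, 0 < D.val i q)
    (x : affineToric k P)
    (hx : (AddMonoidAlgebra.single q 1 : AddMonoidAlgebra k P) ∉ x.asIdeal) :
    (AddMonoidAlgebra.single p 1 : AddMonoidAlgebra k P) ∉ x.asIdeal := by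
  have := D.finite
  obtain ⟨N, hN⟩ := exists_nat_add_mul_nonneg (fun i => -D.val i p) (fun i => D.val i q)
    fun i => Or.inl (hq i)
  obtain ⟨r, hr⟩ := D.exists_add_eq (p := p) (q := N • q) fun i => by
    rw [D.val_nsmul]
    linarith [hN i]
  intro hp
  apply hx
  refine x.isPrime.mem_of_pow_mem N ?_
  rw [AddMonoidAlgebra.single_pow, one_pow, ← hr, ← mul_one (1 : k),
    ← AddMonoidAlgebra.single_mul_single]
  exact Ideal.mul_mem_right _ _ hp

/-- The toric log structure consists of the functions invertible on the torus `D(χ^q)`. One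
direction holds since all monomials are invertible there; the other is
`FacetData.exists_factorization`. -/
lemma mem_sectionFunctions_toricChar_iff (D : FacetData P L) [IsDomain (AddMonoidAlgebra k L)]
    [IsIntegrallyClosed (AddMonoidAlgebra k L)] (q : P) (hq : ∀ i, 0 < D.val i q)
    (V : (affineToric k P).Etale) (f : Γ(src V, ⊤)) :
    f ∈ (chartLog (toricChar k P)).sectionFunctions V ↔
      str V ⁻¹ᵁ specOpen (AddMonoidAlgebra.single q 1) ≤ (src V).basicOpen f := by
  constructor
  · intro hf x hx
    obtain ⟨W, g, y, p, v, rfl, e⟩ := exists_eq_mul_of_mem_sectionFunctions _ V f hf x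
    rw [← mem_basicOpen_appTop_iff, e, mem_basicOpen_mul_iff]
    refine ⟨?_, mem_basicOpen_of_isUnit v.isUnit y⟩
    rw [resTop_toricChar, basicOpen_pullFun]
    have e2 : str W y = str V (srcMap g y) := by
      rw [← Scheme.Hom.comp_apply, srcMap_str]
    refine single_notMem_of_interior k D q _ hq _ ?_
    rw [e2]
    exact hx
  · intro hf
    refine (chartLog_toricChar_isInjective k D).mem_of_locally_mem f fun x => ?_
    obtain ⟨Z, i, _, p, v, ⟨y, hy⟩, e⟩ := FacetData.exists_factorization k D (str V) f q hf x
    let W : (affineToric k P).Etale := Scheme.Etale.mk (i ≫ str V)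
    refine ⟨W, mkHom (V := W) i rfl, y, hy, ?_⟩
    have h := mul_mem_sectionFunctions_chartLog (toricChar k P) W (Multiplicative.ofAdd p) v
    rw [resTop_toricChar] at h
    exact (congrArg (· ∈ _) e).mpr h

end AffineToric

/-! ### Functions invertible over an open subscheme -/

section Compactifying

variable {X T : Scheme.{u}} (j : T ⟶ X)

/-- Points with the same image lift to the fibre product, so invertibility of the pullback depends
only on the range of `j`. -/
lemma mem_compactifyingSubmonoid_iff {V : X.Etale} (f : Γ(src V, ⊤)) :
    f ∈ compactifyingSubmonoid j V ↔
      ∀ v : src V, str V v ∈ Set.range j → v ∈ (src V).basicOpen f := by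
  rw [mem_compactifyingSubmonoid, isUnit_iff_basicOpen, eq_top_iff]
  constructor
  · rintro h v ⟨t, ht⟩
    obtain ⟨z, hz, -⟩ := Scheme.Pullback.exists_preimage_pullback (f := str V) (g := j) v t ht.symm
    rw [← hz, ← mem_basicOpen_appTop_iff]
    exact h trivial
  · intro h z _
    rw [mem_basicOpen_appTop_iff]
    refine h _ ⟨pullback.snd (str V) j z, ?_⟩
    rw [← Scheme.Hom.comp_apply, ← Scheme.Hom.comp_apply, pullback.condition]

lemma compactifyingLog_isInjective : (compactifyingLog j).IsInjective :=
  fun _ _ _ h => Subtype.ext h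

lemma mem_sectionFunctions_compactifyingLog_iff {V : X.Etale} (f : Γ(src V, ⊤)) :
    f ∈ (compactifyingLog j).sectionFunctions V ↔
      ∀ v : src V, str V v ∈ Set.range j → v ∈ (src V).basicOpen f := by
  rw [← mem_compactifyingSubmonoid_iff]
  exact ⟨fun ⟨m, hm⟩ => hm ▸ m.2, fun h => ⟨⟨f, h⟩, rfl⟩⟩

end Compactifying

/-! ### Functions of a descended log structure -/

section Descent

variable {X U W A B : Scheme.{u}} {P P' : Type} [CommMonoid P] [CommMonoid P']
  {π : U ⟶ X} {q : W ⟶ X} (ι : U ⟶ A) [Etale ι] (κ : W ⟶ B) [Etale κ]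
  (c : W ⟶ U) (hc : c ≫ π = q) (f : B ⟶ A) (hf : c ≫ ι = κ ≫ f)
  (d : W ⟶ U) (hd : d ≫ π = q) (g : B ⟶ A) (hg : d ≫ ι = κ ≫ g)
  {γ : P →* Γ(A, ⊤)} {γ' : P' →* Γ(B, ⊤)} (h : P →* P') (eh : γ'.comp h = resTop γ f)
  (k : P →* P') (ek : γ'.comp k = resTop γ g)

lemma descentLog_isInjective (hγ : (chartLog γ).IsInjective) :
    (descentLog ι κ c hc f hf d hd g hg h eh k ek).IsInjective := by
  rintro V ⟨⟨t, m⟩, h1, h2⟩ ⟨⟨t', m'⟩, h3, h4⟩ e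
  have e : t = t' := e
  subst e
  exact Subtype.ext (Prod.ext rfl (hγ _ (h1.trans h3.symm)))

lemma overMap_fst_appTop {c : W ⟶ U} (hc : c ≫ π = q) (V : X.Etale) (t : Γ(src V, ⊤)) :
    (overMap c hc V).appTop.hom ((pullback.fst (str V) π).appTop.hom t) =
      (pullback.fst (str V) q).appTop.hom t := by
  have e := Scheme.Hom.comp_appTop (overMap c hc V) (pullback.fst (str V) π)
  unfold overMap at e ⊢
  rw [pullback.lift_fst] at e
  exact ConcreteCategory.congr_hom e.symm t

/-- The two pullbacks of `m` to `V ×_X W` have the same underlying function, the pullback of `t`.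
Injectivity on `B` identifies them, so the descent condition is automatic. -/
lemma mem_sectionFunctions_descentLog_iff (hγ' : (chartLog γ').IsInjective) {V : X.Etale}
    (t : Γ(src V, ⊤)) :
    t ∈ (descentLog ι κ c hc f hf d hd g hg h eh k ek).sectionFunctions V ↔
      (pullback.fst (str V) π).appTop.hom t ∈
        (chartLog γ).sectionFunctions ((liftEtale π ι).obj V) := by
  constructor
  · rintro ⟨⟨⟨t', m⟩, h1, h2⟩, rfl⟩
    exact ⟨m, h1⟩
  · rintro ⟨m, hm⟩
    refine ⟨⟨(t, m), hm, hγ' _ ?_⟩, rfl⟩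
    refine (α_descentPull ι κ c hc f hf h eh V m).trans (Eq.trans ?_
      (α_descentPull ι κ d hd g hg k ek V m).symm)
    refine (congrArg _ hm).trans (Eq.trans ?_ (congrArg _ hm).symm)
    exact (overMap_fst_appTop hc V t).trans (overMap_fst_appTop hd V t).symm

end Descent

/-! ### Points of `Proj` and basic open sets -/

section ProjPoints

variable {R : Type u} [CommRing R] {σ : Type*} [SetLike σ R] [AddSubgroupClass σ R]
  (𝒜 : ℕ → σ) [GradedRing 𝒜]

/-- In `Spec (R_t)_0` the trace of `D₊(s)` is the locus where `s^d / t^c` is invertible, and this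
fraction pulls back to `f s ^ d` up to a unit. -/
lemma mem_basicOpen_projOfUnit_iff {Z : Scheme.{u}} (f : R →+* Γ(Z, ⊤)) {t : R} {d : ℕ}
    (ht : t ∈ 𝒜 d) (hd : 0 < d) (hu : IsUnit (f t)) {s : R} {c : ℕ} (hs : s ∈ 𝒜 c) (hc : 0 < c)
    (z : Z) : projOfUnit 𝒜 f ht hd hu z ∈ Proj.basicOpen 𝒜 s ↔ z ∈ Z.basicOpen (f s) := by
  let x := HomogeneousLocalization.Away.isLocalizationElem ht hs
  have h1 : awayLift 𝒜 f hu x * f t ^ c = f (s ^ d) := awayLift_mk 𝒜 f hu ht c _ _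
  have h2 : z ∈ Z.basicOpen (awayLift 𝒜 f hu x) ↔ z ∈ Z.basicOpen (f s) := by
    have h3 : z ∈ Z.basicOpen (f (s ^ d)) ↔ z ∈ Z.basicOpen (f s) := by
      rw [map_pow, Scheme.basicOpen_pow _ _ hd]
    rw [← h3, ← h1, mem_basicOpen_mul_iff]
    exact (and_iff_left (mem_basicOpen_of_isUnit (hu.pow c) z)).symm
  rw [← h2, ← Scheme.toSpecΓ_preimage_basicOpen]
  have h4 := Proj.awayι_preimage_basicOpen 𝒜 ht hd hs hc
  change (Spec.map (CommRingCat.ofHom (awayLift 𝒜 f hu)) (Z.toSpecΓ z)) ∈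
    Proj.awayι 𝒜 t ht hd ⁻¹ᵁ Proj.basicOpen 𝒜 s ↔ _
  rw [h4]
  rfl

lemma toProj_mem_basicOpen_iff (y : punctured 𝒜) {s : R} {c : ℕ} (hs : s ∈ 𝒜 c) (hc : 0 < c) :
    toProj 𝒜 y ∈ Proj.basicOpen 𝒜 s ↔ s ∉ y.1.asIdeal := by
  obtain ⟨d, t, hd, ht, h⟩ := exists_of_mem_punctured 𝒜 y.2
  let i : PosElt 𝒜 := ⟨(d, t), hd, ht⟩
  have h1 := comp_toProj 𝒜 (puncturedOpen 𝒜 i).ι ht hd (isUnit_puncturedOpen 𝒜 i)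
  have h2 : toProj 𝒜 y = ((puncturedOpen 𝒜 i).ι ≫ toProj 𝒜) ⟨y, h⟩ := rfl
  rw [h2, h1]
  refine (mem_basicOpen_projOfUnit_iff 𝒜 _ ht hd _ hs hc _).trans ?_
  rw [basicOpen_pullFun]
  rfl

end ProjPoints

/-! ### The torus orbit of an affine toric variety -/

section Torus

variable (k : Type u) [Field k] {P L : Type} [AddCommMonoid P] [AddCommGroup L]

lemma exists_single_mul_eq (D : FacetData P L) (q : P) (hq : ∀ i, 0 < D.val i q)
    (z : AddMonoidAlgebra k L) : ∃ (N : ℕ) (x : AddMonoidAlgebra k P),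
      z * AddMonoidAlgebra.mapDomainRingHom k D.incl (AddMonoidAlgebra.single q 1 ^ N) =
        AddMonoidAlgebra.mapDomainRingHom k D.incl x := by
  have := D.finite
  rw [← AddMonoidAlgebra.sum_coeff_single z]
  refine Finset.sum_induction _ (fun z => ∃ (N : ℕ) (x : AddMonoidAlgebra k P),
      z * AddMonoidAlgebra.mapDomainRingHom k D.incl (AddMonoidAlgebra.single q 1 ^ N) =
        AddMonoidAlgebra.mapDomainRingHom k D.incl x) ?_ ⟨0, 0, by simp⟩ fun m _ => ?_
  · rintro a b ⟨N, x, hx⟩ ⟨M, y, hy⟩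
    refine ⟨N + M, x * AddMonoidAlgebra.single q 1 ^ M + y * AddMonoidAlgebra.single q 1 ^ N, ?_⟩
    rw [map_add, map_mul _ x, map_mul _ y, ← hx, ← hy, pow_add, map_mul]
    ring
  · obtain ⟨N, hN⟩ := exists_nat_add_mul_nonneg (fun i => D.ν i m) (fun i => D.val i q)
      fun i => Or.inl (hq i)
    obtain ⟨p, hp⟩ := D.exists_of_nonneg (m + N • D.incl q) fun i => by
      rw [map_add, map_nsmul, nsmul_eq_mul]
      exact hN i
    refine ⟨N, AddMonoidAlgebra.single p (z.coeff m), ?_⟩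
    rw [AddMonoidAlgebra.single_pow, one_pow]
    change _ * AddMonoidAlgebra.mapDomain _ _ = AddMonoidAlgebra.mapDomain _ _
    rw [AddMonoidAlgebra.mapDomain_single, AddMonoidAlgebra.mapDomain_single,
      AddMonoidAlgebra.single_mul_single, mul_one, map_nsmul, hp]

/-- Every lattice point enters `P` after adding a multiple of the interior point `q`, so `k[L]` is
the localization of `k[P]` at `χ^q`. -/
lemma exists_toricMap_eq (D : FacetData P L) (q : P) (hq : ∀ i, 0 < D.val i q)
    (x : affineToric k P)
    (hx : (AddMonoidAlgebra.single q 1 : AddMonoidAlgebra k P) ∉ x.asIdeal) :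
    ∃ z, toricMap k D.incl z = x := by
  let φ := AddMonoidAlgebra.mapDomainRingHom k D.incl
  let _ : Algebra (AddMonoidAlgebra k P) (AddMonoidAlgebra k L) := φ.toAlgebra
  have hinj : Function.Injective φ := AddMonoidAlgebra.mapDomain_injective D.incl_injective
  have hloc : IsLocalization.Away (AddMonoidAlgebra.single q 1 : AddMonoidAlgebra k P)
      (AddMonoidAlgebra k L) := by
    refine (isLocalization_iff _ _).2 ⟨?_, fun z => ?_, fun {a b} h => ⟨1, ?_⟩⟩
    · rintro ⟨_, N, rfl⟩
      refine (?_ : IsUnit (φ _))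
      rw [map_pow]
      refine IsUnit.pow _ (IsUnit.of_mul_eq_one (AddMonoidAlgebra.single (-D.incl q) 1) ?_)
      change AddMonoidAlgebra.mapDomain _ _ * _ = _
      rw [AddMonoidAlgebra.mapDomain_single, AddMonoidAlgebra.single_mul_single, add_neg_cancel,
        mul_one]
      rfl
    · obtain ⟨N, x, h⟩ := exists_single_mul_eq k D q hq z
      exact ⟨(x, ⟨_, N, rfl⟩), h⟩
    · rw [hinj h]
  have h := PrimeSpectrum.localization_away_comap_range (AddMonoidAlgebra k L)
    (AddMonoidAlgebra.single q 1 : AddMonoidAlgebra k P)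
  have h1 : x ∈ Set.range (PrimeSpectrum.comap (algebraMap (AddMonoidAlgebra k P)
    (AddMonoidAlgebra k L))) := h ▸ hx
  exact h1

end Torus

/-! ### Comparison of the two log structures -/

section ConeGeometry

variable {n : ℕ} {A : Finset (Fin n → ℤ)} (k : Type u) [Field k]

lemma single_mem_coneGrading (p : coneMonoid A) (c : k) :
    AddMonoidAlgebra.single p c ∈ coneGrading A k (coneDeg A p) :=
  AddMonoidAlgebra.single_mem_gradeBy _ _ _

/-- The inclusion of the torus in the complement of the irrelevant locus. -/
noncomputable def torusLift (hA : A.Nonempty) :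
    affineToric k (Fin n → ℤ) ⟶ (coneOpen A k).toScheme :=
  IsOpenImmersion.lift (coneOpen A k).ι (toricMap k (coneToLattice A)) (torus_mapsTo k hA)

lemma torusLift_ι (hA : A.Nonempty) :
    torusLift k hA ≫ (coneOpen A k).ι = toricMap k (coneToLattice A) :=
  IsOpenImmersion.lift_fac _ _ _

lemma isUnit_single {M : Type} [AddCommGroup M] (m : M) :
    IsUnit (AddMonoidAlgebra.single m 1 : AddMonoidAlgebra k M) := by
  refine IsUnit.of_mul_eq_one (AddMonoidAlgebra.single (-m) 1) ?_
  rw [AddMonoidAlgebra.single_mul_single, add_neg_cancel, mul_one]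
  rfl

lemma pullFun_toricMap_single {M N : Type} [AddCommMonoid M] [AddCommMonoid N] (f : M →+ N)
    {Z : Scheme.{u}} (c : Z ⟶ affineToric k N) (m : M) (a : k) :
    pullFun (c ≫ toricMap k f) (AddMonoidAlgebra.single m a) =
      pullFun c (AddMonoidAlgebra.single (f m) a) := by
  rw [pullFun_toricMap]
  congr 1
  exact AddMonoidAlgebra.mapDomain_single

lemma single_notMem_of_torus (hA : A.Nonempty) (p : coneMonoid A)
    (z : affineToric k (Fin n → ℤ)) :
    (AddMonoidAlgebra.single p 1 : coneAlg A k) ∉ (torusLift k hA z).1.asIdeal := by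
  have h := (isUnit_pullFun_iff (torusLift k hA ≫ (coneOpen A k).ι)
    (AddMonoidAlgebra.single p 1 : coneAlg A k)).1 (by
      rw [torusLift_ι, ← Category.id_comp (toricMap k (coneToLattice A)), pullFun_toricMap_single]
      exact (isUnit_single k _).map _) z
  exact h

lemma toricMap_coneInclusion_mapsTo (hA : A.Nonempty) :
    Set.range (toricMap k (coneInclusion A)) ⊆ Set.range (coneOpen A k).ι := by
  rintro _ ⟨w, rfl⟩
  rw [Scheme.Opens.range_ι]
  obtain ⟨p, hp⟩ := exists_degree_one hA
  refine mem_punctured _ (d := 1) (t := AddMonoidAlgebra.single p 1) one_pos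
    (hp ▸ single_mem_coneGrading k p 1) ?_
  refine (isUnit_pullFun_iff (𝟙 _ ≫ toricMap k (coneInclusion A)) _).1 ?_ w
  rw [pullFun_toricMap_single]
  exact (isUnit_single k _).map _

/-- The projection to `X` of a point of the open torus orbit of the affine cone. -/
lemma lift_coneProj_eq (hA : A.Nonempty) (c : affineToric k ((Fin n → ℤ) × ℤ) ⟶
    (coneOpen A k).toScheme) (hc : c ≫ (coneOpen A k).ι = toricMap k (coneInclusion A)) :
    c ≫ coneProj A k = toricMap k (AddMonoidHom.inl (Fin n → ℤ) ℤ) ≫ torusIncl k hA := by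
  obtain ⟨p, hp⟩ := exists_degree_one hA
  let pr := toricMap k (AddMonoidHom.inl (Fin n → ℤ) ℤ)
  -- The two maps to `U` differ by the action of the last coordinate of the torus: in degree `d` by
  -- its `d`-th power. Hence they agree in `Proj`, by `projOfUnit_scale`.
  have hs : ∀ (d : ℕ) (x : coneAlg A k), x ∈ coneGrading A k d →
      pullFun (c ≫ (coneOpen A k).ι) x = pullFun ((pr ≫ torusLift k hA) ≫ (coneOpen A k).ι) x *
        pullFun (𝟙 (affineToric k ((Fin n → ℤ) × ℤ))) (AddMonoidAlgebra.single (0, 1) 1) ^ d := by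
    intro d x hx
    have h4 : x = ∑ m ∈ x.coeff.support, AddMonoidAlgebra.single m (x.coeff m) :=
      (AddMonoidAlgebra.sum_coeff_single x).symm
    rw [h4, map_sum, map_sum, Finset.sum_mul]
    refine Finset.sum_congr rfl fun m hm => ?_
    have h2 : coneDeg A m = d := hx m hm
    rw [hc, Category.assoc, torusLift_ι, ← Category.id_comp (toricMap k (coneInclusion A)),
      pullFun_toricMap_single, pullFun_toricMap_single, ← Category.id_comp pr,
      pullFun_toricMap_single, ← map_pow, ← map_mul, AddMonoidAlgebra.single_pow,
      AddMonoidAlgebra.single_mul_single, one_pow, mul_one]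
    congr 2
    refine Prod.ext ?_ ?_
    · change m.1.1 = m.1.1 + d • (0 : Fin n → ℤ)
      rw [smul_zero, add_zero]
    · change ((coneDeg A m : ℕ) : ℤ) = 0 + d • (1 : ℤ)
      rw [h2]
      simp
  have hmem : (AddMonoidAlgebra.single p 1 : coneAlg A k) ∈ coneGrading A k 1 :=
    hp ▸ single_mem_coneGrading k p 1
  have u1 : IsUnit (pullFun (c ≫ (coneOpen A k).ι)
      (AddMonoidAlgebra.single p 1 : coneAlg A k)) := by
    rw [hc, ← Category.id_comp (toricMap k (coneInclusion A)), pullFun_toricMap_single]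
    exact (isUnit_single k _).map _
  have u2 : IsUnit (pullFun ((pr ≫ torusLift k hA) ≫ (coneOpen A k).ι)
      (AddMonoidAlgebra.single p 1 : coneAlg A k)) := by
    rw [Category.assoc, torusLift_ι, pullFun_toricMap_single]
    exact (isUnit_single k _).map _
  have h1 : pr ≫ torusIncl k hA = (pr ≫ torusLift k hA) ≫ coneProj A k :=
    (Category.assoc _ _ _).symm
  refine Eq.trans ?_ h1.symm
  rw [comp_toProj _ _ hmem one_pos u1, comp_toProj _ _ hmem one_pos u2]
  exact (projOfUnit_scale _ _ _ _ hs hmem one_pos u2 u1).symm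

/-- The preimage of `T` in `U` is the open orbit. A point over `T` lies over `D₊(χ^q)` because the
lift of the torus to `U` does; conversely, a point of `D(χ^q)` comes from `Spec k[ℤⁿ × ℤ]`, whose
map to `X` factors through `T`. -/
lemma coneProj_mem_range_torusIncl_iff (hA : A.Nonempty)
    (D : FacetData (coneMonoid A) ((Fin n → ℤ) × ℤ)) (hD : D.incl = coneInclusion A)
    (hq : ∀ i, 0 < D.val i (coneInterior A)) (y : coneOpen A k) :
    coneProj A k y ∈ Set.range (torusIncl k hA) ↔
      (AddMonoidAlgebra.single (coneInterior A) 1 : coneAlg A k) ∉ y.1.asIdeal := by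
  have hdeg := coneDeg_coneInterior_pos A hA
  have hmem := single_mem_coneGrading k (coneInterior A) 1
  constructor
  · rintro ⟨z, hz⟩
    have hz : coneProj A k (torusLift k hA z) = coneProj A k y := hz
    rw [← toProj_mem_basicOpen_iff _ y hmem hdeg, ← hz]
    refine (toProj_mem_basicOpen_iff _ _ hmem hdeg).2 ?_
    exact single_notMem_of_torus k hA _ z
  · intro h
    obtain ⟨z, hz⟩ := exists_toricMap_eq k D _ hq y.1 h
    rw [hD] at hz
    let c := IsOpenImmersion.lift (coneOpen A k).ι (toricMap k (coneInclusion A))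
      (toricMap_coneInclusion_mapsTo k hA)
    have hc : c ≫ (coneOpen A k).ι = toricMap k (coneInclusion A) :=
      IsOpenImmersion.lift_fac _ _ _
    have hcz : c z = y := by
      apply (coneOpen A k).ι.isOpenEmbedding.injective
      rw [← Scheme.Hom.comp_apply, hc]
      exact hz
    refine ⟨toricMap k (AddMonoidHom.inl (Fin n → ℤ) ℤ) z, ?_⟩
    rw [← hcz, ← Scheme.Hom.comp_apply, ← Scheme.Hom.comp_apply, lift_coneProj_eq k hA c hc]

instance : IsIntegrallyClosed (AddMonoidAlgebra k ((Fin n → ℤ) × ℤ)) :=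
  isIntegrallyClosed_addMonoidAlgebra_lattice k n

/-- `D.prodInt` supplies the injectivity of the log structure on `𝔾ₘ × Spec k[P]`. -/
lemma mem_sectionFunctions_descendedLog_iff (D : FacetData (coneMonoid A) ((Fin n → ℤ) × ℤ))
    (V : (toricVariety A k).Etale) (t : Γ(src V, ⊤)) :
    t ∈ (descendedLog A k).sectionFunctions V ↔
      (pullback.fst (str V) (coneProj A k)).appTop.hom t ∈
        (chartLog (toricChar k (coneMonoid A))).sectionFunctions
          ((liftEtale (coneProj A k) (coneOpen A k).ι).obj V) :=
  mem_sectionFunctions_descentLog_iff _ _ _ _ _ _ _ _ _ _ _ _ _ _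
    (chartLog_toricChar_isInjective k D.prodInt) t

/-- Both sides express invertibility over the torus, upstairs on `V ×_X U` and downstairs on `V`.
They agree because every point of `T` lifts to `U`, and `D(χ^q)` is the preimage of `T`. -/
lemma sectionFunctions_descendedLog (hA : A.Nonempty)
    (hfull : affineSpan ℝ (latticePolytope A) = ⊤) (V : (toricVariety A k).Etale) :
    (descendedLog A k).sectionFunctions V = (standardLog k hA).sectionFunctions V := by
  obtain ⟨D, hD, hq⟩ := exists_facetData_cone A hfull
  have hq' : ∀ i, 0 < D.val i (coneInterior A) := fun i => by
    rw [FacetData.val, hD]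
    exact hq i
  ext t
  refine (mem_sectionFunctions_descendedLog_iff k D V t).trans ?_
  refine (mem_sectionFunctions_toricChar_iff k D _ hq'
    ((liftEtale (coneProj A k) (coneOpen A k).ι).obj V) _).trans ?_
  refine Iff.trans ?_ (mem_sectionFunctions_compactifyingLog_iff _ t).symm
  constructor
  · rintro h v ⟨z, hz⟩
    have hz : coneProj A k (torusLift k hA z) = str V v := hz
    obtain ⟨w, hw1, hw2⟩ := Scheme.Pullback.exists_preimage_pullback (f := str V)
      (g := coneProj A k) v (torusLift k hA z) hz.symm
    rw [← hw1, ← mem_basicOpen_appTop_iff]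
    refine h ?_
    change (AddMonoidAlgebra.single (coneInterior A) 1 : coneAlg A k) ∉
      (pullback.snd (str V) (coneProj A k) w).1.asIdeal
    rw [hw2]
    exact single_notMem_of_torus k hA _ z
  · intro h w hw
    refine (mem_basicOpen_appTop_iff (pullback.fst (str V) (coneProj A k)) t w).2 (h _ ?_)
    have e : str V (pullback.fst (str V) (coneProj A k) w) =
        coneProj A k (pullback.snd (str V) (coneProj A k) w) :=
      congrArg (fun f : pullback (str V) (coneProj A k) ⟶ toricVariety A k => f w)
        pullback.condition
    rw [e]
    exact (coneProj_mem_range_torusIncl_iff k hA D hD hq' _).2 hw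

theorem exists_unique_isIso_descendedLog (hA : A.Nonempty)
    (hfull : affineSpan ℝ (latticePolytope A) = ⊤) :
    ∃ ψ : descendedLog A k ⟶ standardLog k hA,
      (∀ ψ' : descendedLog A k ⟶ standardLog k hA, ψ' = ψ) ∧ IsIso ψ := by
  obtain ⟨D, -, -⟩ := exists_facetData_cone A hfull
  have h1 : (descendedLog A k).IsInjective :=
    descentLog_isInjective _ _ _ _ _ _ _ _ _ _ _ _ _ _ (chartLog_toricChar_isInjective k D)
  have h2 : (standardLog k hA).IsInjective := compactifyingLog_isInjective _
  obtain ⟨ψ, hψ⟩ := h1.exists_isIso h2 (sectionFunctions_descendedLog k hA hfull)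
  exact ⟨ψ, fun ψ' => h2.hom_ext _ _, hψ⟩

end ConeGeometry

lemma appTop_comp_apply {Y Z W : Scheme.{u}} (g : Y ⟶ Z) (f : Z ⟶ W) (x : Γ(W, ⊤)) :
    (g ≫ f).appTop.hom x = g.appTop.hom (f.appTop.hom x) := by
  rw [Scheme.Hom.comp_appTop]
  rfl

/-! ### Charts and the characteristic sheaf in the injective case -/

namespace LogStructure

variable {X : Scheme.{u}} {L : LogStructure X}

lemma IsInjective.associated (hL : L.IsInjective) {V : X.Etale} (x y : L.M.obj (op V))
    (f a b : Γ(src V, ⊤)) (hf : IsUnit f) (ha : (L.α.app (op V)).hom x = a)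
    (hb : (L.α.app (op V)).hom y = b) (h : a * f = b) : Associated x y := by
  obtain ⟨g, hg⟩ := hf.exists_right_inv
  obtain ⟨m, hm, -⟩ := L.existsUnique_of_isUnit V f hf
  obtain ⟨m', hm', -⟩ := L.existsUnique_of_isUnit V g (IsUnit.of_mul_eq_one _ (mul_comm f g ▸ hg))
  have h1 : m * m' = 1 := hL V (by
    rw [map_mul, map_one, hm, hm']
    exact hg)
  refine ⟨⟨m, m', h1, (mul_comm _ _).trans h1⟩, hL V ?_⟩
  change (L.α.app (op V)).hom (x * m) = _
  rw [map_mul, hm, ha, hb]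
  exact h

lemma toCharacteristic_map (L : LogStructure X) {V W : X.Etale} (g : W ⟶ V)
    (m : L.M.obj (op V)) : (L.characteristic.map g.op).hom (L.toCharacteristic V m) =
      L.toCharacteristic W ((L.M.map g.op).hom m) :=
  (ConcreteCategory.congr_hom ((toSheafify X.smallEtaleTopology L.preChar).naturality g.op)
    (Associates.mk m)).symm

lemma toCharacteristic_eq_of_associated (L : LogStructure X) {V : X.Etale}
    {x y : L.M.obj (op V)} (h : Associated x y) :
    L.toCharacteristic V x = L.toCharacteristic V y :=
  congrArg ((toSheafify X.smallEtaleTopology L.preChar).app (op V)).hom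
    (Associates.mk_eq_mk_iff_associated.2 h)

/-- The functions of the chart belong to `L` automatically, since they are locally products of some
`β p` and a unit. Only the opposite inclusion has to be supplied. -/
lemma IsInjective.isChart (hL : L.IsInjective) (V : X.Etale) {P : Type} [CommMonoid P]
    (β : P →* L.M.obj (op V))
    (h : (chartLog (X := src V) ((L.α.app (op V)).hom.comp β)).IsInjective)
    (h' : ∀ W, (L.restrict (str V)).sectionFunctions W ⊆
      (chartLog (X := src V) ((L.α.app (op V)).hom.comp β)).sectionFunctions W) :
    L.IsChart V β := by
  have hr : (L.restrict (str V)).IsInjective := hL.restrict (str V)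
  have hβ : ∀ (W : (src V).Etale) (p : P),
      ((L.restrict (str V)).α.app (op W)).hom
        ((L.M.map (mkHom (V := (etaleMap (str V)).obj W) (W := V) (str W) rfl).op).hom (β p)) =
      resTop (X := src V) ((L.α.app (op V)).hom.comp β) (str W) p := fun W p =>
    L.α_map (mkHom (V := (etaleMap (str V)).obj W) (W := V) (str W) rfl) (β p)
  obtain ⟨e, he⟩ := h.exists_isIso hr fun W => by
    refine Set.Subset.antisymm (fun f hf => hr.mem_of_locally_mem f fun x => ?_) (h' W)
    obtain ⟨W', g, y, p, v, hy, e⟩ := exists_eq_mul_of_mem_sectionFunctions _ W f hf x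
    obtain ⟨m, hm, -⟩ := (L.restrict (str V)).existsUnique_of_isUnit W' v v.isUnit
    let m' : (L.restrict (str V)).M.obj (op W') := (L.M.map
      (mkHom (V := (etaleMap (str V)).obj W') (W := V) (str W') rfl).op).hom (β p)
    refine ⟨W', g, y, hy, m' * m, ?_⟩
    refine (map_mul ((L.restrict (str V)).α.app (op W')).hom m' m).trans ?_
    rw [hm, e]
    exact congrArg (· * (v : Γ(src W', ⊤))) (hβ W' p)
  refine ⟨e, he, fun W p => hr W ?_⟩
  refine (hom_apply e W _).trans (Eq.trans ?_ (hβ W p).symm)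
  have h1 := chartι_apply_α (X := src V) ((L.α.app (op V)).hom.comp β) W p 1
  rw [Units.val_one, mul_one] at h1
  exact h1

/-- A homomorphism to the global sections of the characteristic sheaf is given by local sections
of the log structure which agree up to units. -/
lemma IsInjective.exists_characteristic_hom (hL : L.IsInjective) {P : Type} [CommMonoid P]
    {ι : Type} (V : ι → X.Etale) (hV : ∀ x : X, ∃ i, x ∈ Set.range (str (V i)))
    (β : ∀ i, P →* L.M.obj (op (V i)))
    (hβ : ∀ (i j : ι) (Z : X.Etale) (g : Z ⟶ V i) (g' : Z ⟶ V j) (p : P),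
      ∃ f : Γ(src Z, ⊤), IsUnit f ∧
        ((srcMap g).appTop.hom ((L.α.app (op (V i))).hom (β i p)) : Γ(src Z, ⊤)) * f =
        (srcMap g').appTop.hom ((L.α.app (op (V j))).hom (β j p))) :
    ∃ ρ : P →* L.characteristic.obj (op (Scheme.Etale.mk (𝟙 X))), ∀ i p,
      L.toCharacteristic (V i) (β i p) =
        (L.characteristic.map (mkHom (W := Scheme.Etale.mk (𝟙 X)) (str (V i))
          (Category.comp_id _)).op).hom (ρ p) := by
  -- The homomorphisms are glued as a whole: `V ↦ Hom(E, M̄(V))`, for `M̄` the characteristic sheaf,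
  -- is a sheaf of sets. `ULift` only adjusts the universe.
  let E : CommMonCat.{u} := .of (ULift.{u} P)
  let F : X.Etaleᵒᵖ ⥤ Type u := L.characteristic ⋙ coyoneda.obj (op E)
  let φ : ∀ i, V i ⟶ Scheme.Etale.mk (𝟙 X) := fun i =>
    mkHom (W := Scheme.Etale.mk (𝟙 X)) (str (V i)) (Category.comp_id _)
  have hmem : Sieve.generate (Presieve.ofArrows V φ) ∈
      X.smallEtaleTopology (Scheme.Etale.mk (𝟙 X)) := by
    rw [mem_smallEtale_iff]
    intro x
    obtain ⟨i, y, hy⟩ := hV x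
    exact ⟨V i, φ i, y, Sieve.ofArrows_mk V φ i, hy⟩
  have hsh : Presieve.IsSheafFor F (Presieve.ofArrows V φ) := by
    rw [Presieve.isSheafFor_iff_generate]
    exact ((presheafToSheaf X.smallEtaleTopology CommMonCat.{u}).obj L.preChar).property E _ hmem
  rw [Presieve.isSheafFor_arrows_iff] at hsh
  obtain ⟨t, ht, -⟩ := hsh (fun i => CommMonCat.ofHom
    ((L.toCharacteristic (V i)).comp ((β i).comp MulEquiv.ulift.toMonoidHom))) (by
      intro i j Z g g' _
      refine CommMonCat.hom_ext (MonoidHom.ext fun p => ?_)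
      refine (L.toCharacteristic_map g (β i p.down)).trans (Eq.trans ?_
        (L.toCharacteristic_map g' (β j p.down)).symm)
      obtain ⟨f, hf, h⟩ := hβ i j Z g g' p.down
      refine L.toCharacteristic_eq_of_associated (hL.associated _ _ f _ _ hf (α_map _ _ _)
        (α_map _ _ _) h))
  refine ⟨t.hom.comp MulEquiv.ulift.symm.toMonoidHom, fun i p => ?_⟩
  exact (ConcreteCategory.congr_hom (ht i) (ULift.up p)).symm

end LogStructure

/-! ### Transfer of log structures along a retract -/

section Retract

variable {B Y : Scheme.{u}} {P : Type} [CommMonoid P] (γ : P →* Γ(B, ⊤)) (c : Y ⟶ B)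

/-- Near `s x` the function `r^* f` is a monomial times a unit; restricting this along `s` gives
back `f`, since `s ≫ r` is the identity. -/
lemma mem_sectionFunctions_of_retract (hY : (chartLog (resTop γ c)).IsInjective) (V : Y.Etale)
    (W : B.Etale) (s : src V ⟶ src W) (r : src W ⟶ src V) (hs : s ≫ r = 𝟙 _)
    (hc : s ≫ str W = str V ≫ c) (f : Γ(src V, ⊤))
    (hf : r.appTop.hom f ∈ (chartLog γ).sectionFunctions W) :
    f ∈ (chartLog (resTop γ c)).sectionFunctions V := by
  refine hY.mem_of_locally_mem f fun x => ?_
  obtain ⟨W', g, y, p, v, hy, e⟩ := exists_eq_mul_of_mem_sectionFunctions γ W _ hf (s x)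
  let i := pullback.fst s (srcMap g)
  let j := pullback.snd s (srcMap g)
  have hij : i ≫ s = j ≫ srcMap g := pullback.condition
  obtain ⟨z, hz, -⟩ := Scheme.Pullback.exists_preimage_pullback (f := s) (g := srcMap g) x y hy.symm
  let V' : Y.Etale := Scheme.Etale.mk (i ≫ str V)
  refine ⟨V', mkHom (V := V') i rfl, z, hz, ?_⟩
  have h1 := mul_mem_sectionFunctions_chartLog (resTop γ c) V' p (Units.map
    (j.appTop.hom : Γ(src W', ⊤) →* Γ(pullback s (srcMap g), ⊤)) v)
  have h2 : j ≫ str W' = (i ≫ str V) ≫ c := by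
    rw [Category.assoc, ← hc, ← Category.assoc, hij, Category.assoc, srcMap_str]
  have h3 : resTop (resTop γ c) (str V') p = j.appTop.hom (resTop γ (str W') p) := by
    rw [resTop_resTop]
    exact (DFunLike.congr_fun (congrArg (resTop γ) h2) p).symm.trans
      (DFunLike.congr_fun (resTop_resTop γ (str W') j) p).symm
  have h4 : i.appTop.hom f = j.appTop.hom ((srcMap g).appTop.hom (r.appTop.hom f)) := by
    rw [← appTop_comp_apply, ← appTop_comp_apply, ← hij, Category.assoc, hs,
      Category.comp_id]
  rw [e, map_mul, ← h3] at h4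
  exact (congrArg (· ∈ _) h4).mpr h1

/-- A relation over `V` is pulled back by `r` to a relation over `W`, at the cost of the units `e`.
It is resolved there by injectivity and restricted along `s`, where the units `e` become `1`. -/
lemma chartLog_isInjective_of_retract (hγ : (chartLog γ).IsInjective)
    (H : ∀ V : Y.Etale, ∃ (W : B.Etale) (s : src V ⟶ src W) (r : src W ⟶ src V)
      (e : P → Γ(src W, ⊤)ˣ), s ≫ r = 𝟙 _ ∧ s ≫ str W = str V ≫ c ∧
        (∀ p, r.appTop.hom (resTop (resTop γ c) (str V) p) * e p = resTop γ (str W) p) ∧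
        ∀ p, s.appTop.hom (e p) = 1) : (chartLog (resTop γ c)).IsInjective := by
  refine chartLog_isInjective _ fun V p p' v v' h x => ?_
  obtain ⟨W, s, r, e, hs, hc, he, he'⟩ := H V
  have hu : ∀ (q : P) (w : Γ(src V, ⊤)ˣ), resTop γ (str W) q *
      ((e q)⁻¹ * Units.map (r.appTop.hom : Γ(src V, ⊤) →* Γ(src W, ⊤)) w : Γ(src W, ⊤)ˣ) =
      r.appTop.hom (resTop (resTop γ c) (str V) q * w) := fun q w => by
    rw [← he, Units.val_mul, mul_assoc, Units.mul_inv_cancel_left, map_mul]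
    rfl
  obtain ⟨W', g, y, a, b, hy, ha, hb, hab, hv⟩ :=
    exists_relation_of_chartLog_isInjective γ hγ W p p' _ _
      ((hu p v).trans ((congrArg _ h).trans (hu p' v').symm)) (s x)
  let i := pullback.fst s (srcMap g)
  let j := pullback.snd s (srcMap g)
  have hij : i ≫ s = j ≫ srcMap g := pullback.condition
  obtain ⟨z, hz, -⟩ := Scheme.Pullback.exists_preimage_pullback (f := s) (g := srcMap g) x y hy.symm
  let V' : Y.Etale := Scheme.Etale.mk (i ≫ str V)
  have h2 : j ≫ str W' = (i ≫ str V) ≫ c := by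
    rw [Category.assoc, ← hc, ← Category.assoc, hij, Category.assoc, srcMap_str]
  have h3 : ∀ q, resTop (resTop γ c) (str V') q = j.appTop.hom (resTop γ (str W') q) := fun q => by
    rw [resTop_resTop]
    exact (DFunLike.congr_fun (congrArg (resTop γ) h2) q).symm.trans
      (DFunLike.congr_fun (resTop_resTop γ (str W') j) q).symm
  have h4 : ∀ (q : P) (w : Γ(src V, ⊤)ˣ), j.appTop.hom ((srcMap g).appTop.hom
      ((e q)⁻¹ * Units.map (r.appTop.hom : Γ(src V, ⊤) →* Γ(src W, ⊤)) w : Γ(src W, ⊤)ˣ)) =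
      i.appTop.hom (w : Γ(src V, ⊤)) := fun q w => by
    rw [← appTop_comp_apply, ← hij, appTop_comp_apply, Units.val_mul, map_mul]
    have h5 : s.appTop.hom ((e q)⁻¹ : Γ(src W, ⊤)ˣ) = 1 := by
      have h6 := congrArg s.appTop.hom (e q).inv_mul
      rwa [map_mul, he', mul_one, map_one] at h6
    rw [h5, one_mul]
    congr 1
    change s.appTop.hom (r.appTop.hom (w : Γ(src V, ⊤))) = _
    rw [← appTop_comp_apply, hs]
    rfl
  refine ⟨V', mkHom (V := V') i rfl, z, a, b, hz, ?_, ?_, hab, ?_⟩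
  · rw [h3]
    exact ha.map j.appTop.hom
  · rw [h3]
    exact hb.map j.appTop.hom
  · have h5 := congrArg j.appTop.hom hv
    rw [map_mul, map_mul, h4, h4, ← h3, ← h3] at h5
    exact h5

end Retract

open HomogeneousLocalization

lemma pullFun_toSpecΓ_SpecMap {R : Type u} [CommRing R] {W : Scheme.{u}}
    (φ : CommRingCat.of R ⟶ Γ(W, ⊤)) (x : R) :
    pullFun (W.toSpecΓ ≫ Spec.map φ) x = φ.hom x := by
  rw [pullFun_comp]
  change W.toSpecΓ.appTop.hom (pullFun (Spec.map φ) x) = _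
  rw [pullFun_SpecMap, Scheme.toSpecΓ_appTop]
  exact ConcreteCategory.congr_hom (Scheme.ΓSpecIso Γ(W, ⊤)).inv_hom_id (φ.hom x)

/-! ### Dehomogenization at an element of `A` -/

section Dehomogenization

variable {n : ℕ} {A : Finset (Fin n → ℤ)} (k : Type u) [Field k]

/-- The monomial of a vertex. -/
noncomputable abbrev vertexChar (a : A) : coneAlg A k := AddMonoidAlgebra.single (coneGen A a) 1

lemma vertexChar_mem (a : A) : vertexChar k a ∈ coneGrading A k 1 :=
  single_mem_coneGrading k (coneGen A a) 1

lemma mem_coneGrading_smul_one {d : ℕ} {x : coneAlg A k} (hx : x ∈ coneGrading A k d) :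
    x ∈ coneGrading A k (d • 1) := by
  rwa [smul_eq_mul, mul_one]

lemma val_mk_mul_pow (a : A) {d : ℕ} {x : coneAlg A k} (hx : x ∈ coneGrading A k d) :
    (Away.mk (coneGrading A k) (vertexChar_mem k a) d x (mem_coneGrading_smul_one k hx)).val *
      algebraMap (coneAlg A k) (Localization.Away (vertexChar k a)) (vertexChar k a) ^ d =
        algebraMap (coneAlg A k) (Localization.Away (vertexChar k a)) x := by
  rw [Away.val_mk, ← map_pow, Localization.mk_eq_mk']
  exact IsLocalization.mk'_spec (Localization.Away (vertexChar k a)) x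
    (⟨vertexChar k a ^ d, d, rfl⟩ : Submonoid.powers (vertexChar k a))

lemma isUnit_algebraMap_vertexChar (a : A) :
    IsUnit (algebraMap (coneAlg A k) (Localization.Away (vertexChar k a)) (vertexChar k a)) :=
  IsLocalization.Away.algebraMap_isUnit (vertexChar k a)

/-- The degree-zero fractions embed in the full localization, where `χ^a` is a unit; so equalities
may be tested after clearing denominators. -/
lemma away_ext (a : A) (d : ℕ) {y z : Away (coneGrading A k) (vertexChar k a)}
    (h : y.val * algebraMap (coneAlg A k) (Localization.Away (vertexChar k a))
        (vertexChar k a) ^ d = z.val * algebraMap (coneAlg A k)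
        (Localization.Away (vertexChar k a)) (vertexChar k a) ^ d) : y = z :=
  val_injective _ (((isUnit_algebraMap_vertexChar k a).pow d).mul_right_cancel h)

/-- The homomorphism `p ↦ χ^p / (χ^a)^{deg p}`. -/
noncomputable def dehomChar (a : A) :
    Multiplicative (coneMonoid A) →* Away (coneGrading A k) (vertexChar k a) where
  toFun p := Away.mk (coneGrading A k) (vertexChar_mem k a) (coneDeg A p.toAdd)
    (AddMonoidAlgebra.single p.toAdd 1) (mem_coneGrading_smul_one k (single_mem_coneGrading k _ 1))
  map_one' := by
    apply away_ext k a (coneDeg A 0)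
    refine (val_mk_mul_pow k a (single_mem_coneGrading k 0 1)).trans ?_
    rw [map_zero, pow_zero, mul_one, val_one]
    exact map_one _
  map_mul' p q := by
    apply away_ext k a (coneDeg A (p.toAdd + q.toAdd))
    refine (val_mk_mul_pow k a (single_mem_coneGrading k (p.toAdd + q.toAdd) 1)).trans ?_
    rw [map_add, pow_add, val_mul, mul_mul_mul_comm]
    refine Eq.trans ?_ (congrArg₂ (· * ·) (val_mk_mul_pow k a (single_mem_coneGrading k p.toAdd 1))
      (val_mk_mul_pow k a (single_mem_coneGrading k q.toAdd 1))).symm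
    rw [← map_mul, AddMonoidAlgebra.single_mul_single, mul_one]

/-- Dehomogenization with respect to the monomial of a vertex. -/
noncomputable def dehom (a : A) : coneAlg A k →+* Away (coneGrading A k) (vertexChar k a) :=
  AddMonoidAlgebra.liftNCRingHom
    ((fromZeroRingHom (coneGrading A k) (Submonoid.powers (vertexChar k a))).comp
      (algebraMap k (coneGrading A k 0))) (dehomChar k a) fun _ _ => Commute.all _ _

lemma val_dehom_mul_pow (a : A) (d : ℕ) (x : coneAlg A k) (hx : x ∈ coneGrading A k d) :
    (dehom k a x).val *
      algebraMap (coneAlg A k) (Localization.Away (vertexChar k a)) (vertexChar k a) ^ d =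
        algebraMap (coneAlg A k) (Localization.Away (vertexChar k a)) x := by
  let T := algebraMap (coneAlg A k) (Localization.Away (vertexChar k a)) (vertexChar k a) ^ d
  let v : Away (coneGrading A k) (vertexChar k a) →+* Localization.Away (vertexChar k a) :=
    algebraMap _ _
  have hv : ∀ y, v y = y.val := fun y => rfl
  have h4 : x = ∑ m ∈ x.coeff.support, AddMonoidAlgebra.single m (x.coeff m) :=
    (AddMonoidAlgebra.sum_coeff_single x).symm
  rw [← hv, h4, map_sum, map_sum, map_sum, Finset.sum_mul]
  refine Finset.sum_congr rfl fun m hm => ?_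
  have h2 : coneDeg A m = d := hx m hm
  subst h2
  rw [dehom, AddMonoidAlgebra.liftNCRingHom_single, map_mul, mul_assoc, hv (dehomChar k a _)]
  have h3 := val_mk_mul_pow k a (single_mem_coneGrading k m 1)
  refine (congrArg _ h3).trans ?_
  have h5 : v ((fromZeroRingHom (coneGrading A k) (Submonoid.powers (vertexChar k a)))
      (algebraMap k (coneGrading A k 0) (x.coeff m))) =
      algebraMap (coneAlg A k) (Localization.Away (vertexChar k a))
        (AddMonoidAlgebra.single 0 (x.coeff m)) := by
    rw [hv]
    exact Localization.mk_one_eq_algebraMap _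
  refine (congrArg (· * _) h5).trans ?_
  rw [← map_mul, AddMonoidAlgebra.single_mul_single, zero_add, mul_one]

lemma dehom_eq_mk (a : A) (d : ℕ) (x : coneAlg A k) (hx : x ∈ coneGrading A k (d • 1)) :
    dehom k a x = Away.mk (coneGrading A k) (vertexChar_mem k a) d x hx := by
  have hx' : x ∈ coneGrading A k d := by rwa [smul_eq_mul, mul_one] at hx
  exact away_ext k a d ((val_dehom_mul_pow k a d x hx').trans (val_mk_mul_pow k a hx').symm)

lemma dehom_vertexChar (a : A) : dehom k a (vertexChar k a) = 1 := by
  apply away_ext k a 1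
  rw [val_dehom_mul_pow k a 1 _ (vertexChar_mem k a), pow_one, val_one, one_mul]

lemma awayLift_dehom (a : A) {S : Type u} [CommRing S] (f : coneAlg A k →+* S)
    (hu : IsUnit (f (vertexChar k a))) (d : ℕ) (x : coneAlg A k) (hx : x ∈ coneGrading A k d) :
    awayLift (coneGrading A k) f hu (dehom k a x) * f (vertexChar k a) ^ d = f x := by
  rw [dehom_eq_mk k a d x (mem_coneGrading_smul_one k hx)]
  exact awayLift_mk _ f hu _ d x _

/-- The morphism to the affine cone which corresponds to dehomogenization. -/
noncomputable def dehomMap (a : A) :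
    Spec (.of (Away (coneGrading A k) (vertexChar k a))) ⟶ affineToric k (coneMonoid A) :=
  Spec.map (CommRingCat.ofHom (dehom k a))

/-- The affine chart of the toric variety given by a vertex. -/
noncomputable abbrev vertexι (a : A) :
    Spec (.of (Away (coneGrading A k) (vertexChar k a))) ⟶ toricVariety A k :=
  Proj.awayι (coneGrading A k) (vertexChar k a) (vertexChar_mem k a) one_pos

lemma pullFun_dehomMap_vertexChar (a : A) : pullFun (dehomMap k a) (vertexChar k a) = 1 := by
  rw [dehomMap, pullFun_SpecMap]
  change (Scheme.ΓSpecIso (.of (Away (coneGrading A k) (vertexChar k a)))).inv.hom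
    (dehom k a (vertexChar k a)) = 1
  rw [dehom_vertexChar, map_one]

/-- Dehomogenization sets `χ^a = 1`, which lands in `U` and does not alter fractions of degree zero.
It is therefore a section of `U ⟶ X` over `D₊(χ^a)`. -/
lemma exists_section_coneProj (a : A) :
    ∃ σ : Spec (.of (Away (coneGrading A k) (vertexChar k a))) ⟶ (coneOpen A k).toScheme,
      σ ≫ (coneOpen A k).ι = dehomMap k a ∧ σ ≫ coneProj A k = vertexι k a := by
  have hu : IsUnit (pullFun (dehomMap k a) (vertexChar k a)) :=
    (pullFun_dehomMap_vertexChar k a).symm ▸ isUnit_one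
  have hr : Set.range (dehomMap k a) ⊆ Set.range (coneOpen A k).ι := by
    rintro _ ⟨z, rfl⟩
    rw [Scheme.Opens.range_ι]
    exact mem_punctured _ one_pos (vertexChar_mem k a) ((isUnit_pullFun_iff _ _).1 hu z)
  let σ := IsOpenImmersion.lift (coneOpen A k).ι (dehomMap k a) hr
  have hσ : σ ≫ (coneOpen A k).ι = dehomMap k a := IsOpenImmersion.lift_fac _ _ _
  refine ⟨σ, hσ, ?_⟩
  have hu' : IsUnit (pullFun (σ ≫ (coneOpen A k).ι) (vertexChar k a)) := hσ.symm ▸ hu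
  -- Each degree-zero fraction is the dehomogenization of its numerator, so the induced ring map is
  -- the canonical one.
  have h1 : CommRingCat.ofHom (awayLift (coneGrading A k) (pullFun (σ ≫ (coneOpen A k).ι)) hu') =
      (Scheme.ΓSpecIso (.of (Away (coneGrading A k) (vertexChar k a)))).inv := by
    refine CommRingCat.hom_ext (RingHom.ext fun z => ?_)
    obtain ⟨d, x, hx, rfl⟩ := Away.mk_surjective (coneGrading A k) (vertexChar_mem k a) z
    rw [← dehom_eq_mk]
    refine (hu'.pow d).mul_right_cancel ?_
    refine (awayLift_dehom k a _ hu' d x (by rwa [smul_eq_mul, mul_one] at hx)).trans ?_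
    rw [hσ, pullFun_dehomMap_vertexChar, one_pow, mul_one, dehomMap, pullFun_SpecMap]
    rfl
  rw [comp_toProj _ σ (vertexChar_mem k a) one_pos hu', projOfUnit, h1, ← SpecMap_ΓSpecIso_hom,
    ← Category.assoc, ← Spec.map_comp, Iso.inv_hom_id, Spec.map_id, Category.id_comp]

/-- A lift to `U` of a point of the chart is governed by the value of `χ^a` alone: each monomial is
its dehomogenization times the power of `χ^a` given by its degree. -/
lemma pullFun_dehomMap_mul_pow (a : A) {W : Scheme.{u}} (w : W ⟶ (coneOpen A k).toScheme)
    (r : W ⟶ Spec (.of (Away (coneGrading A k) (vertexChar k a))))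
    (h : w ≫ coneProj A k = r ≫ vertexι k a) :
    IsUnit (pullFun (w ≫ (coneOpen A k).ι) (vertexChar k a)) ∧
      ∀ p : coneMonoid A, pullFun (r ≫ dehomMap k a) (AddMonoidAlgebra.single p 1) *
        pullFun (w ≫ (coneOpen A k).ι) (vertexChar k a) ^ coneDeg A p =
          pullFun (w ≫ (coneOpen A k).ι) (AddMonoidAlgebra.single p 1) := by
  have hu : IsUnit (pullFun (w ≫ (coneOpen A k).ι) (vertexChar k a)) := by
    rw [isUnit_pullFun_iff]
    intro z
    refine (toProj_mem_basicOpen_iff (coneGrading A k) (w z) (vertexChar_mem k a) one_pos).1 ?_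
    rw [← Proj.opensRange_awayι (coneGrading A k) _ (vertexChar_mem k a) one_pos]
    refine ⟨r z, ?_⟩
    exact congrArg (fun f : W ⟶ toricVariety A k => f z) h.symm
  refine ⟨hu, fun p => ?_⟩
  rw [comp_toProj _ w (vertexChar_mem k a) one_pos hu, projOfUnit, ← Category.assoc,
    cancel_mono] at h
  have h1 : pullFun (r ≫ dehomMap k a) (AddMonoidAlgebra.single p 1 : coneAlg A k) =
      awayLift (coneGrading A k) (pullFun (w ≫ (coneOpen A k).ι)) hu
        (dehom k a (AddMonoidAlgebra.single p 1)) := by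
    rw [← h, dehomMap, Category.assoc, ← Spec.map_comp, pullFun_toSpecΓ_SpecMap]
    rfl
  rw [h1]
  exact awayLift_dehom k a _ hu _ _ (single_mem_coneGrading k p 1)

/-- A multiple of any point of positive degree is divisible by some `coneGen A a`. A homogeneous
prime containing all `χ^a` would thus contain the irrelevant ideal. -/
lemma exists_mem_range_vertexι (x : toricVariety A k) : ∃ a : A, x ∈ Set.range (vertexι k a) := by
  classical
  by_contra! H
  have h1 : ∀ a : A, vertexChar k a ∈ x.asHomogeneousIdeal := fun a => by
    by_contra h
    refine H a ?_
    have h2 : x ∈ (vertexι k a).opensRange := by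
      rw [Proj.opensRange_awayι]
      exact h
    exact h2
  refine x.not_irrelevant_le fun f hf => ?_
  have hf : GradedRing.proj (coneGrading A k) 0 f = 0 :=
    (HomogeneousIdeal.mem_irrelevant_iff _ f).1 hf
  change f ∈ x.asHomogeneousIdeal.toIdeal
  rw [← DirectSum.sum_support_decompose (coneGrading A k) f]
  refine Ideal.sum_mem _ fun d hd => FacetData.mem_of_forall_single _ _ fun p hp => ?_
  have hd0 : 0 < d := by
    refine Nat.pos_of_ne_zero ?_
    rintro rfl
    rw [DFinsupp.mem_support_toFun] at hd
    exact hd (Subtype.ext hf)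
  have hdeg : coneDeg A p = d := (DirectSum.decompose (coneGrading A k) f d).2 p
    (Finsupp.mem_support_iff.2 hp)
  obtain ⟨N, a, r, h⟩ := exists_nsmul_eq_coneGen_add A p (hdeg ▸ hd0)
  refine x.isPrime.mem_of_pow_mem N ?_
  rw [AddMonoidAlgebra.single_pow, one_pow, h, ← mul_one (1 : k),
    ← AddMonoidAlgebra.single_mul_single]
  exact Ideal.mul_mem_right _ _ (h1 a)

end Dehomogenization

/-! ### Charts of the standard log structure -/

section VertexCharts

variable {n : ℕ} {A : Finset (Fin n → ℤ)} (k : Type u) [Field k]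

/-- The affine chart of a vertex as an étale scheme over the toric variety. -/
noncomputable abbrev vertexChart (a : A) : (toricVariety A k).Etale :=
  Scheme.Etale.mk (vertexι k a)

/-- The functions `χ^p / (χ^a)^{deg p}` on the affine chart of the vertex `a`. -/
noncomputable abbrev vertexFun (a : A) : Multiplicative (coneMonoid A) →*
    Γ(Spec (.of (Away (coneGrading A k) (vertexChar k a))), ⊤) :=
  resTop (toricChar k (coneMonoid A)) (dehomMap k a)

lemma appTop_vertexFun (a : A) {W : Scheme.{u}}
    (r : W ⟶ Spec (.of (Away (coneGrading A k) (vertexChar k a))))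
    (p : Multiplicative (coneMonoid A)) : r.appTop.hom (vertexFun k a p) =
      pullFun (r ≫ dehomMap k a) (AddMonoidAlgebra.single p.toAdd 1 : coneAlg A k) := by
  rw [← resTop_toricChar, ← resTop_resTop]
  rfl

/-- The function is the restriction of `χ^p` along the section `σ`, which sends points over `T` into
the open orbit, where all monomials are invertible. -/
lemma vertexFun_mem (hA : A.Nonempty) (hfull : affineSpan ℝ (latticePolytope A) = ⊤) (a : A)
    (p : Multiplicative (coneMonoid A)) :
    vertexFun k a p ∈ compactifyingSubmonoid (torusIncl k hA) (vertexChart k a) := by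
  obtain ⟨D, hD, hq⟩ := exists_facetData_cone A hfull
  have hq' : ∀ i, 0 < D.val i (coneInterior A) := fun i => by
    rw [FacetData.val, hD]
    exact hq i
  obtain ⟨σ, hσ, hσ'⟩ := exists_section_coneProj k a
  refine (mem_compactifyingSubmonoid_iff (torusIncl k hA) (V := vertexChart k a) _).2
    fun v hv => ?_
  have h1 : coneProj A k (σ v) ∈ Set.range (torusIncl k hA) := by
    have h2 : coneProj A k (σ v) = vertexι k a v := by rw [← hσ']; rfl
    rw [h2]
    exact hv
  have h3 := single_notMem_of_interior k D _ p.toAdd hq' _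
    ((coneProj_mem_range_torusIncl_iff k hA D hD hq' _).1 h1)
  rw [vertexFun, resTop_toricChar]
  refine (basicOpen_pullFun (dehomMap k a) _).symm ▸ ?_
  change _ ∉ (dehomMap k a v).asIdeal
  rw [← hσ]
  exact h3

/-- The chart of the standard log structure on the affine chart of a vertex. -/
noncomputable def vertexHom (hA : A.Nonempty) (hfull : affineSpan ℝ (latticePolytope A) = ⊤)
    (a : A) : Multiplicative (coneMonoid A) →* (standardLog k hA).M.obj (op (vertexChart k a)) :=
  (vertexFun k a).codRestrict (compactifyingSubmonoid (torusIncl k hA) (vertexChart k a))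
    (vertexFun_mem k hA hfull a)

/-- The étale scheme over the affine cone which is the base change along `U ⟶ X` of an étale scheme
over the affine chart of a vertex. -/
noncomputable abbrev vertexLift (a : A)
    (V : (Spec (.of (Away (coneGrading A k) (vertexChar k a)))).Etale) :
    (affineToric k (coneMonoid A)).Etale :=
  (liftEtale (coneProj A k) (coneOpen A k).ι).obj ((etaleMap (vertexι k a)).obj V)

lemma resTop_vertexFun_mul (a : A) {Y Q : Scheme.{u}}
    (v : Y ⟶ Spec (.of (Away (coneGrading A k) (vertexChar k a)))) (r : Q ⟶ Y)
    (w : Q ⟶ (coneOpen A k).toScheme)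
    (hK : ∀ p : coneMonoid A, pullFun ((r ≫ v) ≫ dehomMap k a) (AddMonoidAlgebra.single p 1) *
      pullFun (w ≫ (coneOpen A k).ι) (vertexChar k a) ^ coneDeg A p =
        pullFun (w ≫ (coneOpen A k).ι) (AddMonoidAlgebra.single p 1))
    (p : Multiplicative (coneMonoid A)) :
    r.appTop.hom (resTop (vertexFun k a) v p) *
      pullFun (w ≫ (coneOpen A k).ι) (vertexChar k a) ^ coneDeg A p.toAdd =
        resTop (toricChar k (coneMonoid A)) (w ≫ (coneOpen A k).ι) p := by
  have h1 : r.appTop.hom (resTop (vertexFun k a) v p) =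
      pullFun ((r ≫ v) ≫ dehomMap k a) (AddMonoidAlgebra.single p.toAdd 1 : coneAlg A k) := by
    rw [← appTop_vertexFun, appTop_comp_apply]
    rfl
  rw [resTop_toricChar, ← hK p.toAdd, h1]

lemma appTop_pullFun_vertexChar (a : A) {Y Q : Scheme.{u}}
    (v : Y ⟶ Spec (.of (Away (coneGrading A k) (vertexChar k a)))) (s : Y ⟶ Q)
    (w : Q ⟶ affineToric k (coneMonoid A)) (hs : s ≫ w = v ≫ dehomMap k a) :
    s.appTop.hom (pullFun w (vertexChar k a)) = 1 := by
  have h1 : s.appTop.hom (pullFun w (vertexChar k a)) =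
      pullFun (v ≫ dehomMap k a) (vertexChar k a) := by
    rw [← hs, pullFun_comp s]
    rfl
  rw [h1, pullFun_comp]
  change v.appTop.hom (pullFun (dehomMap k a) (vertexChar k a)) = 1
  rw [pullFun_dehomMap_vertexChar, map_one]

/-- The section `σ` makes `Y` a retract of its base change to `U`. The units `e` are powers of
`χ^a`, which is `1` along the section. -/
lemma exists_pullback_section (a : A) {Y : Scheme.{u}}
    (v : Y ⟶ Spec (.of (Away (coneGrading A k) (vertexChar k a)))) :
    ∃ (s : Y ⟶ pullback (v ≫ vertexι k a) (coneProj A k))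
      (e : coneMonoid A → Γ(pullback (v ≫ vertexι k a) (coneProj A k), ⊤)ˣ),
      s ≫ pullback.fst (v ≫ vertexι k a) (coneProj A k) = 𝟙 _ ∧
      s ≫ pullback.snd (v ≫ vertexι k a) (coneProj A k) ≫ (coneOpen A k).ι = v ≫ dehomMap k a ∧
      (∀ p, (pullback.fst (v ≫ vertexι k a) (coneProj A k)).appTop.hom
        (resTop (vertexFun k a) v p) * e p.toAdd = resTop (toricChar k (coneMonoid A))
          (pullback.snd (v ≫ vertexι k a) (coneProj A k) ≫ (coneOpen A k).ι) p) ∧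
      ∀ p, s.appTop.hom (e p) = 1 := by
  obtain ⟨σ, hσ, hσ'⟩ := exists_section_coneProj k a
  have hcomm : 𝟙 Y ≫ v ≫ vertexι k a = (v ≫ σ) ≫ coneProj A k := by
    rw [Category.id_comp, Category.assoc, hσ']
  obtain ⟨hu, hK⟩ := pullFun_dehomMap_mul_pow k a
    (pullback.snd (v ≫ vertexι k a) (coneProj A k))
    (pullback.fst (v ≫ vertexι k a) (coneProj A k) ≫ v)
    (pullback.condition.symm.trans (Category.assoc _ _ _).symm)
  have hs : pullback.lift _ _ hcomm ≫ pullback.snd (v ≫ vertexι k a) (coneProj A k) ≫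
      (coneOpen A k).ι = v ≫ dehomMap k a := by
    rw [pullback.lift_snd_assoc, Category.assoc, hσ]
  refine ⟨pullback.lift _ _ hcomm, fun p => hu.unit ^ coneDeg A p, pullback.lift_fst _ _ _, hs,
    fun p => ?_, fun p => ?_⟩
  · rw [Units.val_pow_eq_pow_val, IsUnit.unit_spec]
    exact resTop_vertexFun_mul k a v _ _ hK p
  · rw [Units.val_pow_eq_pow_val, IsUnit.unit_spec, map_pow,
      appTop_pullFun_vertexChar k a v _ _ hs, one_pow]

lemma chartLog_vertexFun_isInjective (hfull : affineSpan ℝ (latticePolytope A) = ⊤) (a : A) :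
    (chartLog (vertexFun k a)).IsInjective := by
  obtain ⟨D, -, -⟩ := exists_facetData_cone A hfull
  refine chartLog_isInjective_of_retract _ _ (chartLog_toricChar_isInjective k D) fun V => ?_
  obtain ⟨s, e, hs, hs', he, he'⟩ := exists_pullback_section k a (str V)
  exact ⟨vertexLift k a V, s, pullback.fst (str V ≫ vertexι k a) (coneProj A k),
    fun p => e p.toAdd, hs, hs', he, fun p => he' p.toAdd⟩

/-- A function of the standard log structure is one of the descended log structure, hence toric on
the base change to `U`; the retraction brings this back to the chart. -/
lemma sectionFunctions_restrict_subset (hA : A.Nonempty)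
    (hfull : affineSpan ℝ (latticePolytope A) = ⊤) (a : A)
    (V : (Spec (.of (Away (coneGrading A k) (vertexChar k a)))).Etale) :
    ((standardLog k hA).restrict (vertexι k a)).sectionFunctions V ⊆
      (chartLog (vertexFun k a)).sectionFunctions V := by
  intro f hf
  obtain ⟨D, -, -⟩ := exists_facetData_cone A hfull
  have h1 : f ∈ (standardLog k hA).sectionFunctions ((etaleMap (vertexι k a)).obj V) := hf
  rw [← sectionFunctions_descendedLog k hA hfull] at h1
  have h2 := (mem_sectionFunctions_descendedLog_iff k D
    ((etaleMap (vertexι k a)).obj V) f).1 h1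
  obtain ⟨s, -, hs, hs', -⟩ := exists_pullback_section k a (str V)
  exact mem_sectionFunctions_of_retract (toricChar k (coneMonoid A)) (dehomMap k a)
    (chartLog_vertexFun_isInjective k hfull a) V (vertexLift k a V) s
    (pullback.fst (str V ≫ vertexι k a) (coneProj A k)) hs hs' f h2

lemma isChart_vertexHom (hA : A.Nonempty) (hfull : affineSpan ℝ (latticePolytope A) = ⊤)
    (a : A) : (standardLog k hA).IsChart (vertexChart k a) (vertexHom k hA hfull a) :=
  LogStructure.IsInjective.isChart (compactifyingLog_isInjective _) (vertexChart k a)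
    (vertexHom k hA hfull a) (chartLog_vertexFun_isInjective k hfull a)
    (sectionFunctions_restrict_subset k hA hfull a)

theorem isGeneralizedDeligneFaltings_standardLog (hA : A.Nonempty)
    (hfull : affineSpan ℝ (latticePolytope A) = ⊤) :
    (standardLog k hA).IsGeneralizedDeligneFaltings := by
  have hinj : (standardLog k hA).IsInjective := compactifyingLog_isInjective _
  obtain ⟨ρ, hρ⟩ := hinj.exists_characteristic_hom (vertexChart k)
    (exists_mem_range_vertexι k) (vertexHom k hA hfull) fun a b Z g g' p => by
      obtain ⟨σ, hσ, hσ'⟩ := exists_section_coneProj k b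
      let r : src Z ⟶ Spec (.of (Away (coneGrading A k) (vertexChar k a))) := srcMap g
      let r' : src Z ⟶ Spec (.of (Away (coneGrading A k) (vertexChar k b))) := srcMap g'
      have e : (r' ≫ σ) ≫ coneProj A k = r ≫ vertexι k a := by
        rw [Category.assoc, hσ']
        exact (srcMap_str g').trans (srcMap_str g).symm
      obtain ⟨hu, hK⟩ := pullFun_dehomMap_mul_pow k a _ _ e
      -- The value of `χ^a` on the section for `b` is `χ^a / χ^b`; its power of exponent `deg p` is
      -- the unit relating the two charts.
      refine ⟨_, hu.pow (coneDeg A p.toAdd), ?_⟩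
      refine (congrArg (· * _) (appTop_vertexFun k a r p)).trans ((hK p.toAdd).trans ?_)
      rw [Category.assoc, hσ]
      exact (appTop_vertexFun k b r' p).symm
  refine ⟨_, _, isFineSaturatedSharp_coneMonoid A, ρ, fun x => ?_⟩
  obtain ⟨a, ha⟩ := exists_mem_range_vertexι k x
  exact ⟨vertexChart k a, ha, vertexHom k hA hfull a, isChart_vertexHom k hA hfull a, hρ a⟩

end VertexCharts

end LogToric

theorem mainTheorem8 (k : Type u) [Field k] [IsAlgClosed k] [CharZero k] (n : ℕ)
    (A : Finset (Fin n → ℤ)) (hA : A.Nonempty)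
    (hfull : affineSpan ℝ (LogToric.latticePolytope A) = ⊤) :
    (∃ ψ : LogToric.descendedLog A k ⟶ LogToric.standardLog k hA,
      (∀ ψ' : LogToric.descendedLog A k ⟶ LogToric.standardLog k hA, ψ' = ψ) ∧ IsIso ψ) ∧
    (LogToric.standardLog k hA).IsGeneralizedDeligneFaltings :=
  ⟨LogToric.exists_unique_isIso_descendedLog k hA hfull,
    LogToric.isGeneralizedDeligneFaltings_standardLog k hA hfull⟩
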